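/- Let $1<p<D-3$ and $V=\mathbb R^D$. Let $W\subset V$ be a subspace of dimension $D-p-1$, $\eta$ a symmetric bilinear form on $V$ with kernel exactly $W$, and $h$ a symmetric bilinear form on $V^*$ with kernel exactly the annihilator $\operatorname{ann}W$. (The signatures are arbitrary; the $p$-brane Galilean case is the one where $\eta$ is Lorentzian on $V/W$ and $h$ is positive-definite on $V^*/\operatorname{ann}W$.) Let $h^\sharp:V^*\to V$ be defined by $\langle\alpha,h^\sharp\beta\rangle=h(\alpha,\beta)$, whose image is $W$, and let $\gamma$ be the inner product on $W$ with $\gamma(h^\sharp\alpha,w)=\langle\alpha,w\rangle$. Let $0\neq\Omega\in\wedge^{p+1}\operatorname{ann}W$. Let $G\subset GL(V)$ be the identity component of the group preserving $\eta$ and $h$, $\mathfrak g$ its Lie algebra, and $\partial:\operatorname{Hom}(V,\mathfrak g)\to\operatorname{Hom}(\wedge^2V,V)$, $(\partial\kappa)(v,v')=\kappa(v)v'-\kappa(v')v$, the Spencer differential. In $\operatorname{Hom}(\wedge^2V,V)$ consider the subspaces - $\mathcal T=\{T : T(w,w')\in W\ \text{for all } w,w'\in W\}$; - $\mathcal T_{\rm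 tr}=\{T : \exists\, \tilde w\in W\ \text{such that}\ \eta(T(v,w),v')+\eta(T(v',w),v)=\gamma(\tilde w,w)\,\eta(v,v')\ \text{for all } w\in W,\ v,v'\in V\}$; - $\mathcal T_0=\{T\in\mathcal T : \text{for every } w\in W \text{ the endomorphism of } V/W \text{ induced by } v\mapsto T(w,v) \text{ has trace } 0\}$; and let $\overline{\mathcal T},\overline{\mathcal T}_{\rm tr},\overline{\mathcal T}_0$ be their images in $\operatorname{coker}\partial$. **(A)** The five subspaces $0,\ \overline{\mathcal T}_{\rm tr},\ \overline{\mathcal T}_0,\ \overline{\mathcal T},\ \operatorname{coker}\partial$ are pairwise distinct $G$-submodules of $\operatorname{coker}\partial$, with $\overline{\mathcal T}=\overline{\mathcal T}_{\rm tr}\oplus\overline{\mathcal T}_0$. If $D\neq p+5$, or if $D=p+5$ and the inner product $\gamma$ on the four-dimensional space $W$ is Lorentzian (signature $(1,3)$ or $(3,1)$), they are the only $G$-submodules of $\operatorname{coker}\partial$. Thus there are then exactly five intrinsic torsion classes. **(B)** Let $M$ be a smooth (Hausdorff, $\sigma$-compact) $D$-dimensional manifold with a $G$-structure $P$. Denote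 by $E\subset TM$ (the transverse bundle), $\eta$, $h$, $\Omega$ and $\gamma$ (a metric on $E$) the subbundle and the characteristic tensor fields on $M$ corresponding to $W,\eta,h,\Omega,\gamma$. Let $\nabla$ be a smooth affine connection adapted to $P$, i.e. its connection form in every local frame belonging to $P$ is $\mathfrak g$-valued. Say that its intrinsic torsion lies in a $G$-submodule $N\subset\operatorname{coker}\partial$ if at each point and in each frame in $P$ the class of the torsion of $\nabla$ in $\operatorname{coker}\partial$ belongs to $N$. Then the intrinsic torsion lies in 0. $\operatorname{coker}\partial$: always (generic intrinsic torsion); 1. $\overline{\mathcal T}$ if and only if $E$ is involutive; in that case $M$ is foliated by integral submanifolds of $E$, on which $h$ induces the metric $\gamma$: at each $x\in M$, $E_x$ is the image of $h^\sharp$ and $\gamma(h^\sharp\alpha,Y)=\alpha(Y)$ for $Y\in E_x$; 2. $\overline{\mathcal T}_{\rm tr}$ if and only if there is $Z\in\Gamma(E)$ with $\mathcal L_X\eta=2\gamma(X,Z)\,\eta$ for all $X\in\Gamma(E)$; 3. $\overline{\mathcal T}_0$ if and only if $d\Omega=0$; 4. $0$ if and only if $\mathcal L_X\eta=0$ for all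 $X\in\Gamma(E)$ (vanishing intrinsic torsion). -/

import Mathlib

open scoped Manifold ContDiff
open Module

noncomputable section

/-! ### Linear algebra: the model of a `p`-brane Galilean structure on `ℝ^D` -/

/-- The space `ℝ^D`. -/
abbrev RVec (D : ℕ) : Type := EuclideanSpace ℝ (Fin D)

/-- The general linear group of `ℝ^D`, with its usual topology. -/
abbrev GLVec (D : ℕ) : Type := (RVec D →L[ℝ] RVec D)ˣ

/-- A subspace `W ⊆ ℝ^D` of dimension `D - p - 1` together with a symmetric bilinear form `η` on
`ℝ^D` and a symmetric bilinear form `h` on the dual space, which are non-degenerate in the sense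
that the kernel of `η` is exactly `W` and the kernel of `h` is exactly the annihilator of `W`.
The signatures are arbitrary: `p`-brane Galilean structures are those for which `η` is Lorentzian
on `ℝ^D ⧸ W` and `h` is positive-definite modulo the annihilator of `W`. -/
structure GalileanModel (p D : ℕ) where
  W : Submodule ℝ (RVec D)
  η : LinearMap.BilinForm ℝ (RVec D)
  h : LinearMap.BilinForm ℝ (Dual ℝ (RVec D))
  finrank_W : finrank ℝ W + (p + 1) = D
  η_symm : ∀ v v', η v v' = η v' v
  ker_η : LinearMap.ker η = W
  h_symm : ∀ α β, h α β = h β α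
  ker_h : LinearMap.ker h = W.dualAnnihilator

namespace GalileanModel

variable {p D : ℕ} (S : GalileanModel p D)

/-- The map `h^♯ : (ℝ^D)^* → ℝ^D` defined by `h(α, β) = ⟨α, h^♯ β⟩`. -/
def sharp : Dual ℝ (RVec D) →ₗ[ℝ] RVec D :=
  (evalEquiv ℝ (RVec D)).symm.toLinearMap ∘ₗ S.h.flip

theorem apply_sharp (α β : Dual ℝ (RVec D)) : α (S.sharp β) = S.h α β := by
  simp [sharp]

open Classical in
/-- The inner product `γ` on `W` induced by `h`: `γ(h^♯ α, w) = ⟨α, w⟩`.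
(It is only meaningful when both arguments lie in `W`, which is the image of `h^♯`.) -/
def γ (w w' : RVec D) : ℝ :=
  if hw : ∃ α, S.sharp α = w then hw.choose w' else 0

theorem range_sharp : LinearMap.range S.sharp = S.W := by
  have hle : LinearMap.range S.sharp ≤ S.W := by
    rintro _ ⟨α, rfl⟩
    rw [← Subspace.dualAnnihilator_dualCoannihilator_eq (W := S.W),
      Submodule.mem_dualCoannihilator]
    intro β hβ
    rw [← S.ker_h, LinearMap.mem_ker] at hβ
    rw [S.apply_sharp, hβ, LinearMap.zero_apply]
  have hker : LinearMap.ker S.sharp = S.W.dualAnnihilator := by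
    rw [← S.ker_h]
    ext α
    simp only [LinearMap.mem_ker, sharp, LinearMap.comp_apply, LinearEquiv.coe_coe,
      LinearEquiv.map_eq_zero_iff]
    refine ⟨fun h ↦ LinearMap.ext fun β ↦ ?_, fun h ↦ LinearMap.ext fun β ↦ ?_⟩
    · rw [S.h_symm]
      exact LinearMap.congr_fun h β
    · change S.h β α = 0
      rw [S.h_symm, h]
      rfl
  refine Submodule.eq_of_le_of_finrank_eq hle ?_
  have h1 := LinearMap.finrank_range_add_finrank_ker S.sharp
  have h2 := Subspace.finrank_add_finrank_dualAnnihilator_eq S.W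
  rw [hker, Subspace.dual_finrank_eq] at h1
  omega

theorem γ_sharp (α : Dual ℝ (RVec D)) {w : RVec D} (hw : w ∈ S.W) : S.γ (S.sharp α) w = α w := by
  have hex : ∃ β, S.sharp β = S.sharp α := ⟨α, rfl⟩
  rw [γ, dif_pos hex]
  obtain ⟨β, rfl⟩ : w ∈ LinearMap.range S.sharp := by rwa [S.range_sharp]
  rw [S.apply_sharp, S.apply_sharp, S.h_symm, ← S.apply_sharp, hex.choose_spec, S.apply_sharp,
    S.h_symm]

/-- The group of all linear automorphisms of `ℝ^D` preserving `η` and `h`. -/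
def fullGroup : Subgroup (GLVec D) where
  carrier := {g |
    (∀ v v', S.η (g.val v) (g.val v') = S.η v v') ∧
    (∀ α β : Dual ℝ (RVec D),
      S.h (α ∘ₗ (g⁻¹).val.toLinearMap) (β ∘ₗ (g⁻¹).val.toLinearMap) = S.h α β)}
  one_mem' := by
    refine ⟨fun v v' ↦ by simp, fun α β ↦ ?_⟩
    have : ((1 : GLVec D)⁻¹).val.toLinearMap = LinearMap.id := by
      ext v; simp
    simp only [this, LinearMap.comp_id]
  mul_mem' := by
    rintro a b ⟨ha, ha'⟩ ⟨hb, hb'⟩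
    refine ⟨fun v v' ↦ ?_, fun α β ↦ ?_⟩
    · have e : ∀ v, (a * b).val v = a.val (b.val v) := fun v ↦ rfl
      rw [e, e, ha, hb]
    · have e : ∀ α : Dual ℝ (RVec D), α ∘ₗ ((a * b)⁻¹).val.toLinearMap =
          (α ∘ₗ (b⁻¹).val.toLinearMap) ∘ₗ (a⁻¹).val.toLinearMap := by
        intro α
        rw [mul_inv_rev]
        rfl
      rw [e, e, ha', hb']
  inv_mem' := by
    rintro a ⟨ha, ha'⟩
    refine ⟨fun v v' ↦ ?_, fun α β ↦ ?_⟩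
    · have e : ∀ v, a.val ((a⁻¹).val v) = v := fun v ↦ by
        rw [← mul_apply_eq_comp, Units.mul_inv]; rfl
      rw [← ha, e, e]
    · have e : ∀ α : Dual ℝ (RVec D),
          (α ∘ₗ ((a⁻¹)⁻¹).val.toLinearMap) ∘ₗ (a⁻¹).val.toLinearMap = α := fun α ↦ by
        ext v
        rw [inv_inv]
        change α (a.val ((a⁻¹).val v)) = α v
        rw [← mul_apply_eq_comp, Units.mul_inv]; rfl
      rw [← ha', e, e]

/-- The group `G`: the identity component of the group preserving `η` and `h`. -/
def G : Subgroup (GLVec D) :=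
  (Subgroup.connectedComponentOfOne S.fullGroup).map S.fullGroup.subtype

theorem G_le_fullGroup : S.G ≤ S.fullGroup := by
  rintro _ ⟨g, -, rfl⟩
  exact g.2

/-- The Lie algebra `𝔤` of `G`: the endomorphisms of `ℝ^D` which preserve `η` and `h`
infinitesimally (with `X` acting on covectors by `α ↦ - α ∘ X`). -/
def lieAlg : Submodule ℝ (End ℝ (RVec D)) where
  carrier := {X |
    (∀ v v', S.η (X v) v' + S.η v (X v') = 0) ∧
    (∀ α β : Dual ℝ (RVec D), S.h (α ∘ₗ X) β + S.h α (β ∘ₗ X) = 0)}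
  zero_mem' := by simp
  add_mem' := by
    rintro X Y ⟨hX, hX'⟩ ⟨hY, hY'⟩
    refine ⟨fun v v' ↦ ?_, fun α β ↦ ?_⟩
    · have h1 := hX v v'
      have h2 := hY v v'
      simp only [LinearMap.add_apply, map_add]
      linarith
    · have h1 := hX' α β
      have h2 := hY' α β
      simp only [LinearMap.comp_add, LinearMap.add_apply, map_add]
      linarith
  smul_mem' := by
    rintro c X ⟨hX, hX'⟩
    refine ⟨fun v v' ↦ ?_, fun α β ↦ ?_⟩
    · have h1 := hX v v'
      simp only [LinearMap.smul_apply, map_smul, smul_eq_mul]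
      linear_combination c * h1
    · have h1 := hX' α β
      simp only [LinearMap.comp_smul, LinearMap.smul_apply, map_smul, smul_eq_mul]
      linear_combination c * h1

end GalileanModel

/-- The space `Hom(∧² ℝ^D, ℝ^D)` of torsions. -/
abbrev Tors (D : ℕ) : Type := RVec D [⋀^Fin 2]→ₗ[ℝ] RVec D

/-- The alternating map `(v, v') ↦ B v v'` determined by a bilinear map `B` with `B v v = 0`. -/
def altOfBilin {D : ℕ} (B : RVec D →ₗ[ℝ] RVec D →ₗ[ℝ] RVec D) (hB : ∀ v, B v v = 0) : Tors D where
  toFun m := B (m 0) (m 1)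
  map_update_add' m i x y := by
    fin_cases i <;> simp
  map_update_smul' m i c x := by
    fin_cases i <;> simp
  map_eq_zero_of_eq' m i j hij hne := by
    have h01 : m 0 = m 1 := by
      fin_cases i <;> fin_cases j <;> simp_all
    simp [h01, hB]

theorem altOfBilin_apply {D : ℕ} (B : RVec D →ₗ[ℝ] RVec D →ₗ[ℝ] RVec D) (hB : ∀ v, B v v = 0)
    (m : Fin 2 → RVec D) : altOfBilin B hB m = B (m 0) (m 1) := rfl

/-- The action of `GL(D, ℝ)` on torsions: `(g · T)(v, v') = g T(g⁻¹ v, g⁻¹ v')`. -/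
def torsAct {D : ℕ} : Representation ℝ (GLVec D) (Tors D) where
  toFun g :=
    { toFun := fun T ↦
        g.val.toLinearMap.compAlternatingMap (T.compLinearMap (g⁻¹).val.toLinearMap)
      map_add' := fun T T' ↦ by ext m; simp
      map_smul' := fun c T ↦ by ext m; simp }
  map_one' := by
    ext T m
    simp
  map_mul' := fun a b ↦ by
    ext T m
    simp

theorem torsAct_apply {D : ℕ} (g : GLVec D) (T : Tors D) (m : Fin 2 → RVec D) :
    torsAct g T m = g.val (T fun i ↦ (g⁻¹).val (m i)) := rfl

namespace GalileanModel

variable {p D : ℕ} (S : GalileanModel p D)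

/-- The Spencer differential `∂ : Hom(ℝ^D, 𝔤) → Hom(∧² ℝ^D, ℝ^D)`,
`(∂κ)(v, v') = κ(v) v' - κ(v') v`. -/
def spencer : (RVec D →ₗ[ℝ] S.lieAlg) →ₗ[ℝ] Tors D where
  toFun κ := altOfBilin ((S.lieAlg.subtype ∘ₗ κ) - LinearMap.flip (S.lieAlg.subtype ∘ₗ κ))
    fun v ↦ by simp
  map_add' κ κ' := by
    ext1 m
    simp only [AlternatingMap.add_apply, altOfBilin_apply]
    simp
    abel
  map_smul' c κ := by
    ext1 m
    simp only [AlternatingMap.smul_apply, altOfBilin_apply]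
    simp [smul_sub]

theorem spencer_apply (κ : RVec D →ₗ[ℝ] S.lieAlg) (m : Fin 2 → RVec D) :
    S.spencer κ m = (κ (m 0)).val (m 1) - (κ (m 1)).val (m 0) := by
  simp [spencer, altOfBilin_apply]

/-- The Lie algebra is stable under conjugation by the group. -/
theorem conj_mem_lieAlg {g : GLVec D} (hg : g ∈ S.fullGroup) {X : End ℝ (RVec D)}
    (hX : X ∈ S.lieAlg) :
    g.val.toLinearMap ∘ₗ X ∘ₗ (g⁻¹).val.toLinearMap ∈ S.lieAlg := by
  have hi := S.fullGroup.inv_mem hg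
  refine ⟨fun v v' ↦ ?_, fun α β ↦ ?_⟩
  · have e : ∀ v, v = g.val ((g⁻¹).val v) := fun v ↦ by
      rw [← mul_apply_eq_comp, Units.mul_inv]; rfl
    have h1 := hX.1 ((g⁻¹).val v) ((g⁻¹).val v')
    rw [← hg.1 _ ((g⁻¹).val v'), ← hg.1 ((g⁻¹).val v), ← e, ← e] at h1
    exact h1
  · have h1 := hX.2 (α ∘ₗ g.val.toLinearMap) (β ∘ₗ g.val.toLinearMap)
    rw [← hg.2, ← hg.2 (α ∘ₗ g.val.toLinearMap)] at h1
    have e : ∀ α : Dual ℝ (RVec D),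
        (α ∘ₗ g.val.toLinearMap) ∘ₗ (g⁻¹).val.toLinearMap = α := fun α ↦ by
      ext1 v
      change α (g.val ((g⁻¹).val v)) = α v
      rw [← mul_apply_eq_comp, Units.mul_inv]; rfl
    rw [e, e] at h1
    exact h1

/-- The image of the Spencer differential is stable under the group: `g · ∂κ = ∂(g · κ)` with
`(g · κ)(v) = g κ(g⁻¹ v) g⁻¹`. -/
theorem range_spencer_le_comap {g : GLVec D} (hg : g ∈ S.fullGroup) :
    LinearMap.range S.spencer ≤ (LinearMap.range S.spencer).comap (torsAct g) := by
  rintro _ ⟨κ, rfl⟩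
  let c : S.lieAlg →ₗ[ℝ] S.lieAlg :=
    { toFun := fun X ↦ ⟨_, S.conj_mem_lieAlg hg X.2⟩
      map_add' := fun X Y ↦ by ext v : 2; simp
      map_smul' := fun a X ↦ by ext v : 2; simp }
  refine ⟨c ∘ₗ κ ∘ₗ (g⁻¹).val.toLinearMap, ?_⟩
  ext1 m
  rw [torsAct_apply, spencer_apply, spencer_apply, map_sub]
  rfl

/-- The cokernel of the Spencer differential: the space of intrinsic torsions. -/
abbrev Coker : Type := Tors D ⧸ LinearMap.range S.spencer

/-- The action of `G` on the cokernel of the Spencer differential induced by its action on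
torsions. -/
def cokerAct : Representation ℝ S.G S.Coker where
  toFun g := Submodule.mapQ _ _ (torsAct g.val) (S.range_spencer_le_comap (S.G_le_fullGroup g.2))
  map_one' := by
    ext1
    simp
    rfl
  map_mul' a b := by
    ext1
    simp
    rfl

/-- The `G`-submodules of the cokernel of the Spencer differential. -/
def IsGSubmodule (N : Submodule ℝ S.Coker) : Prop :=
  ∀ g : S.G, ∀ t ∈ N, S.cokerAct g t ∈ N

/-- The torsions `T` with `T(w, w') ∈ W` for all `w, w' ∈ W`. -/
def torsInv : Submodule ℝ (Tors D) where
  carrier := {T | ∀ w ∈ S.W, ∀ w' ∈ S.W, T ![w, w'] ∈ S.W}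
  zero_mem' := by intro w _ w' _; simp
  add_mem' := by
    intro T T' hT hT' w hw w' hw'
    exact S.W.add_mem (hT w hw w' hw') (hT' w hw w' hw')
  smul_mem' := by
    intro c T hT w hw w' hw'
    exact S.W.smul_mem c (hT w hw w' hw')

/-- The torsions `T` for which there is `w₀ ∈ W` such that
`η(T(v, w), v') + η(T(v', w), v) = γ(w₀, w) η(v, v')` for all `w ∈ W` and all `v, v'`. -/
def torsTr : Submodule ℝ (Tors D) where
  carrier := {T | ∃ w₀ ∈ S.W, ∀ w ∈ S.W, ∀ v v',
    S.η (T ![v, w]) v' + S.η (T ![v', w]) v = S.γ w₀ w * S.η v v'}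
  zero_mem' := by
    refine ⟨0, S.W.zero_mem, fun w hw v v' ↦ ?_⟩
    have : S.γ 0 w = 0 := by simpa using S.γ_sharp 0 hw
    simp [this]
  add_mem' := by
    rintro T T' ⟨w₁, h₁, hT⟩ ⟨w₂, h₂, hT'⟩
    refine ⟨w₁ + w₂, S.W.add_mem h₁ h₂, fun w hw v v' ↦ ?_⟩
    rw [← S.range_sharp] at h₁ h₂
    obtain ⟨α, rfl⟩ := h₁
    obtain ⟨β, rfl⟩ := h₂
    have e1 := hT w hw v v'
    have e2 := hT' w hw v v'
    rw [S.γ_sharp _ hw] at e1 e2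
    rw [← map_add, S.γ_sharp _ hw]
    simp only [AlternatingMap.add_apply, map_add, LinearMap.add_apply]
    linear_combination e1 + e2
  smul_mem' := by
    rintro c T ⟨w₁, h₁, hT⟩
    refine ⟨c • w₁, S.W.smul_mem c h₁, fun w hw v v' ↦ ?_⟩
    rw [← S.range_sharp] at h₁
    obtain ⟨α, rfl⟩ := h₁
    have e1 := hT w hw v v'
    rw [S.γ_sharp _ hw] at e1
    rw [← map_smul, S.γ_sharp _ hw]
    simp only [AlternatingMap.smul_apply, map_smul, LinearMap.smul_apply, smul_eq_mul]
    linear_combination c * e1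

/-- For `u ∈ ℝ^D`, the endomorphism `v ↦ T(u, v)` of `ℝ^D`. -/
def contract (T : Tors D) (u : RVec D) : End ℝ (RVec D) where
  toFun v := T ![u, v]
  map_add' v v' := by
    have e : ∀ v, Function.update ![u, 0] 1 v = ![u, v] := fun v ↦ by
      ext i : 1
      fin_cases i <;> simp
    have := T.map_update_add ![u, 0] 1 v v'
    rwa [e, e, e] at this
  map_smul' c v := by
    have e : ∀ v, Function.update ![u, 0] 1 v = ![u, v] := fun v ↦ by
      ext i : 1
      fin_cases i <;> simp
    have := T.map_update_smul ![u, 0] 1 c v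
    rwa [e, e] at this

/-- The torsions `T` with `T(w, w') ∈ W` for all `w, w' ∈ W` and such that, for every `w ∈ W`, the
endomorphism of `ℝ^D ⧸ W` induced by `v ↦ T(w, v)` has trace zero. -/
def torsZero : Submodule ℝ (Tors D) where
  carrier := {T | ∃ hT : T ∈ S.torsInv, ∀ w (hw : w ∈ S.W),
    LinearMap.trace ℝ (RVec D ⧸ S.W)
      (S.W.mapQ S.W (contract T w) fun w' hw' ↦ hT w hw w' hw') = 0}
  zero_mem' := by
    refine ⟨Submodule.zero_mem _, fun w hw ↦ ?_⟩
    rw [← map_zero (LinearMap.trace ℝ (RVec D ⧸ S.W))]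
    congr 1
    ext v
    simp [contract]
  add_mem' := by
    rintro T T' ⟨h, hT⟩ ⟨h', hT'⟩
    refine ⟨Submodule.add_mem _ h h', fun w hw ↦ ?_⟩
    rw [← add_zero (0 : ℝ)]
    nth_rw 1 [← hT w hw]
    rw [← hT' w hw, ← map_add]
    congr 1
    ext v
    simp [contract]
  smul_mem' := by
    rintro c T ⟨h, hT⟩
    refine ⟨Submodule.smul_mem _ c h, fun w hw ↦ ?_⟩
    rw [← smul_zero c, ← hT w hw, ← map_smul]
    congr 1
    ext v
    simp [contract]

end GalileanModel

/-! ### `G`-structures and their characteristic tensor fields -/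

section Geometry

variable {p D : ℕ} {M : Type*} [TopologicalSpace M] [ChartedSpace (RVec D) M]

/-- Smooth vector fields. -/
def IsSmoothVF [IsManifold (𝓡 D) 1 M] (X : ∀ x : M, TangentSpace (𝓡 D) x) : Prop :=
  ContMDiff (𝓡 D) (𝓡 D).tangent ∞ fun x ↦ (⟨x, X x⟩ : TangentBundle (𝓡 D) M)

/-- `s` is a smooth local frame over the open set `U`, each `s x` being a linear isomorphism
`ℝ^D → T_x M` which belongs to `P x`. (The values of `s` outside of `U` are irrelevant.) -/
structure IsLocalSection [IsManifold (𝓡 D) 1 M]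
    (P : ∀ x : M, Set (RVec D ≃L[ℝ] TangentSpace (𝓡 D) x)) (U : Set M)
    (s : ∀ x : M, RVec D ≃L[ℝ] TangentSpace (𝓡 D) x) : Prop where
  isOpen : IsOpen U
  mem : ∀ x ∈ U, s x ∈ P x
  smooth : ∀ v : RVec D, ContMDiffOn (𝓡 D) (𝓡 D).tangent ∞
    (fun x ↦ (⟨x, s x v⟩ : TangentBundle (𝓡 D) M)) U

/-- A `G`-structure on `M`: a principal `G`-subbundle of the bundle of frames, a frame at `x` being
a linear isomorphism `u : ℝ^D → T_x M` and the group acting by `u ↦ u ∘ g`. It is given by its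
fibres, which are `G`-orbits, and it admits smooth local sections. -/
structure GStructure (S : GalileanModel p D) (M : Type*) [TopologicalSpace M]
    [ChartedSpace (RVec D) M] [IsManifold (𝓡 D) 1 M] where
  frames : ∀ x : M, Set (RVec D ≃L[ℝ] TangentSpace (𝓡 D) x)
  mem_iff : ∀ (x : M) (u u' : RVec D ≃L[ℝ] TangentSpace (𝓡 D) x), u ∈ frames x →
    (u' ∈ frames x ↔ ∃ g ∈ S.G, ∀ v, u' v = u (g.val v))
  exists_section : ∀ x₀ : M, ∃ U s, x₀ ∈ U ∧ IsLocalSection frames U s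

namespace GStructure

variable [IsManifold (𝓡 D) 1 M] {S : GalileanModel p D} (P : GStructure S M)

theorem frames_nonempty (x : M) : (P.frames x).Nonempty := by
  obtain ⟨U, s, hx, hs⟩ := P.exists_section x
  exact ⟨s x, hs.mem x hx⟩

/-- Some frame of the `G`-structure at `x`. The tensors defined with it do not depend on the
choice, since they correspond to `G`-invariant tensors of the model. -/
def frame (x : M) : RVec D ≃L[ℝ] TangentSpace (𝓡 D) x := (P.frames_nonempty x).some

theorem frame_mem (x : M) : P.frame x ∈ P.frames x := (P.frames_nonempty x).some_mem

/-- The transverse bundle `E ⊆ TM`, corresponding to `W ⊆ ℝ^D`. -/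
def E (x : M) : Submodule ℝ (TangentSpace (𝓡 D) x) :=
  S.W.map (P.frame x).toLinearEquiv.toLinearMap

/-- The characteristic tensor field `η`. -/
def η (x : M) (X Y : TangentSpace (𝓡 D) x) : ℝ :=
  S.η ((P.frame x).symm X) ((P.frame x).symm Y)

/-- The characteristic tensor field `h`. -/
def h (x : M) (α β : Dual ℝ (TangentSpace (𝓡 D) x)) : ℝ :=
  S.h (α ∘ₗ (P.frame x).toLinearEquiv.toLinearMap) (β ∘ₗ (P.frame x).toLinearEquiv.toLinearMap)

/-- The metric `γ` on the transverse bundle `E` corresponding to the inner product `γ` on `W`. -/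
def γ (x : M) (X Y : TangentSpace (𝓡 D) x) : ℝ :=
  S.γ ((P.frame x).symm X) ((P.frame x).symm Y)

/-- The characteristic `(p+1)`-form `Ω` corresponding to `Ω₀ ∈ ∧^{p+1} ann W`. -/
def Ω (Ω₀ : RVec D [⋀^Fin (p + 1)]→ₗ[ℝ] ℝ) (x : M) (X : Fin (p + 1) → TangentSpace (𝓡 D) x) : ℝ :=
  Ω₀ fun i ↦ (P.frame x).symm (X i)

/-- `X ∈ Γ(E)`: `X` is a smooth section of `E`. -/
def IsSectionE (X : ∀ x : M, TangentSpace (𝓡 D) x) : Prop :=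
  IsSmoothVF X ∧ ∀ x, X x ∈ P.E x

/-- `E` is involutive: `[Γ(E), Γ(E)] ⊆ Γ(E)`. -/
def Involutive : Prop :=
  ∀ X Y : ∀ x : M, TangentSpace (𝓡 D) x, P.IsSectionE X → P.IsSectionE Y →
    ∀ x, VectorField.mlieBracket (𝓡 D) X Y x ∈ P.E x

/-- `M` is foliated by integral submanifolds of `E`: around each point there is a chart
`φ = (φ_1, …, φ_D)` of `M` in which `E` is the kernel of `dφ_1, …, dφ_{p+1}`; so that the leaves
are given locally by constant `φ_1, …, φ_{p+1}`. -/
def Foliated : Prop :=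
  ∀ x₀ : M, ∃ φ ∈ IsManifold.maximalAtlas (𝓡 D) ∞ M, x₀ ∈ φ.source ∧
    ∀ x ∈ φ.source, ∀ v : TangentSpace (𝓡 D) x,
      v ∈ P.E x ↔ ∀ i : Fin D, (i : ℕ) < p + 1 →
        mvfderiv (𝓡 D) φ x v i = 0

/-- The value at `x` of `(L_X η)(Y, Z) = X(η(Y, Z)) - η([X, Y], Z) - η(Y, [X, Z])`. -/
def lieDerivη (X Y Z : ∀ x : M, TangentSpace (𝓡 D) x) (x : M) : ℝ :=
  mvfderiv (𝓡 D) (fun y ↦ P.η y (Y y) (Z y)) x (X x)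
    - P.η x (VectorField.mlieBracket (𝓡 D) X Y x) (Z x)
    - P.η x (Y x) (VectorField.mlieBracket (𝓡 D) X Z x)

/-- The value at `x` of `dΩ(X_0, …, X_{p+1})`, by the invariant formula for the exterior derivative:
`∑_i (-1)^i X_i(Ω(…, X̂_i, …)) + ∑_{i<j} (-1)^{i+j} Ω([X_i, X_j], …, X̂_i, …, X̂_j, …)`.
The second sum is written over pairs `i ≤ j` which stand for the pairs `i < j + 1`. -/
def dΩ (Ω₀ : RVec D [⋀^Fin (p + 1)]→ₗ[ℝ] ℝ) (X : Fin (p + 2) → ∀ x : M, TangentSpace (𝓡 D) x)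
    (x : M) : ℝ :=
  (∑ i : Fin (p + 2), (-1) ^ (i : ℕ) *
    mvfderiv (𝓡 D) (fun y ↦ P.Ω Ω₀ y (i.removeNth fun k ↦ X k y)) x (X i x)) -
  ∑ i : Fin (p + 1), ∑ j ∈ Finset.Ici i, (-1) ^ ((i : ℕ) + (j : ℕ)) *
    P.Ω Ω₀ x (Matrix.vecCons (VectorField.mlieBracket (𝓡 D) (X i.castSucc) (X j.succ) x)
      (j.removeNth (i.castSucc.removeNth fun k ↦ X k x)))

end GStructure

/-! ### Adapted connections and their intrinsic torsion -/

namespace GStructure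

variable [IsManifold (𝓡 D) ∞ M] {S : GalileanModel p D} (P : GStructure S M)

/-- A smooth affine connection `∇` is adapted to the `G`-structure if its connection one-form with
respect to every local section `s` of the `G`-structure takes values in the Lie algebra:
`∇_X (s v) = s (A(X) v)` with `A(X) ∈ 𝔤`. (In Mathlib, `cov σ x X` is `∇_X σ` at `x`.) -/
structure IsAdapted (cov : CovariantDerivative (𝓡 D) (RVec D) (TangentSpace (𝓡 D) : M → Type _)) :
    Prop where
  smooth : CovariantDerivative.ContMDiffCovariantDerivative cov ∞
  connection_form : ∀ U s, IsLocalSection P.frames U s → ∀ x ∈ U, ∀ X : TangentSpace (𝓡 D) x,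
    ∃ A ∈ S.lieAlg, ∀ v : RVec D, cov (fun y ↦ s y v) x X = s x (A v)

/-- The torsion of a connection at `x` as seen in a frame `u : ℝ^D → T_x M`. -/
def torsionAt (cov : CovariantDerivative (𝓡 D) (RVec D) (TangentSpace (𝓡 D) : M → Type _)) (x : M)
    (u : RVec D ≃L[ℝ] TangentSpace (𝓡 D) x) : Tors D :=
  altOfBilin
    (LinearMap.mk₂ ℝ (fun v v' ↦ u.symm (cov.torsion x (u v) (u v')))
      (by intros; simp) (by intros; simp) (by intros; simp) (by intros; simp))
    (by intro v; simp [CovariantDerivative.torsion])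

/-- The intrinsic torsion (the class modulo the image of `∂` of the torsion of an adapted
connection) lies in the subbundle associated to the `G`-submodule `N` of the cokernel of `∂`. -/
def IntrinsicTorsionIn
    (cov : CovariantDerivative (𝓡 D) (RVec D) (TangentSpace (𝓡 D) : M → Type _))
    (N : Submodule ℝ S.Coker) : Prop :=
  ∀ x : M, ∀ u ∈ P.frames x, (LinearMap.range S.spencer).mkQ (torsionAt cov x u) ∈ N

end GStructure

end Geometry

end

noncomputable section

/-! ### Infinitesimal rotations acting on vectors and matrices -/

section Rotations

variable {ι : Type*} [DecidableEq ι]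

/-! Part (A) is a computation in a basis `e i` of `W`, orthogonal for `γ`, completed by vectors `u
a`, orthogonal for `η` and spanning a complement. A torsion T has the coordinates c_ija = η(T(e_i,
e_j), u_a), antisymmetric in i, j, and s_iac = η(T(e_i, u_a), u_c) + η(T(e_i, u_c), u_a), symmetric
in a, c. They vanish exactly on the image of ∂ (`AdaptedBasis.range_spencer`): elements of 𝔤
preserve W = ker η and are η-skew, and conversely a Koszul formula solves ∂κ = T. So coker ∂ is, as
a vector space, the sum of ∧²W* ⊗ V/W and W* ⊗ S²(V/W)*. The space `torsInv` is given by c = 0;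
inside it `torsTr` asks each s_i to be a multiple of η, and `torsZero` asks each s_i to be
traceless.

A G-submodule is closed under differentiation along one-parameter subgroups, hence under the
rotations of W, the rotations of V/W and the boosts, which send c into s (`coord_derivative_mem`).
In dimension at least three, products of rotations produce all matrix units on vectors, so one
tensor factor can be stripped off (`single_mem_of_rotFamily_mem`). What remains is the
irreducibility of traceless symmetric matrices and of antisymmetric ones; the latter would split in
dimension four into selfdual and anti-selfdual parts if the product of the diagonal entries were
positive. If some c ≠ 0 occurs, then all c occur, and the boosts produce all s; otherwise the
submodule is one of the four with c = 0 (`coord_submodule_cases`).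

Part (B) rests on [X, Y] = ∇_X Y - ∇_Y X - Tor(X, Y) read in a local frame of the structure, where
the connection form is 𝔤-valued. For X in Γ(E) the terms ∇_Y X stay in E = ker η, and ∇η = 0, so
(L_X η)(Y, Y') = η(Tor(X, Y), Y') + η(Y, Tor(X, Y')); likewise brackets of sections of E are -Tor
modulo E. As Ω is parallel, dΩ is the antisymmetrised insertion of Tor into Ω
(`IsAdapted.two_mul_dΩ_eq`), and it vanishes exactly for torsions in `torsZero`, since Ω is a top
form on V/W, on which endomorphisms act by their trace.

The foliation comes from the Frobenius theorem. Near a point E is the graph of a family A of linear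
maps, and one solves D_ξ F = A(x₀ + ξ, F) along rays. The ray equation is an integral equation in
C([0,1], Y), solved smoothly in its parameters by the inverse function theorem; integrability and a
Gronwall argument give the derivatives in all directions. -/

theorem exists_ne_ne_of_three_le_card [Fintype ι] (h : 3 ≤ Fintype.card ι) (i j : ι) :
    ∃ k, k ≠ i ∧ k ≠ j := by
  have : (({i, j} : Finset ι)).card < Fintype.card ι := lt_of_le_of_lt Finset.card_le_two (by omega)
  obtain ⟨k, hk⟩ := Finset.exists_mem_notMem_of_card_lt_card (t := Finset.univ) (by simpa using this)
  exact ⟨k, by simpa using hk⟩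

/-- The infinitesimal rotation in the plane of the indices `k` and `l`, for the quadratic form
with diagonal entries `ε`, acting on families indexed by `ι`. -/
def rotFamily {X : Type*} [AddCommGroup X] [Module ℝ X] (ε : ι → ℝ) (k l : ι) (f : ι → X) : ι → X :=
  fun i ↦ (if i = l then ε l • f k else 0) - (if i = k then ε k • f l else 0)

/-- The infinitesimal rotation in the plane of the indices `k` and `l` acting on matrices. -/
def rotMatrix (ε : ι → ℝ) (k l : ι) (m : ι → ι → ℝ) : ι → ι → ℝ :=
  fun x y ↦ (if x = l then ε l * m k y else 0) - (if x = k then ε k * m l y else 0)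
    + (if y = l then ε l * m x k else 0) - (if y = k then ε k * m x l else 0)

/-- In dimension at least three, products of rotations are multiples of the matrix units, so that
a rotation invariant space of families is invariant under all matrices. -/
theorem single_mem_of_rotFamily_mem [Fintype ι] {X : Type*} [AddCommGroup X] [Module ℝ X] {ε : ι → ℝ}
    (hε : ∀ i, ε i ≠ 0) (hι : 3 ≤ Fintype.card ι) {B : Submodule ℝ (ι → X)}
    (hB : ∀ k l f, k ≠ l → f ∈ B → rotFamily ε k l f ∈ B) {f : ι → X} (hf : f ∈ B) (i j : ι) :
    Pi.single j (f i) ∈ B := by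
  have key : ∀ f ∈ B, ∀ i j, i ≠ j → Pi.single j (f i) ∈ B := by
    intro f hf i j hij
    obtain ⟨k, hki, hkj⟩ := exists_ne_ne_of_three_le_card hι i j
    -- The first rotation puts `ε k • f i` in place `k`; the second carries place `k` to place `j`
    -- and kills all other places. Nothing returns to place `k`, since the first rotation left place
    -- `j` empty.
    have h := B.smul_mem (ε j * ε k)⁻¹ (hB k j _ hkj (hB i k f hki.symm hf))
    convert h using 1
    funext x
    have hj := hε j
    have hk := hε k
    rcases eq_or_ne x j with rfl | hxj
    · simp [rotFamily, hkj.symm, smul_smul, hki]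
      rw [show (ε k)⁻¹ * (ε x)⁻¹ * (ε x * ε k) = 1 by field_simp, one_smul]
    · simp [rotFamily, hxj, hkj.symm, hij.symm]
  rcases eq_or_ne i j with rfl | hij
  · obtain ⟨k, hki, -⟩ := exists_ne_ne_of_three_le_card hι i i
    simpa using key _ (key f hf i k hki.symm) k i hki
  · exact key f hf i j hij

/-- The square of a rotation acts on antisymmetric matrices as a mask. -/
theorem rotMatrix_rotMatrix_of_antisymm (ε : ι → ℝ) {k l : ι} (hkl : k ≠ l) (m : ι → ι → ℝ)
    (hm : ∀ x y, m x y = - m y x) (x y : ι) :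
    rotMatrix ε k l (rotMatrix ε k l m) x y =
      if ((x = k ∨ x = l) ↔ (y = k ∨ y = l)) then 0 else - (ε k * ε l) * m x y := by
  have hd : ∀ x, m x x = 0 := fun x ↦ by linarith [hm x x]
  have h1 := hm k l
  have h2 := hm y x
  by_cases hxk : x = k <;> by_cases hxl : x = l <;> by_cases hyk : y = k <;>
    by_cases hyl : y = l <;> simp [rotMatrix, hxk, hxl, hyk, hyl, hkl, hkl.symm, hd] <;> grind

/-- The elementary antisymmetric matrix. -/
def antiUnit (i j : ι) : ι → ι → ℝ := fun x y ↦
  (if x = i ∧ y = j then 1 else 0) - (if x = j ∧ y = i then 1 else 0)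

/-- The elementary symmetric matrix. -/
def symUnit (i j : ι) : ι → ι → ℝ := fun x y ↦
  (if x = i ∧ y = j then 1 else 0) + (if x = j ∧ y = i then 1 else 0)

theorem antiUnit_swap (i j : ι) : antiUnit j i = -antiUnit i j := by
  funext x y; simp [antiUnit]

theorem symUnit_swap (i j : ι) : symUnit j i = symUnit i j := by
  funext x y; simp [symUnit, add_comm]

theorem rotMatrix_antiUnit (ε : ι → ℝ) {i j k : ι} (hij : i ≠ j) (hik : i ≠ k) (hjk : j ≠ k) :
    rotMatrix ε j k (antiUnit i j) = ε k • antiUnit i k := by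
  funext x y
  simp only [rotMatrix, antiUnit, Pi.smul_apply, smul_eq_mul]
  grind

theorem rotMatrix_symUnit (ε : ι → ℝ) {i j k : ι} (hij : i ≠ j) (hik : i ≠ k) (hjk : j ≠ k) :
    rotMatrix ε j k (symUnit i j) = ε k • symUnit i k := by
  funext x y
  simp only [rotMatrix, symUnit, Pi.smul_apply, smul_eq_mul]
  grind

theorem rotMatrix_symUnit_self (ε : ι → ℝ) {i j : ι} (hij : i ≠ j) :
    rotMatrix ε i j (symUnit i j) = ε j • symUnit j j - ε i • symUnit i i := by
  funext x y
  simp only [rotMatrix, symUnit, Pi.smul_apply, Pi.sub_apply, smul_eq_mul]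
  grind

/-- Rotations in the planes `i l` and `j k` together exchange the complementary planes `i j` and `k
l`, as a Hodge star does. This is what remains in dimension four, where no fifth index separates the
two planes. -/
theorem rotMatrix_rotMatrix_antiUnit_add (ε : ι → ℝ) {i j k l : ι} (hij : i ≠ j) (hik : i ≠ k)
    (hil : i ≠ l) (hjk : j ≠ k) (hjl : j ≠ l) (hkl : k ≠ l) (a b : ℝ) :
    rotMatrix ε i l (rotMatrix ε j k (a • antiUnit i j + b • antiUnit k l)) =
      (-1 : ℝ) • ((b * (ε i * ε j)) • antiUnit i j + (a * (ε k * ε l)) • antiUnit k l) := by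
  funext x y
  rcases eq_or_ne x i with rfl | hxi <;> rcases eq_or_ne x j with rfl | hxj <;>
  rcases eq_or_ne x k with rfl | hxk <;> rcases eq_or_ne x l with rfl | hxl <;>
    simp_all [rotMatrix, antiUnit, Ne.symm] <;>
  grind

theorem sum_antiUnit [Fintype ι] {m : ι → ι → ℝ} (hm : ∀ x y, m x y = - m y x) :
    m = (1 / 2 : ℝ) • ∑ i, ∑ j, m i j • antiUnit i j := by
  funext x y
  have e : ∀ i j, antiUnit i j x y =
      (if x = i then (if y = j then 1 else 0) else 0)
        - (if x = j then (if y = i then 1 else 0) else 0) := by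
    intro i j; simp [antiUnit, ite_and]
  simp [e, mul_sub, Finset.sum_sub_distrib, hm y x]
  ring

theorem sum_symUnit [Fintype ι] {m : ι → ι → ℝ} (hm : ∀ x y, m x y = m y x) :
    m = (1 / 2 : ℝ) • ∑ i, ∑ j, m i j • symUnit i j := by
  funext x y
  have e : ∀ i j, symUnit i j x y =
      (if x = i then (if y = j then 1 else 0) else 0)
        + (if x = j then (if y = i then 1 else 0) else 0) := by
    intro i j; simp [symUnit, ite_and]
  simp [e, mul_add, Finset.sum_add_distrib, hm y x]
  ring

/-- With ω = ε_k ε_l, the square R² of the rotation is -ω on entries having one index in {k, l}, has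
eigenvalues 0 and -4ω on the block inside, and is 0 outside. The polynomial R⁴ + 4ωR² therefore
kills everything but the mixed entries, where it is ω² - 4ω² = -3ω². -/
theorem rotMatrix_mask_of_symm (ε : ι → ℝ) {k l : ι} (hkl : k ≠ l) (m : ι → ι → ℝ)
    (hm : ∀ x y, m x y = m y x) (x y : ι) :
    rotMatrix ε k l (rotMatrix ε k l (rotMatrix ε k l (rotMatrix ε k l m))) x y
      + 4 * (ε k * ε l) * rotMatrix ε k l (rotMatrix ε k l m) x y =
      if ((x = k ∨ x = l) ↔ (y = k ∨ y = l)) then 0 else -3 * (ε k * ε l) ^ 2 * m x y := by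
  have h1 := hm k l
  have h2 := hm y x
  by_cases hxk : x = k <;> by_cases hxl : x = l <;> by_cases hyk : y = k <;>
    by_cases hyl : y = l <;> simp [rotMatrix, hxk, hxl, hyk, hyl, hkl, hkl.symm] <;> grind

/-- The polynomial R⁴ + ωR² kills the mixed entries, where R² = -ω, and is 16ω² - 4ω² = 12ω² where
R² = -4ω. If the two diagonal entries vanish, the inner block is a multiple of `symUnit k l`, which
lies in that eigenspace. -/
theorem rotMatrix_proj_of_symm (ε : ι → ℝ) {k l : ι} (hkl : k ≠ l) (m : ι → ι → ℝ)
    (hm : ∀ x y, m x y = m y x) (hk : m k k = 0) (hl : m l l = 0) (x y : ι) :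
    rotMatrix ε k l (rotMatrix ε k l (rotMatrix ε k l (rotMatrix ε k l m))) x y
      + (ε k * ε l) * rotMatrix ε k l (rotMatrix ε k l m) x y =
      12 * (ε k * ε l) ^ 2 * m k l * symUnit k l x y := by
  have h1 := hm k l
  have h2 := hm y x
  by_cases hxk : x = k <;> by_cases hxl : x = l <;> by_cases hyk : y = k <;>
    by_cases hyl : y = l <;>
    simp [rotMatrix, symUnit, hxk, hxl, hyk, hyl, hkl, hkl.symm, hk, hl] <;> grind

/-- The standard representation of the rotation Lie algebra on antisymmetric matrices is
irreducible in dimension three and at least five, and in dimension four if the product of the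
diagonal entries is negative. -/
theorem antisymm_mem_of_rotMatrix_mem [Fintype ι] {ε : ι → ℝ} (hε : ∀ i, ε i ≠ 0)
    (hι : 3 ≤ Fintype.card ι) (hι4 : Fintype.card ι = 4 → ∏ i, ε i < 0)
    {N : Submodule ℝ (ι → ι → ℝ)}
    (hN : ∀ k l m, k ≠ l → m ∈ N → rotMatrix ε k l m ∈ N)
    {m : ι → ι → ℝ} (hm : ∀ x y, m x y = - m y x) (hmN : m ∈ N) (hm0 : m ≠ 0)
    {m' : ι → ι → ℝ} (hm' : ∀ x y, m' x y = - m' y x) : m' ∈ N := by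
  -- masking operators
  have mask : ∀ k l m, k ≠ l → (∀ x y, m x y = - m y x) → m ∈ N →
      (fun x y ↦ if ((x = k ∨ x = l) ↔ (y = k ∨ y = l)) then 0 else m x y) ∈ N := by
    intro k l m hkl hm hmN
    convert N.smul_mem (-(ε k * ε l)⁻¹) (hN k l _ hkl (hN k l m hkl hmN)) using 1
    funext x y
    have hk := hε k
    have hl := hε l
    rw [Pi.smul_apply, Pi.smul_apply, rotMatrix_rotMatrix_of_antisymm ε hkl m hm]
    split_ifs
    · simp
    · simp only [smul_eq_mul]; field_simp
  -- it is enough to find one elementary matrix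
  suffices h : ∃ i j, i ≠ j ∧ antiUnit i j ∈ N by
    obtain ⟨i, j, hij, h⟩ := h
    have sw : ∀ i j, antiUnit i j ∈ N → antiUnit j i ∈ N := fun i j h ↦ by
      rw [antiUnit_swap]; exact N.neg_mem h
    have step : ∀ i j k, i ≠ j → i ≠ k → antiUnit i j ∈ N → antiUnit i k ∈ N := by
      intro i j k hij hik h
      rcases eq_or_ne j k with rfl | hjk
      · exact h
      · have := N.smul_mem (ε k)⁻¹ (hN j k _ hjk h)
        rwa [rotMatrix_antiUnit ε hij hik hjk, smul_smul, inv_mul_cancel₀ (hε k), one_smul] at this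
    have all : ∀ x y, antiUnit x y ∈ N := by
      intro x y
      rcases eq_or_ne x y with rfl | hxy
      · have : antiUnit x x = (0 : ι → ι → ℝ) := by funext a b; simp [antiUnit]
        rw [this]; exact N.zero_mem
      rcases eq_or_ne y i with rfl | hyi
      · exact sw _ _ (step y j x hij hxy.symm h)
      · exact sw _ _ (step y i x hyi hxy.symm (sw _ _ (step i j y hij hyi.symm h)))
    rw [sum_antiUnit hm']
    exact N.smul_mem _ (N.sum_mem fun i _ ↦ N.sum_mem fun j _ ↦ N.smul_mem _ (all i j))
  obtain ⟨i, j, hmij⟩ : ∃ i j, m i j ≠ 0 := by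
    by_contra! h
    exact hm0 (by funext x y; exact h x y)
  have hij : i ≠ j := by
    rintro rfl
    exact hmij (by linarith [hm i i])
  obtain ⟨k, hki, hkj⟩ := exists_ne_ne_of_three_le_card hι i j
  -- A mask keeps the entries with exactly one index in the given pair. After the masks for `i k`
  -- and `j k` only the plane `i j` and the planes of `k` with indices outside {i, j, k} survive.
  have h1 := mask i k m hki.symm hm hmN
  set m1 : ι → ι → ℝ := fun x y ↦
    if ((x = i ∨ x = k) ↔ (y = i ∨ y = k)) then 0 else m x y with hm1
  have hm1a : ∀ x y, m1 x y = - m1 y x := by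
    intro x y; have := hm x y; simp only [hm1]; grind
  have h2 := mask j k m1 hkj.symm hm1a h1
  set m2 : ι → ι → ℝ := fun x y ↦
    if ((x = j ∨ x = k) ↔ (y = j ∨ y = k)) then 0 else m1 x y with hm2
  have hm2a : ∀ x y, m2 x y = - m2 y x := by
    intro x y; have := hm1a x y; simp only [hm2]; grind
  have hm2ij : m2 i j = m i j := by simp only [hm2, hm1]; grind
  have hm2z : ∀ x y, m2 x y ≠ 0 → (x = i ∧ y = j) ∨ (x = j ∧ y = i) ∨
      (x = k ∧ y ≠ i ∧ y ≠ j ∧ y ≠ k) ∨ (y = k ∧ x ≠ i ∧ x ≠ j ∧ x ≠ k) := by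
    intro x y; simp only [hm2, hm1]; grind
  by_cases hl : ∃ l, l ≠ i ∧ l ≠ j ∧ l ≠ k
  swap
  · push Not at hl
    refine ⟨i, j, hij, ?_⟩
    convert N.smul_mem (m i j)⁻¹ h2 using 1
    funext x y
    simp only [antiUnit, Pi.smul_apply, smul_eq_mul]
    have := hm2z x y
    have := hl x
    have := hl y
    have := hm2a i j
    grind
  obtain ⟨l, hli, hlj, hlk⟩ := hl
  -- A fourth index removes the planes of `k` with anything but `l`. Only the planes `i j` and `k l`
  -- are left, and a fifth index, if there is one, removes the second.
  have h3 := mask i l m2 hli.symm hm2a h2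
  set m3 : ι → ι → ℝ := fun x y ↦
    if ((x = i ∨ x = l) ↔ (y = i ∨ y = l)) then 0 else m2 x y with hm3
  have hm3a : ∀ x y, m3 x y = - m3 y x := by
    intro x y; have := hm2a x y; simp only [hm3]; grind
  have hm3e : m3 = m i j • antiUnit i j + m3 k l • antiUnit k l := by
    funext x y
    have := hm2z x y
    have := hm2a x y
    simp only [antiUnit, Pi.smul_apply, Pi.add_apply, smul_eq_mul, hm3]
    grind
  by_cases ho : ∃ o, o ≠ i ∧ o ≠ j ∧ o ≠ k ∧ o ≠ l
  · obtain ⟨o, hoi, hoj, hok, hol⟩ := ho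
    have h4 := mask i o m3 hoi.symm hm3a h3
    refine ⟨i, j, hij, ?_⟩
    convert N.smul_mem (m i j)⁻¹ h4 using 1
    funext x y
    simp only [Pi.smul_apply, smul_eq_mul]
    rw [hm3e]
    simp only [antiUnit, Pi.smul_apply, Pi.add_apply, smul_eq_mul]
    grind
  · push Not at ho
    have huniv : (Finset.univ : Finset ι) = {i, j, k, l} := by
      ext x
      have := ho x
      simp
      grind
    have hcard : Fintype.card ι = 4 := by
      rw [← Finset.card_univ, huniv]
      simp [hij, hki.symm, hkj.symm, hli.symm, hlj.symm, hlk.symm]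
    have hneg := hι4 hcard
    rw [huniv] at hneg
    simp [hij, hki.symm, hkj.symm, hli.symm, hlj.symm, hlk.symm] at hneg
    set a := m i j
    set b := m3 k l
    rw [hm3e] at h3
    have h4 := hN i l _ hli.symm (hN j k _ hkj.symm h3)
    rw [rotMatrix_rotMatrix_antiUnit_add ε hij hki.symm hli.symm hkj.symm hlj.symm hlk.symm] at h4
    -- This is the coefficient of `antiUnit i j` in the combination of `h3` and `h4` which cancels
    -- `antiUnit k l`. Multiplied by ε_k ε_l it is a positive number minus b² times the negative
    -- product of all entries. For a positive product it could vanish, on selfdual matrices.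
    have hdet : a ^ 2 * (ε k * ε l) - b ^ 2 * (ε i * ε j) ≠ 0 := by
      intro h0
      have h5 : a ^ 2 * (ε k * ε l) ^ 2 = b ^ 2 * (ε i * (ε j * (ε k * ε l))) := by
        linear_combination (ε k * ε l) * h0
      have h6 : 0 < a ^ 2 * (ε k * ε l) ^ 2 := by
        have := hε k
        have := hε l
        positivity
      have h7 : b ^ 2 * (ε i * (ε j * (ε k * ε l))) ≤ 0 :=
        mul_nonpos_of_nonneg_of_nonpos (sq_nonneg _) hneg.le
      linarith
    refine ⟨i, j, hij, ?_⟩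
    have h5 := N.smul_mem (a ^ 2 * (ε k * ε l) - b ^ 2 * (ε i * ε j))⁻¹
      (N.add_mem (N.smul_mem (a * (ε k * ε l)) h3) (N.smul_mem b h4))
    convert h5 using 1
    rw [eq_inv_smul_iff₀ hdet]
    module

/-- The traceless symmetric matrices form an irreducible representation of the rotation Lie
algebra: an invariant space of symmetric matrices which contains one that is not a multiple of the
invariant quadratic form contains all the traceless ones. -/
theorem symm_mem_of_rotMatrix_mem [Fintype ι] {ε : ι → ℝ} (hε : ∀ i, ε i ≠ 0)
    (hι : 3 ≤ Fintype.card ι) {N : Submodule ℝ (ι → ι → ℝ)}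
    (hN : ∀ k l m, k ≠ l → m ∈ N → rotMatrix ε k l m ∈ N)
    {m : ι → ι → ℝ} (hm : ∀ x y, m x y = m y x) (hmN : m ∈ N)
    (hm0 : ∀ c : ℝ, m ≠ fun x y ↦ if x = y then c * ε x else 0)
    {m' : ι → ι → ℝ} (hm' : ∀ x y, m' x y = m' y x) (htr : ∑ i, (ε i)⁻¹ * m' i i = 0) :
    m' ∈ N := by
  -- it is enough to find one off-diagonal elementary matrix
  suffices h : ∃ i j, i ≠ j ∧ symUnit i j ∈ N by
    obtain ⟨i, j, hij, h⟩ := h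
    have sw : ∀ i j, symUnit i j ∈ N → symUnit j i ∈ N := fun i j h ↦ by
      rwa [symUnit_swap]
    have step : ∀ i j k, i ≠ j → i ≠ k → symUnit i j ∈ N → symUnit i k ∈ N := by
      intro i j k hij hik h
      rcases eq_or_ne j k with rfl | hjk
      · exact h
      · have := N.smul_mem (ε k)⁻¹ (hN j k _ hjk h)
        rwa [rotMatrix_symUnit ε hij hik hjk, smul_smul, inv_mul_cancel₀ (hε k), one_smul] at this
    have all : ∀ x y, x ≠ y → symUnit x y ∈ N := by
      intro x y hxy
      rcases eq_or_ne y i with rfl | hyi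
      · exact sw _ _ (step y j x hij hxy.symm h)
      · exact sw _ _ (step y i x hyi hxy.symm (sw _ _ (step i j y hij hyi.symm h)))
    have diag : ∀ x, ε x • symUnit x x - ε i • symUnit i i ∈ N := by
      intro x
      rcases eq_or_ne i x with rfl | hix
      · rw [sub_self]; exact N.zero_mem
      · rw [← rotMatrix_symUnit_self ε hix]
        exact hN i x _ hix (all i x hix)
    -- Each diagonal unit is replaced by its difference with a fixed one, and these differences are
    -- rotations of off-diagonal units. The corrections add up to the trace, which is zero.
    have e : m' = (1 / 2 : ℝ) • ∑ x, ∑ y, (if x = y then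
        ((ε x)⁻¹ * m' x x) • (ε x • symUnit x x - ε i • symUnit i i)
          else m' x y • symUnit x y) := by
      conv_lhs => rw [sum_symUnit hm']
      congr 1
      rw [← sub_eq_zero, ← Finset.sum_sub_distrib]
      trans ∑ x, ((ε x)⁻¹ * m' x x) • (ε i • symUnit i i)
      · refine Finset.sum_congr rfl fun x _ ↦ ?_
        rw [← Finset.sum_sub_distrib, Finset.sum_eq_single x]
        · rw [if_pos rfl, smul_sub, smul_smul _ (ε x),
            show (ε x)⁻¹ * m' x x * ε x = m' x x by have := hε x; field_simp]
          abel
        · intro y _ hyx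
          rw [if_neg hyx.symm, sub_self]
        · simp
      · rw [← Finset.sum_smul, htr, zero_smul]
    rw [e]
    refine N.smul_mem _ (N.sum_mem fun x _ ↦ N.sum_mem fun y _ ↦ ?_)
    split_ifs with hxy
    · exact N.smul_mem _ (diag x)
    · exact N.smul_mem _ (all x y hxy)
  by_cases hoff : ∃ a c, a ≠ c ∧ m a c ≠ 0
  · obtain ⟨a, c, hac, hmac⟩ := hoff
    obtain ⟨b, hba, hbc⟩ := exists_ne_ne_of_three_le_card hι a c
    have ha := hε a
    have hb := hε b
    have hc := hε c
    have hR : ∀ k l m, k ≠ l → m ∈ N → rotMatrix ε k l (rotMatrix ε k l m) ∈ N :=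
      fun k l m hkl h ↦ hN k l _ hkl (hN k l m hkl h)
    -- The mask for `a b` keeps the entry `(a, c)` and kills the diagonal entries at `a` and `c`, as
    -- the projection onto `symUnit a c` requires.
    have h1 := N.add_mem (hR a b _ hba.symm (hR a b m hba.symm hmN))
      (N.smul_mem (4 * (ε a * ε b)) (hR a b m hba.symm hmN))
    set m1 := rotMatrix ε a b (rotMatrix ε a b (rotMatrix ε a b (rotMatrix ε a b m)))
      + (4 * (ε a * ε b)) • rotMatrix ε a b (rotMatrix ε a b m)
    have hm1 : ∀ x y, m1 x y = if ((x = a ∨ x = b) ↔ (y = a ∨ y = b)) then 0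
        else -3 * (ε a * ε b) ^ 2 * m x y := rotMatrix_mask_of_symm ε hba.symm m hm
    have hm1s : ∀ x y, m1 x y = m1 y x := by
      intro x y
      rw [hm1, hm1, hm x y]
      simp only [iff_comm]
    have h2 := N.add_mem (hR a c _ hac (hR a c m1 hac h1))
      (N.smul_mem (ε a * ε c) (hR a c m1 hac h1))
    refine ⟨a, c, hac, ?_⟩
    convert N.smul_mem (12 * (ε a * ε c) ^ 2 * (-3 * (ε a * ε b) ^ 2 * m a c))⁻¹ h2 using 1
    rw [eq_inv_smul_iff₀ (by positivity)]
    funext x y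
    have h3 := rotMatrix_proj_of_symm ε hac m1 hm1s (by simp [hm1])
      (by simp [hm1]) x y
    have h4 : m1 a c = -3 * (ε a * ε b) ^ 2 * m a c := by
      rw [hm1, if_neg (by simp [hac.symm, hbc.symm])]
    simp only [Pi.add_apply, Pi.smul_apply, smul_eq_mul]
    rw [h3, h4]
  · push Not at hoff
    -- A diagonal matrix that is not a multiple of the quadratic form has two entries out of
    -- proportion to it; the rotation in their plane gives an off-diagonal unit.
    obtain ⟨a, b, hab⟩ : ∃ a b, ε b * m a a - ε a * m b b ≠ 0 := by
      by_contra! h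
      obtain ⟨a⟩ : Nonempty ι := Fintype.card_pos_iff.mp (by omega)
      apply hm0 (m a a / ε a)
      funext x y
      have := hε a
      split_ifs with hxy
      · subst hxy
        have := h a x
        field_simp
        linarith
      · exact hoff x y hxy
    have hne : a ≠ b := by
      rintro rfl; exact hab (sub_self _)
    refine ⟨a, b, hne, ?_⟩
    convert N.smul_mem (ε b * m a a - ε a * m b b)⁻¹ (hN a b m hne hmN) using 1
    rw [eq_inv_smul_iff₀ hab]
    funext x y
    simp only [rotMatrix, symUnit, Pi.smul_apply, smul_eq_mul]
    grind

end Rotations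

/-! ### Invariant subspaces of the space of coordinates -/

section Classification

variable {ι κ : Type*} [Fintype ι] [DecidableEq ι] [Fintype κ] [DecidableEq κ]

/-- A rotation invariant space of symmetric matrices is one of the four obvious ones. -/
theorem symm_submodule_cases {δ : κ → ℝ} (hδ : ∀ a, δ a ≠ 0) (hκ : 3 ≤ Fintype.card κ)
    {N : Submodule ℝ (κ → κ → ℝ)} (hsym : ∀ m ∈ N, ∀ a b, m a b = m b a)
    (hN : ∀ k l m, k ≠ l → m ∈ N → rotMatrix δ k l m ∈ N) :
    (∀ m, m ∈ N ↔ m = 0) ∨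
    (∀ m, m ∈ N ↔ ∃ c : ℝ, m = fun a b ↦ if a = b then c * δ a else 0) ∨
    (∀ m, m ∈ N ↔ (∀ a b, m a b = m b a) ∧ ∑ a, (δ a)⁻¹ * m a a = 0) ∨
    (∀ m, m ∈ N ↔ ∀ a b, m a b = m b a) := by
  by_cases h1 : ∃ m ∈ N, ∀ c : ℝ, m ≠ fun a b ↦ if a = b then c * δ a else 0
  · obtain ⟨m, hmN, hm⟩ := h1
    right; right
    have hS := fun m' ↦ symm_mem_of_rotMatrix_mem hδ hκ hN (hsym m hmN) hmN hm (m' := m')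
    by_cases h2 : ∃ m ∈ N, ∑ a, (δ a)⁻¹ * m a a ≠ 0
    · obtain ⟨m₁, hm₁N, hm₁⟩ := h2
      right
      intro m'
      refine ⟨hsym m', fun h ↦ ?_⟩
      -- The multiple of `m₁` having the trace of `m'`, so that the difference is traceless.
      set t := (∑ a, (δ a)⁻¹ * m' a a) / ∑ a, (δ a)⁻¹ * m₁ a a
      have := hS (m' - t • m₁) (fun a b ↦ by simp [h a b, hsym m₁ hm₁N a b]) (by
        simp only [Pi.sub_apply, Pi.smul_apply, smul_eq_mul, mul_sub, Finset.sum_sub_distrib]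
        simp only [mul_left_comm _ t, ← Finset.mul_sum]
        simp [t, hm₁])
      simpa using N.add_mem this (N.smul_mem t hm₁N)
    · push Not at h2
      left
      exact fun m' ↦ ⟨fun h ↦ ⟨hsym m' h, h2 m' h⟩, fun h ↦ hS m' h.1 h.2⟩
  · push Not at h1
    by_cases h2 : ∀ m ∈ N, m = 0
    · exact Or.inl fun m ↦ ⟨h2 m, fun h ↦ h ▸ N.zero_mem⟩
    · push Not at h2
      obtain ⟨m, hmN, hm⟩ := h2
      right; left
      obtain ⟨c, rfl⟩ := h1 m hmN
      have hc : c ≠ 0 := by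
        rintro rfl
        exact hm (by funext a b; simp)
      intro m'
      refine ⟨h1 m', ?_⟩
      rintro ⟨c', rfl⟩
      convert N.smul_mem (c' / c) hmN using 1
      funext a b
      simp only [Pi.smul_apply, smul_eq_mul]
      split_ifs
      · field_simp
      · simp

/-- The coordinates of intrinsic torsions: families `c` which are antisymmetric in the first two
indices, and `s` which are symmetric in the last two. A subspace invariant under the rotations of
both kinds and under the boosts is one of five. -/
theorem coord_submodule_cases {ε : ι → ℝ} {δ : κ → ℝ} (hε : ∀ i, ε i ≠ 0) (hδ : ∀ a, δ a ≠ 0)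
    (hι : 3 ≤ Fintype.card ι) (hκ : 3 ≤ Fintype.card κ)
    (hι4 : Fintype.card ι = 4 → ∏ i, ε i < 0)
    {B : Submodule ℝ ((ι → ι → κ → ℝ) × (ι → κ → κ → ℝ))}
    (hc : ∀ x ∈ B, ∀ i j a, x.1 i j a = - x.1 j i a)
    (hs : ∀ x ∈ B, ∀ i a b, x.2 i a b = x.2 i b a)
    (hL : ∀ k l, k ≠ l → ∀ x ∈ B,
      (fun i j a ↦ rotMatrix ε k l (fun i j ↦ x.1 i j a) i j, rotFamily ε k l x.2) ∈ B)
    (hR : ∀ k l, k ≠ l → ∀ x ∈ B,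
      (fun i j ↦ rotFamily δ k l (x.1 i j), fun i ↦ rotMatrix δ k l (x.2 i)) ∈ B)
    (hA : ∀ k d, ∀ x ∈ B, ((0, fun i a b ↦ (if a = d then x.1 i k b else 0)
      + (if b = d then x.1 i k a else 0)) : (ι → ι → κ → ℝ) × (ι → κ → κ → ℝ)) ∈ B) :
    (∀ x, x ∈ B ↔ x.1 = 0 ∧ x.2 = 0) ∨
    (∀ x, x ∈ B ↔ x.1 = 0 ∧ ∀ i, ∃ c : ℝ, x.2 i = fun a b ↦ if a = b then c * δ a else 0) ∨
    (∀ x, x ∈ B ↔ x.1 = 0 ∧ ∀ i, (∀ a b, x.2 i a b = x.2 i b a) ∧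
      ∑ a, (δ a)⁻¹ * x.2 i a a = 0) ∨
    (∀ x, x ∈ B ↔ x.1 = 0 ∧ ∀ i a b, x.2 i a b = x.2 i b a) ∨
    (∀ x, x ∈ B ↔ (∀ i j a, x.1 i j a = - x.1 j i a) ∧ ∀ i a b, x.2 i a b = x.2 i b a) := by
  by_cases hB : ∃ x ∈ B, x.1 ≠ 0
  · right; right; right; right
    obtain ⟨x₀, hx₀, hne⟩ := hB
    -- the antisymmetric parts occurring in `B`
    let sw : (κ → ι → ι → ℝ) →ₗ[ℝ] (ι → ι → κ → ℝ) :=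
      { toFun := fun f i j a ↦ f a i j
        map_add' := fun _ _ ↦ rfl
        map_smul' := fun _ _ ↦ rfl }
    -- The first components are viewed as families indexed by `κ` with values in antisymmetric
    -- matrices. Rotations of `κ` then act by `rotFamily`, and each member of a family can be
    -- isolated.
    let C : Submodule ℝ (κ → ι → ι → ℝ) := (B.map (LinearMap.fst ℝ _ _)).comap sw
    have hC : ∀ f, f ∈ C ↔ ∃ s, (fun i j a ↦ f a i j, s) ∈ B := by
      intro f
      constructor
      · rintro ⟨x, hx, hxe⟩
        refine ⟨x.2, ?_⟩
        have : (sw f, x.2) = x := Prod.ext hxe.symm rfl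
        rwa [← this] at hx
      · rintro ⟨s, hs⟩
        exact ⟨_, hs, rfl⟩
    have hCrot : ∀ k l f, k ≠ l → f ∈ C → rotFamily δ k l f ∈ C := by
      intro k l f hkl hf
      obtain ⟨s, hs⟩ := (hC f).1 hf
      refine (hC _).2 ⟨fun i ↦ rotMatrix δ k l (s i), ?_⟩
      convert hR k l hkl _ hs using 2
      funext i j a
      simp only [rotFamily]
      split_ifs <;> rfl
    have hCmat : ∀ k l f, k ≠ l → f ∈ C → (fun a ↦ rotMatrix ε k l (f a)) ∈ C := by
      intro k l f hkl hf
      obtain ⟨s, hs⟩ := (hC f).1 hf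
      exact (hC _).2 ⟨_, hL k l hkl _ hs⟩
    have hx₀C : (fun a i j ↦ x₀.1 i j a) ∈ C := (hC _).2 ⟨x₀.2, hx₀⟩
    obtain ⟨a₀, ha₀⟩ : ∃ a, (fun i j ↦ x₀.1 i j a) ≠ 0 := by
      by_contra! h
      apply hne
      funext i j a
      exact congrFun (congrFun (h a) i) j
    have hsingle : ∀ d (m : ι → ι → ℝ), (∀ i j, m i j = - m j i) → Pi.single d m ∈ C := by
      intro d m hm
      refine antisymm_mem_of_rotMatrix_mem hε hι hι4
        (N := C.comap (LinearMap.single ℝ (fun _ ↦ ι → ι → ℝ) d)) ?_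
        (fun i j ↦ hc x₀ hx₀ i j a₀) ?_ ha₀ hm
      · intro k l m hkl hm
        simp only [Submodule.mem_comap, LinearMap.coe_single] at hm ⊢
        convert hCmat k l _ hkl hm using 1
        funext a
        rcases eq_or_ne a d with rfl | had
        · simp
        · simp only [Pi.single_eq_of_ne had]
          funext i j
          simp [rotMatrix]
      · simpa using single_mem_of_rotFamily_mem hδ hκ hCrot hx₀C a₀ d
    have hall : ∀ c : ι → ι → κ → ℝ, (∀ i j a, c i j a = - c j i a) → ∃ s, (c, s) ∈ B := by
      intro c hc'
      refine (hC fun a i j ↦ c i j a).1 ?_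
      rw [← Finset.univ_sum_single fun a i j ↦ c i j a]
      exact C.sum_mem fun d _ ↦ hsingle d _ fun i j ↦ hc' i j d
    have hunit : ∀ i d b, ((0, Pi.single i (symUnit d b)) :
        (ι → ι → κ → ℝ) × (ι → κ → κ → ℝ)) ∈ B := by
      intro i d b
      obtain ⟨k, hk, -⟩ := exists_ne_ne_of_three_le_card hι i i
      -- The boost contracts the second index of c with `k`. Applied to `antiUnit i k` tensored with
      -- the basis vector at `b`, it leaves `symUnit d b` in row `i` alone, whatever the second
      -- component `s` was.
      obtain ⟨s, hs'⟩ := hall (fun x y a ↦ antiUnit i k x y * (if a = b then 1 else 0)) (by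
        intro x y a
        rw [← neg_mul]
        congr 1
        simp [antiUnit, and_comm])
      convert hA k d _ hs' using 2
      funext x y z
      rcases eq_or_ne x i with rfl | hxi
      · simp only [Pi.single_eq_same, symUnit, antiUnit]
        grind
      · simp only [Pi.single_eq_of_ne hxi, antiUnit, Pi.zero_apply]
        grind
    have hsymm : ∀ s : ι → κ → κ → ℝ, (∀ i a b, s i a b = s i b a) →
        ((0, s) : (ι → ι → κ → ℝ) × (ι → κ → κ → ℝ)) ∈ B := by
      intro s hs'
      have e : s = ∑ i, Pi.single i ((1 / 2 : ℝ) • ∑ a, ∑ b, s i a b • symUnit a b) := by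
        conv_lhs => rw [← Finset.univ_sum_single s]
        refine Finset.sum_congr rfl fun i _ ↦ ?_
        rw [← sum_symUnit (hs' i)]
      have : ((0, s) : (ι → ι → κ → ℝ) × (ι → κ → κ → ℝ)) ∈ B ↔
        s ∈ B.comap (LinearMap.inr ℝ (ι → ι → κ → ℝ) (ι → κ → κ → ℝ)) := Iff.rfl
      rw [this, e]
      refine Submodule.sum_mem _ fun i _ ↦ ?_
      change LinearMap.single ℝ (fun _ : ι ↦ κ → κ → ℝ) i _ ∈ _
      simp only [map_smul, map_sum]
      refine Submodule.smul_mem _ _ (Submodule.sum_mem _ fun a _ ↦ Submodule.sum_mem _ fun b _ ↦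
        Submodule.smul_mem _ _ (hunit i a b))
    rintro ⟨c, s⟩
    refine ⟨fun h ↦ ⟨hc _ h, hs _ h⟩, fun ⟨h1, h2⟩ ↦ ?_⟩
    obtain ⟨s', hs'⟩ := hall c h1
    have := B.add_mem hs' (hsymm (s - s') fun i a b ↦ by
      exact congrArg₂ (· - ·) (h2 i a b) (hs _ hs' i a b))
    simpa using this
  · push Not at hB
    -- All first components vanish here. The second components are families indexed by `ι`, so a
    -- single space `N` of symmetric matrices governs every row.
    let C : Submodule ℝ (ι → κ → κ → ℝ) :=
      B.comap (LinearMap.inr ℝ (ι → ι → κ → ℝ) (ι → κ → κ → ℝ))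
    have hC : ∀ x, x ∈ B ↔ x.1 = 0 ∧ x.2 ∈ C := by
      rintro ⟨c, s⟩
      refine ⟨fun h ↦ ?_, ?_⟩
      · have h0 := hB _ h
        simp only at h0
        subst h0
        exact ⟨rfl, h⟩
      · rintro ⟨rfl, h⟩
        exact h
    have hCrot : ∀ k l f, k ≠ l → f ∈ C → rotFamily ε k l f ∈ C := by
      intro k l f hkl hf
      exact ((hC _).1 (hL k l hkl _ hf)).2
    obtain ⟨i₀⟩ : Nonempty ι := Fintype.card_pos_iff.mp (by omega)
    let N : Submodule ℝ (κ → κ → ℝ) := C.comap (LinearMap.single ℝ (fun _ ↦ κ → κ → ℝ) i₀)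
    have hN : ∀ m, m ∈ N ↔ Pi.single i₀ m ∈ C := fun _ ↦ Iff.rfl
    have hCN : ∀ s, s ∈ C ↔ ∀ i, s i ∈ N := by
      intro s
      refine ⟨fun h i ↦ single_mem_of_rotFamily_mem hε hι hCrot h i i₀, fun h ↦ ?_⟩
      rw [← Finset.univ_sum_single s]
      refine C.sum_mem fun i _ ↦ ?_
      simpa using single_mem_of_rotFamily_mem hε hι hCrot (h i) i₀ i
    have hcases := symm_submodule_cases hδ hκ (N := N)
      (fun m hm a b ↦ by simpa using hs _ hm i₀ a b) (by
        intro k l m hkl hm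
        have := ((hC _).1 (hR k l hkl _ hm)).2
        rw [hN]
        convert this using 1
        funext i
        rcases eq_or_ne i i₀ with rfl | hi
        · simp
        · simp only [LinearMap.coe_single, LinearMap.inr_apply, Pi.single_eq_of_ne hi]
          funext a b
          simp [rotMatrix])
    rcases hcases with h | h | h | h
    · left
      intro x
      rw [hC, hCN]
      simp only [h]
      rw [funext_iff (f := x.2)]
      rfl
    · right; left
      intro x
      rw [hC, hCN]
      simp only [h]
    · right; right; left
      intro x
      rw [hC, hCN]
      simp only [h]
    · right; right; right; left
      intro x
      rw [hC, hCN]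
      simp only [h]

end Classification

namespace GalileanModel

variable {p D : ℕ} (S : GalileanModel p D)

/-! ### The inner product `γ` and adapted bases -/

theorem mem_W_iff {w : RVec D} : w ∈ S.W ↔ ∀ v, S.η w v = 0 := by
  rw [← S.ker_η, LinearMap.mem_ker]
  exact ⟨fun h v ↦ by rw [h]; rfl, fun h ↦ LinearMap.ext h⟩

theorem η_left {w : RVec D} (hw : w ∈ S.W) (v : RVec D) : S.η w v = 0 := S.mem_W_iff.1 hw v

theorem η_right {w : RVec D} (hw : w ∈ S.W) (v : RVec D) : S.η v w = 0 := by
  rw [S.η_symm, S.η_left hw]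

theorem exists_sharp {w : RVec D} (hw : w ∈ S.W) : ∃ α, S.sharp α = w := by
  rwa [← S.range_sharp] at hw

theorem sharp_mem (α : Dual ℝ (RVec D)) : S.sharp α ∈ S.W := by
  rw [← S.range_sharp]; exact ⟨α, rfl⟩

/-- The inner product `γ` as a bilinear form on `W`. -/
def γForm : LinearMap.BilinForm ℝ S.W :=
  LinearMap.mk₂ ℝ (fun w w' ↦ S.γ w w')
    (fun w₁ w₂ w' ↦ by
      obtain ⟨α, hα⟩ := S.exists_sharp w₁.2
      obtain ⟨β, hβ⟩ := S.exists_sharp w₂.2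
      rw [Submodule.coe_add, ← hα, ← hβ, ← map_add, S.γ_sharp _ w'.2, S.γ_sharp _ w'.2,
        S.γ_sharp _ w'.2, LinearMap.add_apply])
    (fun c w w' ↦ by
      obtain ⟨α, hα⟩ := S.exists_sharp w.2
      rw [Submodule.coe_smul, ← hα, ← map_smul, S.γ_sharp _ w'.2, S.γ_sharp _ w'.2,
        LinearMap.smul_apply])
    (fun w w₁ w₂ ↦ by
      obtain ⟨α, hα⟩ := S.exists_sharp w.2
      rw [← hα, S.γ_sharp _ (w₁ + w₂).2, S.γ_sharp _ w₁.2, S.γ_sharp _ w₂.2, Submodule.coe_add,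
        map_add])
    (fun c w w₁ ↦ by
      obtain ⟨α, hα⟩ := S.exists_sharp w.2
      rw [← hα, S.γ_sharp _ (c • w₁).2, S.γ_sharp _ w₁.2, Submodule.coe_smul, map_smul])

theorem γForm_apply (w w' : S.W) : S.γForm w w' = S.γ w w' := rfl

theorem γ_symm {w w' : RVec D} (hw : w ∈ S.W) (hw' : w' ∈ S.W) : S.γ w w' = S.γ w' w := by
  obtain ⟨α, rfl⟩ := S.exists_sharp hw
  obtain ⟨β, rfl⟩ := S.exists_sharp hw'
  rw [S.γ_sharp _ hw', S.γ_sharp _ hw, S.apply_sharp, S.apply_sharp, S.h_symm]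

theorem eq_zero_of_γ {w : RVec D} (hw : w ∈ S.W) (h : ∀ w' ∈ S.W, S.γ w w' = 0) : w = 0 := by
  obtain ⟨α, rfl⟩ := S.exists_sharp hw
  have hα : α ∈ S.W.dualAnnihilator := by
    rw [Submodule.mem_dualAnnihilator]
    intro w' hw'
    rw [← S.γ_sharp α hw', h w' hw']
  rw [← S.ker_h, LinearMap.mem_ker] at hα
  rw [← forall_dual_apply_eq_zero_iff ℝ]
  intro β
  rw [S.apply_sharp, S.h_symm, hα, LinearMap.zero_apply]

theorem γForm_nondegenerate : S.γForm.Nondegenerate := by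
  refine ⟨fun w hw ↦ ?_, fun w hw ↦ ?_⟩
  · exact Subtype.ext (S.eq_zero_of_γ w.2 fun w' hw' ↦ hw ⟨w', hw'⟩)
  · refine Subtype.ext (S.eq_zero_of_γ w.2 fun w' hw' ↦ ?_)
    rw [S.γ_symm w.2 hw']
    exact hw ⟨w', hw'⟩

/-- A basis of `ℝ^D` which consists of an orthogonal basis of `W` and of vectors which are
orthogonal with respect to `η`. -/
structure AdaptedBasis (ι κ : Type*) [DecidableEq ι] [DecidableEq κ] where
  b : Basis (ι ⊕ κ) ℝ (RVec D)
  ε : ι → ℝ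
  δ : κ → ℝ
  ε_ne : ∀ i, ε i ≠ 0
  δ_ne : ∀ a, δ a ≠ 0
  mem_W : ∀ i, b (.inl i) ∈ S.W
  γ_apply : ∀ i j, S.γ (b (.inl i)) (b (.inl j)) = if i = j then ε i else 0
  η_apply : ∀ a c, S.η (b (.inr a)) (b (.inr c)) = if a = c then δ a else 0

theorem exists_adaptedBasis :
    Nonempty (S.AdaptedBasis (Fin (finrank ℝ S.W)) (Fin (p + 1))) := by
  obtain ⟨U, hU⟩ := S.W.exists_isCompl
  have hγ : LinearMap.IsSymm S.γForm := ⟨fun w w' ↦ S.γ_symm w.2 w'.2⟩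
  have hη : LinearMap.IsSymm S.η := ⟨fun w w' ↦ S.η_symm w w'⟩
  obtain ⟨e, he⟩ := LinearMap.BilinForm.exists_orthogonal_basis hγ
  have hηU : LinearMap.IsSymm (S.η.domRestrict₁₂ U U) := ⟨fun w w' ↦ S.η_symm w w'⟩
  obtain ⟨u, hu⟩ := LinearMap.BilinForm.exists_orthogonal_basis hηU
  -- Since W is the whole kernel of `η`, the form is non-degenerate on any complement; so the
  -- diagonal entries `δ` do not vanish.
  have hηn : (S.η.domRestrict₁₂ U U).Nondegenerate :=
    hη.nondegenerate_restrict_of_isCompl_ker (by rw [S.ker_η]; exact hU.symm)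
  have hfr : finrank ℝ U = p + 1 := by
    have h1 := Submodule.finrank_add_eq_of_isCompl hU
    have h2 := S.finrank_W
    rw [finrank_euclideanSpace_fin] at h1
    omega
  let u' := u.reindex (finCongr hfr)
  have hu' : ∀ a c, a ≠ c → S.η (u' a) (u' c) = 0 := by
    intro a c hac
    simpa [u', Function.onFun] using! @hu ((finCongr hfr).symm a) ((finCongr hfr).symm c) (by simpa using hac)
  refine ⟨⟨(e.prod u').map (Submodule.prodEquivOfIsCompl _ _ hU), fun i ↦ S.γ (e i) (e i),
    fun a ↦ S.η (u' a) (u' a), ?_, ?_, ?_, ?_, ?_⟩⟩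
  · intro i
    exact he.not_isOrtho_basis_self_of_separatingLeft S.γForm_nondegenerate.1 i
  · intro a
    simpa [u'] using!
      hu.not_isOrtho_basis_self_of_separatingLeft hηn.1 ((finCongr hfr).symm a)
  · intro i
    simp
  · intro i j
    split_ifs with hij
    · subst hij; simp
    · simpa [Function.onFun, γForm_apply] using he hij
  · intro i j
    split_ifs with hij
    · subst hij; simp
    · simpa using hu' _ _ hij

namespace AdaptedBasis

variable {S} {ι κ : Type*} [DecidableEq ι] [DecidableEq κ] [Fintype ι] [Fintype κ]
  (b : S.AdaptedBasis ι κ)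

/-- The vectors of the basis which lie in `W`. -/
abbrev e (i : ι) : RVec D := b.b (.inl i)

/-- The vectors of the basis which span a complement of `W`. -/
abbrev u (a : κ) : RVec D := b.b (.inr a)

omit [Fintype ι] [Fintype κ] in
theorem η_e (i : ι) (v : RVec D) : S.η (b.e i) v = 0 := S.η_left (b.mem_W i) v

omit [Fintype ι] [Fintype κ] in
theorem η_e' (i : ι) (v : RVec D) : S.η v (b.e i) = 0 := S.η_right (b.mem_W i) v

theorem eq_sum (v : RVec D) :
    v = ∑ i, b.b.repr v (.inl i) • b.e i + ∑ a, b.b.repr v (.inr a) • b.u a := by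
  conv_lhs => rw [← b.b.sum_repr v, Fintype.sum_sum_type]

theorem repr_inr (v : RVec D) (a : κ) : b.b.repr v (.inr a) = (b.δ a)⁻¹ * S.η v (b.u a) := by
  conv_rhs => rw [b.eq_sum v]
  have := b.δ_ne a
  simp [b.η_e, b.η_apply]
  field_simp

theorem mem_W_iff {v : RVec D} : v ∈ S.W ↔ ∀ a, S.η v (b.u a) = 0 := by
  refine ⟨fun h a ↦ S.η_left h _, fun h ↦ ?_⟩
  rw [b.eq_sum v]
  refine S.W.add_mem (S.W.sum_mem fun i _ ↦ S.W.smul_mem _ (b.mem_W i)) ?_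
  simp [b.repr_inr, h]

theorem eq_sum_of_mem {w : RVec D} (hw : w ∈ S.W) : w = ∑ i, b.b.repr w (.inl i) • b.e i := by
  conv_lhs => rw [b.eq_sum w]
  simp [b.repr_inr, S.η_left hw]

omit [Fintype ι] [Fintype κ] in
theorem γ_sum_left {σ : Type*} (s : Finset σ) (c : σ → ℝ) (x : σ → RVec D) (hx : ∀ i ∈ s, x i ∈ S.W)
    {w : RVec D} (hw : w ∈ S.W) : S.γ (∑ i ∈ s, c i • x i) w = ∑ i ∈ s, c i * S.γ (x i) w := by
  classical
  induction s using Finset.induction_on with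
  | empty => simpa using S.γ_sharp 0 hw
  | insert a s ha ih =>
    have h1 := hx a (Finset.mem_insert_self a s)
    have h2 := fun i hi ↦ hx i (Finset.mem_insert_of_mem hi)
    rw [Finset.sum_insert ha, Finset.sum_insert ha, ← ih h2]
    have h3 : ∑ i ∈ s, c i • x i ∈ S.W := S.W.sum_mem fun i hi ↦ S.W.smul_mem _ (h2 i hi)
    have := congrArg (fun f ↦ f ⟨w, hw⟩) (S.γForm.map_add (c a • ⟨x a, h1⟩) ⟨_, h3⟩)
    simp only [map_smul, LinearMap.add_apply, LinearMap.smul_apply, smul_eq_mul,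
      γForm_apply] at this
    exact this

theorem repr_inl {w : RVec D} (hw : w ∈ S.W) (i : ι) :
    b.b.repr w (.inl i) = (b.ε i)⁻¹ * S.γ w (b.e i) := by
  conv_rhs => rw [b.eq_sum_of_mem hw, γ_sum_left _ _ _ (fun i _ ↦ b.mem_W i) (b.mem_W i)]
  have := b.ε_ne i
  simp [b.γ_apply]
  field_simp

theorem sum_γ {w : RVec D} (hw : w ∈ S.W) : ∑ i, ((b.ε i)⁻¹ * S.γ w (b.e i)) • b.e i = w := by
  conv_rhs => rw [b.eq_sum_of_mem hw]
  simp [b.repr_inl hw]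

/-- A basis of the quotient by `W`. -/
def quotBasis : Basis κ ℝ (RVec D ⧸ S.W) :=
  .mk (v := fun a ↦ S.W.mkQ (b.u a))
    (by
      rw [Fintype.linearIndependent_iff]
      intro g hg a
      simp only [← map_smul, ← map_sum] at hg
      rw [Submodule.mkQ_apply, Submodule.Quotient.mk_eq_zero, b.mem_W_iff] at hg
      simpa [b.η_apply, b.δ_ne a] using hg a)
    (by
      rintro x -
      obtain ⟨v, rfl⟩ := S.W.mkQ_surjective x
      rw [b.eq_sum v, map_add, map_sum, map_sum]
      refine Submodule.add_mem _ (Submodule.sum_mem _ fun i _ ↦ ?_)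
        (Submodule.sum_mem _ fun a _ ↦ ?_)
      · rw [map_smul, (Submodule.Quotient.mk_eq_zero S.W).2 (b.mem_W i) |> (Submodule.mkQ_apply _ _).trans,
          smul_zero]
        exact Submodule.zero_mem _
      · rw [map_smul]
        exact Submodule.smul_mem _ _ (Submodule.subset_span ⟨a, rfl⟩))

theorem quotBasis_apply (a : κ) : b.quotBasis a = S.W.mkQ (b.u a) := by
  simp [quotBasis]

theorem quotBasis_repr (v : RVec D) (a : κ) :
    b.quotBasis.repr (S.W.mkQ v) a = (b.δ a)⁻¹ * S.η v (b.u a) := by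
  have : S.W.mkQ v = ∑ a, ((b.δ a)⁻¹ * S.η v (b.u a)) • b.quotBasis a := by
    simp only [b.quotBasis_apply, ← map_smul, ← map_sum]
    rw [← sub_eq_zero, ← map_sub, Submodule.mkQ_apply, Submodule.Quotient.mk_eq_zero, b.mem_W_iff]
    intro c
    simp [b.η_apply]
    have := b.δ_ne c
    field_simp
    simp
  rw [this, b.quotBasis.repr_sum_self]

theorem trace_mapQ (X : End ℝ (RVec D)) (hX : S.W ≤ S.W.comap X) :
    LinearMap.trace ℝ (RVec D ⧸ S.W) (S.W.mapQ S.W X hX) =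
      ∑ a, (b.δ a)⁻¹ * S.η (X (b.u a)) (b.u a) := by
  rw [LinearMap.trace_eq_matrix_trace ℝ b.quotBasis, Matrix.trace]
  refine Finset.sum_congr rfl fun a _ ↦ ?_
  rw [Matrix.diag_apply, LinearMap.toMatrix_apply, b.quotBasis_apply, Submodule.mkQ_apply,
    Submodule.mapQ_apply, ← Submodule.mkQ_apply, b.quotBasis_repr]

end AdaptedBasis

end GalileanModel

namespace GalileanModel

variable {p D : ℕ} (S : GalileanModel p D)

/-! ### The group and its Lie algebra -/

theorem val_inv_apply (g : GLVec D) (v : RVec D) : g.val ((g⁻¹).val v) = v := by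
  rw [← mul_apply_eq_comp, Units.mul_inv]; rfl

theorem inv_val_apply (g : GLVec D) (v : RVec D) : (g⁻¹).val (g.val v) = v := by
  rw [← mul_apply_eq_comp, Units.inv_mul]; rfl

variable {S} in
theorem map_mem_W {g : GLVec D} (hg : g ∈ S.fullGroup) {w : RVec D} (hw : w ∈ S.W) :
    g.val w ∈ S.W := by
  rw [S.mem_W_iff]
  intro v
  rw [← val_inv_apply g v, hg.1, S.η_left hw]

variable {S} in
theorem map_mem_W_iff {g : GLVec D} (hg : g ∈ S.fullGroup) {w : RVec D} :
    g.val w ∈ S.W ↔ w ∈ S.W := by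
  refine ⟨fun h ↦ ?_, map_mem_W hg⟩
  rw [← inv_val_apply g w]
  exact map_mem_W (S.fullGroup.inv_mem hg) h

variable {S} in
theorem map_sharp {g : GLVec D} (hg : g ∈ S.fullGroup) (α : Dual ℝ (RVec D)) :
    g.val (S.sharp α) = S.sharp (α ∘ₗ (g⁻¹).val.toLinearMap) := by
  rw [← sub_eq_zero, ← forall_dual_apply_eq_zero_iff ℝ]
  intro β
  have h1 : β (g.val (S.sharp α)) = (β ∘ₗ g.val.toLinearMap) (S.sharp α) := rfl
  have e : (β ∘ₗ g.val.toLinearMap) ∘ₗ (g⁻¹).val.toLinearMap = β := by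
    ext1 v
    exact congrArg β (val_inv_apply g v)
  rw [map_sub, h1, S.apply_sharp, S.apply_sharp, ← hg.2, e, sub_self]

variable {S} in
theorem γ_map {g : GLVec D} (hg : g ∈ S.fullGroup) {w w' : RVec D} (hw : w ∈ S.W)
    (hw' : w' ∈ S.W) : S.γ (g.val w) (g.val w') = S.γ w w' := by
  obtain ⟨α, rfl⟩ := S.exists_sharp hw
  rw [map_sharp hg, S.γ_sharp _ (map_mem_W hg hw'), S.γ_sharp _ hw']
  exact congrArg α (inv_val_apply g w')

variable {S} in
theorem lieAlg_mem_W {X : End ℝ (RVec D)} (hX : X ∈ S.lieAlg) {w : RVec D} (hw : w ∈ S.W) :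
    X w ∈ S.W := by
  rw [S.mem_W_iff]
  intro v
  have := hX.1 w v
  rwa [S.η_left hw, add_zero] at this

/-- The Lie algebra consists of the endomorphisms which preserve `W`, and are skew with respect to
`η` and `γ`. -/
theorem mem_lieAlg_of {X : End ℝ (RVec D)} (hW : ∀ w ∈ S.W, X w ∈ S.W)
    (hη : ∀ v v', S.η (X v) v' + S.η v (X v') = 0)
    (hγ : ∀ w ∈ S.W, ∀ w' ∈ S.W, S.γ (X w) w' + S.γ w (X w') = 0) : X ∈ S.lieAlg := by
  refine ⟨hη, fun α β ↦ ?_⟩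
  rw [S.h_symm α, ← S.apply_sharp, ← S.apply_sharp]
  have h1 := hγ _ (S.sharp_mem β) _ (S.sharp_mem α)
  rw [S.γ_symm (hW _ (S.sharp_mem β)) (S.sharp_mem α), S.γ_sharp _ (hW _ (S.sharp_mem β)),
    S.γ_sharp _ (hW _ (S.sharp_mem α))] at h1
  exact h1

variable {S} {ι κ : Type*} [DecidableEq ι] [DecidableEq κ] [Fintype ι] [Fintype κ]
  (b : S.AdaptedBasis ι κ)

/-- Pairings under `η` involving a vector of W need no check: X preserves W, which is the kernel of
`η`. The components of X from the complement into W are therefore free; they are the boosts. -/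
theorem AdaptedBasis.mem_lieAlg {X : End ℝ (RVec D)} (hW : ∀ i, X (b.e i) ∈ S.W)
    (hη : ∀ a c, S.η (X (b.u a)) (b.u c) + S.η (b.u a) (X (b.u c)) = 0)
    (hγ : ∀ i j, S.γ (X (b.e i)) (b.e j) + S.γ (b.e i) (X (b.e j)) = 0) : X ∈ S.lieAlg := by
  have hWW : ∀ w ∈ S.W, X w ∈ S.W := by
    intro w hw
    rw [b.eq_sum_of_mem hw, map_sum]
    exact S.W.sum_mem fun i _ ↦ by rw [map_smul]; exact S.W.smul_mem _ (hW i)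
  refine S.mem_lieAlg_of hWW ?_ ?_
  · have : S.η.comp X LinearMap.id + S.η.comp LinearMap.id X = 0 := by
      refine LinearMap.BilinForm.ext_basis b.b ?_
      rintro (i | a) (j | c)
      · simp [S.η_left (hW i), b.η_e]
      · simp [S.η_left (hW i), b.η_e]
      · simp [S.η_right (hW j), b.η_e']
      · simpa using hη a c
    intro v v'
    simpa using LinearMap.congr_fun₂ this v v'
  · intro w hw w' hw'
    have h1 : ∀ j, S.γ (X w) (b.e j) + S.γ w (X (b.e j)) = 0 := by
      intro j
      rw [b.eq_sum_of_mem hw, map_sum]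
      simp only [map_smul]
      rw [AdaptedBasis.γ_sum_left _ _ _ (fun i _ ↦ hW i) (b.mem_W j),
        AdaptedBasis.γ_sum_left _ _ _ (fun i _ ↦ b.mem_W i) (hW j), ← Finset.sum_add_distrib]
      refine Finset.sum_eq_zero fun i _ ↦ ?_
      rw [← mul_add, hγ, mul_zero]
    rw [S.γ_symm (hWW _ hw) hw', S.γ_symm hw (hWW _ hw'), b.eq_sum_of_mem hw', map_sum]
    simp only [map_smul]
    rw [AdaptedBasis.γ_sum_left _ _ _ (fun i _ ↦ b.mem_W i) (hWW _ hw),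
      AdaptedBasis.γ_sum_left _ _ _ (fun i _ ↦ hW i) hw, ← Finset.sum_add_distrib]
    refine Finset.sum_eq_zero fun i _ ↦ ?_
    rw [← mul_add, S.γ_symm (b.mem_W i) (hWW _ hw), S.γ_symm (hW i) hw, h1, mul_zero]

/-! ### The kernel and cokernel of the Spencer differential -/

/-- Torsions are bilinear. -/
def _root_.torsBilin (T : Tors D) : RVec D →ₗ[ℝ] RVec D →ₗ[ℝ] RVec D :=
  LinearMap.mk₂ ℝ (fun v v' ↦ T ![v, v'])
    (fun v₁ v₂ v' ↦ by
      have e : ∀ v, Function.update ![0, v'] 0 v = ![v, v'] := fun v ↦ by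
        ext i : 1; fin_cases i <;> simp
      have := T.map_update_add ![0, v'] 0 v₁ v₂
      rwa [e, e, e] at this)
    (fun c v v' ↦ by
      have e : ∀ v, Function.update ![0, v'] 0 v = ![v, v'] := fun v ↦ by
        ext i : 1; fin_cases i <;> simp
      have := T.map_update_smul ![0, v'] 0 c v
      rwa [e, e] at this)
    (fun v v₁ v₂ ↦ (contract T v).map_add v₁ v₂)
    (fun c v v' ↦ (contract T v).map_smul c v')

theorem _root_.torsBilin_apply (T : Tors D) (v v' : RVec D) : torsBilin T v v' = T ![v, v'] := rfl

theorem _root_.torsBilin_swap (T : Tors D) (v v' : RVec D) :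
    torsBilin T v v' = - torsBilin T v' v := by
  rw [torsBilin_apply, torsBilin_apply, ← T.map_swap ![v', v] (show (0 : Fin 2) ≠ 1 by decide)]
  congr 1
  ext i : 1
  fin_cases i <;> simp

theorem _root_.torsBilin_add (T T' : Tors D) : torsBilin (T + T') = torsBilin T + torsBilin T' := rfl

theorem _root_.torsBilin_smul (c : ℝ) (T : Tors D) : torsBilin (c • T) = c • torsBilin T := rfl

theorem _root_.torsBilin_torsAct (g : GLVec D) (T : Tors D) (v v' : RVec D) :
    torsBilin (torsAct g T) v v' = g.val (torsBilin T ((g⁻¹).val v) ((g⁻¹).val v')) := by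
  rw [torsBilin_apply, torsAct_apply, torsBilin_apply]
  congr 2
  ext i : 1
  fin_cases i <;> simp

theorem torsBilin_spencer (k : RVec D →ₗ[ℝ] S.lieAlg) (v v' : RVec D) :
    torsBilin (S.spencer k) v v' = (k v).val v' - (k v').val v := by
  rw [torsBilin_apply, spencer_apply]; rfl

/-- The coordinates of the intrinsic torsion. -/
def AdaptedBasis.coord : Tors D →ₗ[ℝ] (ι → ι → κ → ℝ) × (ι → κ → κ → ℝ) where
  toFun T := (fun i j a ↦ S.η (torsBilin T (b.e i) (b.e j)) (b.u a),
    fun i a c ↦ S.η (torsBilin T (b.e i) (b.u a)) (b.u c)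
      + S.η (torsBilin T (b.e i) (b.u c)) (b.u a))
  map_add' T T' := by
    ext <;> simp [torsBilin_add]
    ring
  map_smul' r T := by
    ext <;> simp [torsBilin_smul]
    ring

omit [Fintype ι] [Fintype κ] in
theorem AdaptedBasis.tors_ext {T T' : Tors D}
    (h1 : ∀ i j, torsBilin T (b.e i) (b.e j) = torsBilin T' (b.e i) (b.e j))
    (h2 : ∀ i a, torsBilin T (b.e i) (b.u a) = torsBilin T' (b.e i) (b.u a))
    (h3 : ∀ a c, torsBilin T (b.u a) (b.u c) = torsBilin T' (b.u a) (b.u c)) : T = T' := by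
  refine b.b.ext_alternating fun v _ ↦ ?_
  have e : (fun i ↦ b.b (v i)) = ![b.b (v 0), b.b (v 1)] := by
    ext i : 1; fin_cases i <;> rfl
  rw [e, ← torsBilin_apply, ← torsBilin_apply]
  rcases v 0 with i | a <;> rcases v 1 with j | c
  · exact h1 i j
  · exact h2 i c
  · rw [torsBilin_swap, torsBilin_swap T']
    exact congrArg _ (h2 j a)
  · exact h3 a c

-- In κ(e_i)v - κ(v)e_i the second term lies in W = ker η. The first lies in W if v does, and
-- otherwise cancels by skewness after symmetrisation.
omit [Fintype ι] [Fintype κ] in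
theorem AdaptedBasis.coord_spencer (k : RVec D →ₗ[ℝ] S.lieAlg) : b.coord (S.spencer k) = 0 := by
  ext i a c
  · change S.η (torsBilin _ _ _) _ = 0
    rw [torsBilin_spencer]
    exact S.η_left (S.W.sub_mem (lieAlg_mem_W (k _).2 (b.mem_W _))
      (lieAlg_mem_W (k _).2 (b.mem_W _))) _
  · change S.η (torsBilin _ _ _) _ + S.η (torsBilin _ _ _) _ = 0
    rw [torsBilin_spencer, torsBilin_spencer, map_sub, map_sub, LinearMap.sub_apply,
      LinearMap.sub_apply, S.η_left (lieAlg_mem_W (k _).2 (b.mem_W _)),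
      S.η_left (lieAlg_mem_W (k _).2 (b.mem_W _)), sub_zero, sub_zero, S.η_symm _ (b.u a)]
    exact (k (b.e i)).2.1 _ _

/-- A torsion is in the image of the Spencer differential if its coordinates vanish: the
corresponding connection is given by the formula of Koszul on `W` and on its complement. -/
theorem AdaptedBasis.mem_range_spencer_of_coord {T : Tors D} (hT : b.coord T = 0) :
    T ∈ LinearMap.range S.spencer := by
  have hc : ∀ i j, torsBilin T (b.e i) (b.e j) ∈ S.W := fun i j ↦ b.mem_W_iff.2 fun a ↦
    congrFun (congrFun (congrFun (congrArg Prod.fst hT) i) j) a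
  have hs : ∀ i a c, S.η (torsBilin T (b.e i) (b.u a)) (b.u c)
      + S.η (torsBilin T (b.e i) (b.u c)) (b.u a) = 0 := fun i a c ↦
    congrFun (congrFun (congrFun (congrArg Prod.snd hT) i) a) c
  let t : ι → ι → ι → ℝ := fun i j k ↦ S.γ (torsBilin T (b.e i) (b.e j)) (b.e k)
  let r : κ → κ → κ → ℝ := fun i j k ↦ S.η (torsBilin T (b.u i) (b.u j)) (b.u k)
  have ht : ∀ i j k, t i j k = - t j i k := by
    intro i j k
    have := AdaptedBasis.γ_sum_left (S := S) {0} (fun _ ↦ (-1 : ℝ))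
      (fun _ : Fin 1 ↦ torsBilin T (b.e j) (b.e i)) (fun _ _ ↦ hc _ _) (b.mem_W k)
    simp only [t]
    rw [torsBilin_swap]
    simpa using this
  have hr : ∀ i j k, r i j k = - r j i k := by
    intro i j k
    simp only [r]
    rw [torsBilin_swap, map_neg, LinearMap.neg_apply]
  let A : ι ⊕ κ → ι ⊕ κ → RVec D := fun x y ↦ match x, y with
    | .inl i, .inl j => ∑ k, ((2 * b.ε k)⁻¹ * (t i j k - t j k i + t k i j)) • b.e k
    | .inl i, .inr a => torsBilin T (b.e i) (b.u a)
    | .inr _, .inl _ => 0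
    | .inr a, .inr c => ∑ d, ((2 * b.δ d)⁻¹ * (r a c d - r c d a + r d a c)) • b.u d
        + (1 / 2 : ℝ) • ∑ i, b.b.repr (torsBilin T (b.u a) (b.u c)) (.inl i) • b.e i
  have hAw : ∀ i j, A (.inl i) (.inl j) ∈ S.W := fun i j ↦
    S.W.sum_mem fun k _ ↦ S.W.smul_mem _ (b.mem_W k)
  have hAη : ∀ a c d, S.η (A (.inr a) (.inr c)) (b.u d) =
      (1 / 2) * (r a c d - r c d a + r d a c) := by
    intro a c d
    have := b.δ_ne d
    simp [A, b.η_apply, b.η_e]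
    field_simp
  have hAγ : ∀ i j k, S.γ (A (.inl i) (.inl j)) (b.e k) =
      (1 / 2) * (t i j k - t j k i + t k i j) := by
    intro i j k
    have := b.ε_ne k
    change S.γ (∑ k, _ • b.e k) _ = _
    rw [AdaptedBasis.γ_sum_left _ _ _ (fun i _ ↦ b.mem_W i) (b.mem_W k)]
    simp [b.γ_apply]
    field_simp
  let K : ι ⊕ κ → S.lieAlg := fun x ↦ ⟨b.b.constr ℝ (A x), by
    rcases x with i | a
    · refine b.mem_lieAlg ?_ ?_ ?_
      · intro j
        rw [AdaptedBasis.e, Basis.constr_basis]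
        exact hAw i j
      · intro a c
        rw [AdaptedBasis.u, AdaptedBasis.u, Basis.constr_basis, Basis.constr_basis,
          S.η_symm (b.b _)]
        exact hs i a c
      · intro j k
        rw [AdaptedBasis.e, AdaptedBasis.e, Basis.constr_basis, Basis.constr_basis,
          S.γ_symm (b.mem_W _) (hAw _ _), hAγ, hAγ, ht k j i, ht j i k, ht i k j]
        ring
    · refine b.mem_lieAlg ?_ ?_ ?_
      · intro j
        rw [AdaptedBasis.e, Basis.constr_basis]
        exact S.W.zero_mem
      · intro c d
        rw [AdaptedBasis.u, AdaptedBasis.u, Basis.constr_basis, Basis.constr_basis,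
          S.η_symm (b.b _), hAη, hAη, hr d c a, hr c a d, hr a d c]
        ring
      · intro j k
        rw [AdaptedBasis.e, AdaptedBasis.e, Basis.constr_basis, Basis.constr_basis,
          S.γ_symm (b.mem_W _) S.W.zero_mem]
        change S.γ 0 _ + S.γ 0 _ = 0
        have : ∀ k, S.γ 0 (b.e k) = 0 := fun k ↦ by simpa using S.γ_sharp 0 (b.mem_W k)
        rw [this, this, add_zero]⟩
  have hK : ∀ x y, (K x).val (b.b y) = A x y := fun x y ↦ Basis.constr_basis _ _ _ _
  have hK' : ∀ x, b.b.constr ℝ K (b.b x) = K x := fun x ↦ Basis.constr_basis _ _ _ _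
  refine ⟨b.b.constr ℝ K, b.tors_ext ?_ ?_ ?_⟩
  · intro i j
    rw [torsBilin_spencer, AdaptedBasis.e, AdaptedBasis.e, hK', hK', hK, hK]
    conv_rhs => rw [← b.sum_γ (hc i j)]
    rw [← Finset.sum_sub_distrib]
    refine Finset.sum_congr rfl fun k _ ↦ ?_
    rw [← sub_smul]
    congr 1
    change _ = (b.ε k)⁻¹ * t i j k
    have := b.ε_ne k
    rw [ht k i j, ht j i k, ht k j i]
    field_simp
    ring
  · intro i a
    rw [torsBilin_spencer, AdaptedBasis.e, AdaptedBasis.u, hK', hK', hK, hK]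
    exact sub_zero _
  · intro a c
    rw [torsBilin_spencer, AdaptedBasis.u, AdaptedBasis.u, hK', hK', hK, hK]
    conv_rhs => rw [b.eq_sum (torsBilin T (b.u a) (b.u c))]
    have h1 : ∀ i, b.b.repr (torsBilin T (b.u c) (b.u a)) (.inl i) =
        - b.b.repr (torsBilin T (b.u a) (b.u c)) (.inl i) := by
      intro i
      rw [torsBilin_swap, map_neg]; rfl
    simp only [A, h1, neg_smul, Finset.sum_neg_distrib, smul_neg]
    have h2 : ∀ d, b.b.repr (torsBilin T (b.u a) (b.u c)) (.inr d) =
      (2 * b.δ d)⁻¹ * (r a c d - r c d a + r d a c)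
        - (2 * b.δ d)⁻¹ * (r c a d - r a d c + r d c a) := by
      intro d
      rw [b.repr_inr]
      change (b.δ d)⁻¹ * r a c d = _
      have := b.δ_ne d
      rw [hr d a c, hr c a d, hr d c a]
      field_simp
      ring
    simp only [h2, sub_smul, Finset.sum_sub_distrib]
    module

theorem AdaptedBasis.range_spencer : LinearMap.range S.spencer = LinearMap.ker b.coord := by
  refine le_antisymm ?_ fun T hT ↦ b.mem_range_spencer_of_coord hT
  rintro _ ⟨k, rfl⟩
  exact b.coord_spencer k

end GalileanModel

namespace GalileanModel

variable {p D : ℕ} {S : GalileanModel p D} {ι κ : Type*} [DecidableEq ι] [DecidableEq κ]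
  [Fintype ι] [Fintype κ] (b : S.AdaptedBasis ι κ)

/-! ### The submodules in coordinates -/

namespace AdaptedBasis

omit [Fintype ι] [Fintype κ] in
theorem coord_fst_swap (T : Tors D) (i j : ι) (a : κ) :
    (b.coord T).1 i j a = - (b.coord T).1 j i a := by
  change S.η (torsBilin T _ _) _ = - S.η (torsBilin T _ _) _
  rw [torsBilin_swap, map_neg, LinearMap.neg_apply]

omit [Fintype ι] [Fintype κ] in
theorem coord_snd_swap (T : Tors D) (i : ι) (a c : κ) :
    (b.coord T).2 i a c = (b.coord T).2 i c a :=
  add_comm _ _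

theorem mem_torsInv_iff {T : Tors D} : T ∈ S.torsInv ↔ (b.coord T).1 = 0 := by
  constructor
  · intro h
    funext i j a
    exact S.η_left (h _ (b.mem_W i) _ (b.mem_W j)) _
  · intro h w hw w' hw'
    have hc : ∀ i j, torsBilin T (b.e i) (b.e j) ∈ S.W := fun i j ↦ b.mem_W_iff.2 fun a ↦
      congrFun (congrFun (congrFun h i) j) a
    rw [← torsBilin_apply, b.eq_sum_of_mem hw, b.eq_sum_of_mem hw']
    simp only [map_sum, map_smul, LinearMap.sum_apply, LinearMap.smul_apply]
    exact S.W.sum_mem fun i _ ↦ S.W.smul_mem _ (S.W.sum_mem fun j _ ↦ S.W.smul_mem _ (hc _ _))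

/-- The pair v = e_i, v' = u_a makes the right hand side of the defining equation vanish and gives c
= 0. The pair u_a, u_d gives the condition on s, with a sign because the definition evaluates T on
(v, w) and the coordinates on (w, v). -/
theorem mem_torsTr_iff {T : Tors D} : T ∈ S.torsTr ↔ (b.coord T).1 = 0 ∧
    ∀ i, ∃ c : ℝ, (b.coord T).2 i = fun a d ↦ if a = d then c * b.δ a else 0 := by
  constructor
  · rintro ⟨w₀, hw₀, h⟩
    refine ⟨?_, fun i ↦ ⟨- S.γ w₀ (b.e i), ?_⟩⟩
    · funext i j a
      have := h _ (b.mem_W j) (b.e i) (b.u a)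
      rwa [S.η_right (b.mem_W i), b.η_e, mul_zero, add_zero] at this
    · funext a d
      have := h _ (b.mem_W i) (b.u a) (b.u d)
      rw [b.η_apply, ← torsBilin_apply, ← torsBilin_apply, torsBilin_swap,
        torsBilin_swap _ (b.u d)] at this
      simp only [map_neg, LinearMap.neg_apply] at this
      change S.η (torsBilin T _ _) _ + S.η (torsBilin T _ _) _ = _
      split_ifs with h
      · rw [if_pos h] at this; linarith
      · rw [if_neg h] at this; linarith
  · rintro ⟨h1, h2⟩
    choose c hc using h2
    -- The vector of W whose `γ`-products with the basis vectors are `- c i`.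
    refine ⟨∑ i, (- c i * (b.ε i)⁻¹) • b.e i,
      S.W.sum_mem fun i _ ↦ S.W.smul_mem _ (b.mem_W i), ?_⟩
    have hγ : ∀ j, S.γ (∑ i, (- c i * (b.ε i)⁻¹) • b.e i) (b.e j) = - c j := by
      intro j
      rw [γ_sum_left _ _ _ (fun i _ ↦ b.mem_W i) (b.mem_W j)]
      have := b.ε_ne j
      simp [b.γ_apply]
      field_simp
    have key : ∀ j v v', S.η (torsBilin T v (b.e j)) v' + S.η (torsBilin T v' (b.e j)) v =
        - c j * S.η v v' := by
      intro j
      have : S.η.comp ((torsBilin T).flip (b.e j)) LinearMap.id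
          + (S.η.comp ((torsBilin T).flip (b.e j)) LinearMap.id).flip = (- c j) • S.η := by
        refine LinearMap.BilinForm.ext_basis b.b ?_
        have h3 : ∀ i a, S.η (torsBilin T (b.e i) (b.e j)) (b.u a) = 0 := fun i a ↦
          congrFun (congrFun (congrFun h1 i) j) a
        have h4 : ∀ a d, S.η (torsBilin T (b.e j) (b.u a)) (b.u d)
            + S.η (torsBilin T (b.e j) (b.u d)) (b.u a) = if a = d then c j * b.δ a else 0 :=
          fun a d ↦ congrFun (congrFun (hc j) a) d
        rintro (i | a) (k | d)
        · simp [b.η_e, b.η_e']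
        · simp [b.η_e, b.η_e', h3]
        · simp [b.η_e', h3]
        · have := h4 a d
          change S.η (torsBilin T (b.u a) (b.e j)) (b.u d) + S.η (torsBilin T (b.u d) (b.e j)) (b.u a)
            = - c j * S.η (b.u a) (b.u d)
          rw [b.η_apply, torsBilin_swap, torsBilin_swap _ (b.u d), map_neg, map_neg, LinearMap.neg_apply,
            LinearMap.neg_apply, ← neg_add, this]
          split_ifs <;> simp
      intro v v'
      simpa using LinearMap.congr_fun₂ this v v'
    intro w hw v v'
    have hw₀ : (∑ i, (- c i * (b.ε i)⁻¹) • b.e i) ∈ S.W :=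
      S.W.sum_mem fun i _ ↦ S.W.smul_mem _ (b.mem_W i)
    rw [S.γ_symm hw₀ hw, ← torsBilin_apply, ← torsBilin_apply, b.eq_sum_of_mem hw,
      γ_sum_left _ _ _ (fun i _ ↦ b.mem_W i) hw₀]
    simp only [map_sum, map_smul, LinearMap.sum_apply, LinearMap.smul_apply, smul_eq_mul]
    rw [← Finset.sum_add_distrib, Finset.sum_mul]
    refine Finset.sum_congr rfl fun i _ ↦ ?_
    rw [← mul_add, key, S.γ_symm (b.mem_W i) hw₀, hγ, mul_assoc]

theorem trace_contract (T : Tors D) (w : RVec D) (h : S.W ≤ S.W.comap (contract T w)) :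
    LinearMap.trace ℝ (RVec D ⧸ S.W) (S.W.mapQ S.W (contract T w) h) =
      ∑ a, (b.δ a)⁻¹ * S.η (torsBilin T w (b.u a)) (b.u a) :=
  b.trace_mapQ _ h

/-- The diagonal entries s_iaa are 2 η(T(e_i, u_a), u_a), so the trace of s_i with respect to `δ` is
twice the trace of T(e_i, ·) on V/W. -/
theorem mem_torsZero_iff {T : Tors D} : T ∈ S.torsZero ↔ (b.coord T).1 = 0 ∧
    ∀ i, (∀ a c, (b.coord T).2 i a c = (b.coord T).2 i c a) ∧
      ∑ a, (b.δ a)⁻¹ * (b.coord T).2 i a a = 0 := by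
  have e : ∀ i, ∑ a, (b.δ a)⁻¹ * (b.coord T).2 i a a =
      2 * ∑ a, (b.δ a)⁻¹ * S.η (torsBilin T (b.e i) (b.u a)) (b.u a) := by
    intro i
    rw [Finset.mul_sum]
    refine Finset.sum_congr rfl fun a _ ↦ ?_
    change _ * (S.η (torsBilin T _ _) _ + S.η (torsBilin T _ _) _) = _
    ring
  constructor
  · rintro ⟨h, htr⟩
    refine ⟨b.mem_torsInv_iff.1 h, fun i ↦ ⟨b.coord_snd_swap T i, ?_⟩⟩
    have := (b.trace_contract T _ _).symm.trans (htr _ (b.mem_W i))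
    rw [e, this, mul_zero]
  · rintro ⟨h, htr⟩
    refine ⟨b.mem_torsInv_iff.2 h, fun w hw ↦ ?_⟩
    refine (b.trace_contract T w _).trans ?_
    rw [b.eq_sum_of_mem hw]
    simp only [map_sum, map_smul, LinearMap.sum_apply, LinearMap.smul_apply, smul_eq_mul,
      Finset.mul_sum]
    rw [Finset.sum_comm]
    refine Finset.sum_eq_zero fun i _ ↦ ?_
    simp only [mul_left_comm _ (b.b.repr w (Sum.inl i)), ← Finset.mul_sum]
    have h2 := (htr i).2
    rw [e] at h2
    rw [(mul_eq_zero.1 h2).resolve_left two_ne_zero, mul_zero]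

omit [Fintype ι] in
/-- Every pair of families with the right symmetries occurs as the coordinates of a torsion. -/
theorem exists_coord_eq {c : ι → ι → κ → ℝ} {s : ι → κ → κ → ℝ}
    (hc : ∀ i j a, c i j a = - c j i a) (hs : ∀ i a d, s i a d = s i d a) :
    ∃ T : Tors D, b.coord T = (c, s) := by
  -- Half of `s`, because the coordinate adds the two orders of its last indices.
  let R : ι → κ → RVec D := fun i a ↦ ∑ d, ((b.δ d)⁻¹ * (s i a d / 2)) • b.u d
  let A : ι ⊕ κ → ι ⊕ κ → RVec D := fun x y ↦ match x, y with
    | .inl i, .inl j => ∑ d, ((b.δ d)⁻¹ * c i j d) • b.u d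
    | .inl i, .inr a => R i a
    | .inr a, .inl i => - R i a
    | .inr _, .inr _ => 0
  let B : RVec D →ₗ[ℝ] RVec D →ₗ[ℝ] RVec D := b.b.constr ℝ fun x ↦ b.b.constr ℝ (A x)
  have hB : ∀ x y, B (b.b x) (b.b y) = A x y := by
    intro x y
    simp only [B]
    rw [Basis.constr_basis, Basis.constr_basis]
  have hflip : B = - B.flip := by
    refine b.b.ext fun x ↦ b.b.ext fun y ↦ ?_
    rw [LinearMap.neg_apply, LinearMap.neg_apply, LinearMap.flip_apply, hB, hB]
    rcases x with i | a <;> rcases y with j | d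
    · simp only [A, ← Finset.sum_neg_distrib, ← neg_smul]
      refine Finset.sum_congr rfl fun d _ ↦ ?_
      rw [hc i j d, mul_neg]
    · simp [A]
    · simp [A]
    · simp [A]
  have halt : ∀ v, B v v = 0 := by
    intro v
    have := LinearMap.congr_fun₂ hflip v v
    rw [LinearMap.neg_apply, LinearMap.neg_apply, LinearMap.flip_apply] at this
    have h2 : (2 : ℝ) • B v v = 0 := by
      rw [two_smul]
      nth_rw 1 [this]
      exact neg_add_cancel _
    exact (smul_eq_zero.1 h2).resolve_left two_ne_zero
  have hT : ∀ v v', torsBilin (altOfBilin B halt) v v' = B v v' := fun v v' ↦ by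
    rw [torsBilin_apply, altOfBilin_apply]; rfl
  refine ⟨altOfBilin B halt, Prod.ext ?_ ?_⟩
  · funext i j a
    change S.η (torsBilin _ _ _) _ = _
    have := b.δ_ne a
    rw [hT, hB]
    simp [A, b.η_apply]
    field_simp
  · funext i a d
    change S.η (torsBilin _ _ _) _ + S.η (torsBilin _ _ _) _ = _
    have h1 := b.δ_ne a
    have h2 := b.δ_ne d
    rw [hT, hT, hB, hB]
    simp [A, R, b.η_apply]
    rw [hs i d a]
    field_simp
    ring

end AdaptedBasis

/-! ### Invariance under the group -/

theorem torsAct_mem_torsInv {g : GLVec D} (hg : g ∈ S.fullGroup) {T : Tors D}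
    (hT : T ∈ S.torsInv) : torsAct g T ∈ S.torsInv := by
  intro w hw w' hw'
  rw [← torsBilin_apply, torsBilin_torsAct]
  have hi := S.fullGroup.inv_mem hg
  exact map_mem_W hg (hT _ (map_mem_W hi hw) _ (map_mem_W hi hw'))

theorem torsAct_mem_torsTr {g : GLVec D} (hg : g ∈ S.fullGroup) {T : Tors D}
    (hT : T ∈ S.torsTr) : torsAct g T ∈ S.torsTr := by
  obtain ⟨w₀, hw₀, h⟩ := hT
  have hi := S.fullGroup.inv_mem hg
  refine ⟨g.val w₀, map_mem_W hg hw₀, fun w hw v v' ↦ ?_⟩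
  rw [← torsBilin_apply, ← torsBilin_apply, torsBilin_torsAct, torsBilin_torsAct]
  have e : ∀ x v, S.η (g.val x) v = S.η x ((g⁻¹).val v) := fun x v ↦ by
    conv_lhs => rw [← val_inv_apply g v, hg.1]
  have h1 := h _ (map_mem_W hi hw) ((g⁻¹).val v) ((g⁻¹).val v')
  rw [hi.1] at h1
  rw [e, e, torsBilin_apply, torsBilin_apply, h1, ← γ_map hg hw₀ (map_mem_W hi hw), val_inv_apply]

theorem torsAct_mem_torsZero {g : GLVec D} (hg : g ∈ S.fullGroup) {T : Tors D}
    (hT : T ∈ S.torsZero) : torsAct g T ∈ S.torsZero := by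
  obtain ⟨h, htr⟩ := hT
  have hi := S.fullGroup.inv_mem hg
  have hgT := torsAct_mem_torsInv hg h
  refine ⟨hgT, fun w hw ↦ ?_⟩
  have hmap : S.W ≤ S.W.comap g.val.toLinearMap := fun w hw ↦ map_mem_W hg hw
  have hmap' : S.W ≤ S.W.comap (g⁻¹).val.toLinearMap := fun w hw ↦ map_mem_W hi hw
  let e : (RVec D ⧸ S.W) ≃ₗ[ℝ] (RVec D ⧸ S.W) :=
    LinearEquiv.ofLinearMap (S.W.mapQ S.W _ hmap) (S.W.mapQ S.W _ hmap')
      (by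
        ext v
        simp only [LinearMap.comp_apply, Submodule.mkQ_apply, Submodule.mapQ_apply]
        exact congrArg _ (val_inv_apply g v))
      (by
        ext v
        simp only [LinearMap.comp_apply, Submodule.mkQ_apply, Submodule.mapQ_apply]
        exact congrArg _ (inv_val_apply g v))
  -- The endomorphism of V/W induced by g · T at w is conjugate, by the action of g on V/W, to the
  -- one induced by T at g⁻¹w.
  rw [← htr _ (map_mem_W hi hw)]
  refine Eq.trans ?_ (LinearMap.trace_conj' _ e)
  congr 1
  ext v
  rw [LinearEquiv.conj_apply]
  exact congrArg (Submodule.Quotient.mk (p := S.W)) (torsBilin_torsAct g T w v)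

end GalileanModel

/-! ### One-parameter groups -/

theorem HasDerivAt.bilin_apply {E F G : Type*} [NormedAddCommGroup E] [NormedSpace ℝ E]
    [FiniteDimensional ℝ E] [NormedAddCommGroup F] [NormedSpace ℝ F] [FiniteDimensional ℝ F]
    [NormedAddCommGroup G] [NormedSpace ℝ G] (B : E →ₗ[ℝ] F →ₗ[ℝ] G) {c : ℝ → E} {d : ℝ → F}
    {c' : E} {d' : F} {t : ℝ} (hc : HasDerivAt c c' t) (hd : HasDerivAt d d' t) :
    HasDerivAt (fun t ↦ B (c t) (d t)) (B c' (d t) + B (c t) d') t := by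
  have h := ((LinearMap.toContinuousBilinearMap B).hasFDerivAt.comp_hasDerivAt t hc).clm_apply hd
  exact h

/-- Subspaces of finite-dimensional spaces are closed, so a limit of difference quotients does not
leave them. This turns invariance under G into invariance under 𝔤. -/
theorem HasDerivAt.mem_of_forall_mem {E : Type*} [NormedAddCommGroup E] [NormedSpace ℝ E]
    [FiniteDimensional ℝ E] {B : Submodule ℝ E} {f : ℝ → E} {f' : E} {t : ℝ}
    (hf : HasDerivAt f f' t) (hB : ∀ t, f t ∈ B) : f' ∈ B := by
  have hcl : IsClosed (B : Set E) := B.closed_of_finiteDimensional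
  refine hcl.mem_of_tendsto hf.tendsto_slope (Filter.Eventually.of_forall fun s ↦ ?_)
  exact B.smul_mem _ (B.sub_mem (hB s) (hB t))

section OneParam

variable {E : Type*} [NormedAddCommGroup E] [NormedSpace ℝ E] [FiniteDimensional ℝ E]

/-- The one-parameter group generated by an endomorphism. -/
def oneParam (X : End ℝ E) (t : ℝ) : (E →L[ℝ] E)ˣ :=
  have : CompleteSpace E := FiniteDimensional.complete ℝ E
  letI := NormedAlgebra.restrictScalars ℚ ℝ (E →L[ℝ] E)
  { val := NormedSpace.exp (t • LinearMap.toContinuousLinearMap X)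
    inv := NormedSpace.exp ((-t) • LinearMap.toContinuousLinearMap X)
    val_inv := by
      rw [← NormedSpace.exp_add_of_commute]
      · rw [← add_smul, add_neg_cancel, zero_smul, NormedSpace.exp_zero]
      · exact ((Commute.refl _).smul_left _).smul_right _
    inv_val := by
      rw [← NormedSpace.exp_add_of_commute]
      · rw [← add_smul, neg_add_cancel, zero_smul, NormedSpace.exp_zero]
      · exact ((Commute.refl _).smul_left _).smul_right _ }

theorem oneParam_val (X : End ℝ E) (t : ℝ) :
    (oneParam X t).val = NormedSpace.exp (t • LinearMap.toContinuousLinearMap X) := rfl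

theorem oneParam_inv (X : End ℝ E) (t : ℝ) : (oneParam X t)⁻¹ = oneParam X (-t) := by
  ext1
  rfl

theorem oneParam_zero (X : End ℝ E) : oneParam X 0 = 1 := by
  ext1
  rw [oneParam_val, zero_smul, NormedSpace.exp_zero]
  rfl

theorem hasDerivAt_oneParam (X : End ℝ E) (t : ℝ) :
    HasDerivAt (fun t ↦ (oneParam X t).val)
      (LinearMap.toContinuousLinearMap X * (oneParam X t).val) t :=
  have : CompleteSpace E := FiniteDimensional.complete ℝ E
  hasDerivAt_exp_smul_const' (LinearMap.toContinuousLinearMap X) t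

theorem hasDerivAt_oneParam_apply (X : End ℝ E) (t : ℝ) (v : E) :
    HasDerivAt (fun t ↦ (oneParam X t).val v) (X ((oneParam X t).val v)) t := by
  have h := (hasDerivAt_oneParam X t).clm_apply (hasDerivAt_const t v)
  simpa using h

theorem hasDerivAt_oneParam_neg (X : End ℝ E) (t : ℝ) :
    HasDerivAt (fun t ↦ (oneParam X (-t)).val)
      (-((oneParam X (-t)).val * LinearMap.toContinuousLinearMap X)) t := by
  have : CompleteSpace E := FiniteDimensional.complete ℝ E
  have h := (hasDerivAt_exp_smul_const (𝕂 := ℝ) (LinearMap.toContinuousLinearMap X)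
    (-t)).scomp t (hasDerivAt_neg t)
  rw [neg_one_smul] at h
  exact h

theorem continuous_oneParam (X : End ℝ E) : Continuous (oneParam X) := by
  have h : Continuous fun t ↦ (oneParam X t).val :=
    continuous_iff_continuousAt.2 fun t ↦ (hasDerivAt_oneParam X t).continuousAt
  refine Units.continuous_iff.2 ⟨h, ?_⟩
  simp only [oneParam_inv]
  exact h.comp continuous_neg

theorem eq_of_hasDerivAt_zero {f : ℝ → ℝ} (hf : ∀ t, HasDerivAt f 0 t) (s t : ℝ) : f s = f t :=
  is_const_of_deriv_eq_zero (fun t ↦ (hf t).differentiableAt) (fun t ↦ (hf t).deriv) s t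

theorem bilin_oneParam {η : LinearMap.BilinForm ℝ E} {X : End ℝ E}
    (hX : ∀ v v', η (X v) v' + η v (X v') = 0) (t : ℝ) (v v' : E) :
    η ((oneParam X t).val v) ((oneParam X t).val v') = η v v' := by
  have h := eq_of_hasDerivAt_zero (f := fun t ↦ η ((oneParam X t).val v) ((oneParam X t).val v'))
    (fun t ↦ by
      have h := HasDerivAt.bilin_apply η (hasDerivAt_oneParam_apply X t v)
        (hasDerivAt_oneParam_apply X t v')
      rwa [hX] at h) t 0
  simp only [oneParam_zero] at h
  exact h

theorem bilin_dual_oneParam {h : LinearMap.BilinForm ℝ (Dual ℝ E)} {X : End ℝ E}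
    (hX : ∀ α β : Dual ℝ E, h (α ∘ₗ X) β + h α (β ∘ₗ X) = 0) (t : ℝ) (α β : Dual ℝ E) :
    h (α ∘ₗ (oneParam X t).val.toLinearMap) (β ∘ₗ (oneParam X t).val.toLinearMap) = h α β := by
  let c : Dual ℝ E → (E →L[ℝ] E) →ₗ[ℝ] Dual ℝ E := fun α ↦
    { toFun := fun Y ↦ α ∘ₗ Y.toLinearMap
      map_add' := fun Y Z ↦ by ext1 v; simp
      map_smul' := fun r Y ↦ by ext1 v; simp }
  -- With Y = exp(-tX), the derivative of Y is written -(Y X), with X on the right. Then α ∘ (Y X) =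
  -- (α ∘ Y) ∘ X, and the infinitesimal invariance applies to α ∘ Y and β ∘ Y.
  have h := eq_of_hasDerivAt_zero
    (f := fun t ↦ h.compl₁₂ (c α) (c β) ((oneParam X (-t)).val) ((oneParam X (-t)).val))
    (fun t ↦ by
      have h1 := HasDerivAt.bilin_apply (h.compl₁₂ (c α) (c β)) (hasDerivAt_oneParam_neg X t)
        (hasDerivAt_oneParam_neg X t)
      have h2 := hX (α ∘ₗ (oneParam X (-t)).val.toLinearMap)
        (β ∘ₗ (oneParam X (-t)).val.toLinearMap)
      have h3 : h.compl₁₂ (c α) (c β)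
          (-((oneParam X (-t)).val * LinearMap.toContinuousLinearMap X)) ((oneParam X (-t)).val)
          + h.compl₁₂ (c α) (c β) ((oneParam X (-t)).val)
          (-((oneParam X (-t)).val * LinearMap.toContinuousLinearMap X)) = 0 := by
        rw [map_neg, map_neg, LinearMap.neg_apply, ← neg_add, neg_eq_zero]
        exact h2
      rwa [h3] at h1) (-t) 0
  simp only [neg_neg, neg_zero, oneParam_zero] at h
  exact h

end OneParam

namespace GalileanModel

variable {p D : ℕ} {S : GalileanModel p D}

theorem oneParam_mem_fullGroup {X : End ℝ (RVec D)} (hX : X ∈ S.lieAlg) (t : ℝ) :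
    oneParam X t ∈ S.fullGroup := by
  refine ⟨bilin_oneParam hX.1 t, fun α β ↦ ?_⟩
  rw [oneParam_inv]
  exact bilin_dual_oneParam hX.2 (-t) α β

/-- The curve is a connected set through the identity, hence remains in the identity component. -/
theorem oneParam_mem_G {X : End ℝ (RVec D)} (hX : X ∈ S.lieAlg) (t : ℝ) : oneParam X t ∈ S.G := by
  let f : ℝ → S.fullGroup := fun t ↦ ⟨oneParam X t, oneParam_mem_fullGroup hX t⟩
  have hf : Continuous f := (continuous_oneParam X).subtype_mk _
  have h1 : (1 : S.fullGroup) ∈ Set.range f := ⟨0, Subtype.ext (oneParam_zero X)⟩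
  exact ⟨f t, (isPreconnected_range hf).subset_connectedComponent h1 ⟨t, rfl⟩, rfl⟩

variable {ι κ : Type*} [DecidableEq ι] [DecidableEq κ] [Fintype ι] [Fintype κ]
  (b : S.AdaptedBasis ι κ)

/-- This is the derivative at 0 of the coordinates of exp(-tX) · T. The sign is chosen so that, `η`
being invariant, exp(tX) acts on all three arguments of η(T(x, y), z), and X enters with plus signs.
-/
theorem coord_derivative_mem {N : Submodule ℝ (Tors D)} (hN : ∀ g ∈ S.G, ∀ T ∈ N, torsAct g T ∈ N)
    {X : End ℝ (RVec D)} (hX : X ∈ S.lieAlg) {T : Tors D} (hT : T ∈ N) :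
    ((fun i j a ↦ S.η (torsBilin T (X (b.e i)) (b.e j)) (b.u a)
        + S.η (torsBilin T (b.e i) (X (b.e j))) (b.u a)
        + S.η (torsBilin T (b.e i) (b.e j)) (X (b.u a)),
      fun i a c ↦ (S.η (torsBilin T (X (b.e i)) (b.u a)) (b.u c)
        + S.η (torsBilin T (b.e i) (X (b.u a))) (b.u c)
        + S.η (torsBilin T (b.e i) (b.u a)) (X (b.u c)))
        + (S.η (torsBilin T (X (b.e i)) (b.u c)) (b.u a)
        + S.η (torsBilin T (b.e i) (X (b.u c))) (b.u a)
        + S.η (torsBilin T (b.e i) (b.u c)) (X (b.u a)))) :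
      (ι → ι → κ → ℝ) × (ι → κ → κ → ℝ)) ∈ N.map b.coord := by
  have hη : ∀ t v w, S.η ((oneParam X (-t)).val v) w = S.η v ((oneParam X t).val w) := by
    intro t v w
    have h := (oneParam_mem_fullGroup hX (-t)).1 v ((oneParam X t).val w)
    rwa [← oneParam_inv, inv_val_apply, oneParam_inv] at h
  have key : ∀ x y z, HasDerivAt
      (fun t ↦ S.η (torsBilin (torsAct (oneParam X (-t)) T) x y) z)
      (S.η (torsBilin T (X x) y) z + S.η (torsBilin T x (X y)) z
        + S.η (torsBilin T x y) (X z)) 0 := by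
    intro x y z
    have h0 : ∀ v, HasDerivAt (fun t ↦ (oneParam X t).val v) (X v) 0 := by
      intro v
      have h := hasDerivAt_oneParam_apply X 0 v
      rwa [oneParam_zero] at h
    have h := HasDerivAt.bilin_apply S.η
      (HasDerivAt.bilin_apply (torsBilin T) (h0 x) (h0 y)) (h0 z)
    simp only [oneParam_zero, map_add, LinearMap.add_apply] at h
    refine h.congr_of_eventuallyEq (Filter.Eventually.of_forall fun t ↦ ?_)
    dsimp only
    rw [torsBilin_torsAct, hη, oneParam_inv, neg_neg]
  refine HasDerivAt.mem_of_forall_mem (f := fun t ↦ b.coord (torsAct (oneParam X (-t)) T)) (t := 0)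
    ?_ fun t ↦ ⟨_, hN _ (oneParam_mem_G hX _) T hT, rfl⟩
  refine HasDerivAt.prodMk ?_ ?_
  · refine hasDerivAt_pi.2 fun i ↦ hasDerivAt_pi.2 fun j ↦ hasDerivAt_pi.2 fun a ↦ ?_
    exact key _ _ _
  · refine hasDerivAt_pi.2 fun i ↦ hasDerivAt_pi.2 fun j ↦ hasDerivAt_pi.2 fun a ↦ ?_
    exact (key _ _ _).add (key _ _ _)

end GalileanModel

namespace GalileanModel

variable {p D : ℕ} {S : GalileanModel p D} {ι κ : Type*} [DecidableEq ι] [DecidableEq κ]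
  [Fintype ι] [Fintype κ] (b : S.AdaptedBasis ι κ)

/-! ### Submodules invariant under the group -/

omit [Fintype ι] in
theorem map_rotFamily {X Y : Type*} [AddCommGroup X] [Module ℝ X] [AddCommGroup Y] [Module ℝ Y]
    (f : X →ₗ[ℝ] Y) (ε : ι → ℝ) (k l : ι) (v : ι → X) (i : ι) :
    f (rotFamily ε k l v i) = rotFamily ε k l (fun i ↦ f (v i)) i := by
  simp only [rotFamily]
  split_ifs <;> simp

theorem γ_smul_left (r : ℝ) {w w' : RVec D} (hw : w ∈ S.W) (hw' : w' ∈ S.W) :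
    S.γ (r • w) w' = r * S.γ w w' := by
  have := AdaptedBasis.γ_sum_left (S := S) {0} (fun _ ↦ r) (fun _ : Fin 1 ↦ w) (fun _ _ ↦ hw) hw'
  simpa using this

namespace AdaptedBasis

/-- The infinitesimal rotation in the plane of two basis vectors of `W`. -/
def rotW (k l : ι) : End ℝ (RVec D) :=
  b.b.constr ℝ (Sum.elim (rotFamily b.ε k l b.e) fun _ ↦ 0)

/-- The infinitesimal rotation in the plane of two basis vectors of the complement of `W`. -/
def rotU (k l : κ) : End ℝ (RVec D) :=
  b.b.constr ℝ (Sum.elim (fun _ ↦ 0) (rotFamily b.δ k l b.u))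

/-- The infinitesimal boost. -/
def boost (k : ι) (d : κ) : End ℝ (RVec D) :=
  b.b.constr ℝ (Sum.elim (fun _ ↦ 0) fun a ↦ if a = d then b.e k else 0)

omit [Fintype κ] [Fintype ι] in
theorem rotW_e (k l i : ι) : b.rotW k l (b.e i) = rotFamily b.ε k l b.e i := by
  rw [rotW, Basis.constr_basis]; rfl

omit [Fintype κ] [Fintype ι] in
theorem rotW_u (k l : ι) (a : κ) : b.rotW k l (b.u a) = 0 := by
  rw [rotW, Basis.constr_basis]; rfl

omit [Fintype κ] [Fintype ι] in
theorem rotU_e (k l : κ) (i : ι) : b.rotU k l (b.e i) = 0 := by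
  rw [rotU, Basis.constr_basis]; rfl

omit [Fintype κ] [Fintype ι] in
theorem rotU_u (k l a : κ) : b.rotU k l (b.u a) = rotFamily b.δ k l b.u a := by
  rw [rotU, Basis.constr_basis]; rfl

omit [Fintype κ] [Fintype ι] in
theorem boost_e (k : ι) (d : κ) (i : ι) : b.boost k d (b.e i) = 0 := by
  rw [boost, Basis.constr_basis]; rfl

omit [Fintype κ] [Fintype ι] in
theorem boost_u (k : ι) (d a : κ) : b.boost k d (b.u a) = if a = d then b.e k else 0 := by
  rw [boost, Basis.constr_basis]; rfl

theorem γ_zero_left {w : RVec D} (hw : w ∈ S.W) : S.γ 0 w = 0 := by simpa using S.γ_sharp 0 hw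

theorem rotW_mem {k l : ι} (hkl : k ≠ l) : b.rotW k l ∈ S.lieAlg := by
  have hW : ∀ i, b.rotW k l (b.e i) ∈ S.W := by
    intro i
    rw [rotW_e, rotFamily]
    refine S.W.sub_mem ?_ ?_ <;> split_ifs <;>
      first | exact S.W.zero_mem | exact S.W.smul_mem _ (b.mem_W _)
  have h : ∀ i j, S.γ (b.rotW k l (b.e i)) (b.e j) =
      (if i = l ∧ j = k then b.ε k * b.ε l else 0) - (if i = k ∧ j = l then b.ε k * b.ε l else 0) := by
    intro i j
    rw [rotW_e, rotFamily]
    by_cases h1 : i = l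
    · have h2 : i ≠ k := fun h ↦ hkl (h.symm.trans h1)
      rw [if_pos h1, if_neg h2, sub_zero, γ_smul_left _ (b.mem_W k) (b.mem_W j), b.γ_apply]
      grind
    · by_cases h2 : i = k
      · rw [if_neg h1, if_pos h2, zero_sub, ← neg_smul, γ_smul_left _ (b.mem_W l) (b.mem_W j),
          b.γ_apply]
        grind
      · rw [if_neg h1, if_neg h2, sub_zero, γ_zero_left (b.mem_W j)]
        grind
  refine b.mem_lieAlg hW ?_ ?_
  · intro a c
    rw [rotW_u, rotW_u]
    simp
  · intro i j
    rw [S.γ_symm (b.mem_W i) (hW j), h, h]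
    grind

theorem rotU_mem {k l : κ} (hkl : k ≠ l) : b.rotU k l ∈ S.lieAlg := by
  have h : ∀ i j, S.η (b.rotU k l (b.u i)) (b.u j) =
      (if i = l ∧ j = k then b.δ k * b.δ l else 0) - (if i = k ∧ j = l then b.δ k * b.δ l else 0) := by
    intro i j
    rw [rotU_u, map_rotFamily S.η]
    have := map_rotFamily (LinearMap.applyₗ (R := ℝ) (M₂ := ℝ) (b.u j)) b.δ k l (fun i ↦ S.η (b.u i)) i
    rw [LinearMap.applyₗ_apply_apply] at this
    rw [this]
    simp only [rotFamily, LinearMap.applyₗ_apply_apply, b.η_apply, smul_eq_mul]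
    grind
  refine b.mem_lieAlg ?_ ?_ ?_
  · intro i
    rw [rotU_e]
    exact S.W.zero_mem
  · intro a c
    rw [S.η_symm (b.u a), h, h]
    grind
  · intro i j
    rw [rotU_e, rotU_e, S.γ_symm (b.mem_W i) S.W.zero_mem, γ_zero_left (b.mem_W _),
      γ_zero_left (b.mem_W _), add_zero]

omit [Fintype κ] [Fintype ι] in
theorem boost_u_mem (k : ι) (d a : κ) : b.boost k d (b.u a) ∈ S.W := by
  rw [boost_u]
  split_ifs
  exacts [b.mem_W k, S.W.zero_mem]

theorem boost_mem (k : ι) (d : κ) : b.boost k d ∈ S.lieAlg := by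
  have hW : ∀ a, b.boost k d (b.u a) ∈ S.W := by
    intro a
    rw [boost_u]
    split_ifs
    exacts [b.mem_W k, S.W.zero_mem]
  refine b.mem_lieAlg ?_ ?_ ?_
  · intro i
    rw [boost_e]
    exact S.W.zero_mem
  · intro a c
    rw [S.η_left (hW a), S.η_right (hW c), add_zero]
  · intro i j
    rw [boost_e, boost_e, S.γ_symm (b.mem_W i) S.W.zero_mem, γ_zero_left (b.mem_W _),
      γ_zero_left (b.mem_W _), add_zero]

/-- The coordinates of the elements of an invariant subspace of the space of torsions. -/
theorem map_coord_cases (hι : 3 ≤ Fintype.card ι) (hκ : 3 ≤ Fintype.card κ)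
    (hι4 : Fintype.card ι = 4 → ∏ i, b.ε i < 0) {N : Submodule ℝ (Tors D)}
    (hN : ∀ g ∈ S.G, ∀ T ∈ N, torsAct g T ∈ N) :
    (∀ x, x ∈ N.map b.coord ↔ x.1 = 0 ∧ x.2 = 0) ∨
    (∀ x, x ∈ N.map b.coord ↔ x.1 = 0 ∧
      ∀ i, ∃ c : ℝ, x.2 i = fun a d ↦ if a = d then c * b.δ a else 0) ∨
    (∀ x, x ∈ N.map b.coord ↔ x.1 = 0 ∧ ∀ i, (∀ a d, x.2 i a d = x.2 i d a) ∧
      ∑ a, (b.δ a)⁻¹ * x.2 i a a = 0) ∨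
    (∀ x, x ∈ N.map b.coord ↔ x.1 = 0 ∧ ∀ i a d, x.2 i a d = x.2 i d a) ∨
    (∀ x, x ∈ N.map b.coord ↔ (∀ i j a, x.1 i j a = - x.1 j i a) ∧
      ∀ i a d, x.2 i a d = x.2 i d a) := by
  -- The last three conditions are the derivatives along `rotW`, `rotU` and `boost`. For a boost
  -- only the argument T(e_i, X u_a) contributes, since boosts kill W and their values lie in ker η.
  refine coord_submodule_cases b.ε_ne b.δ_ne hι hκ hι4 ?_ ?_ ?_ ?_ ?_
  · rintro _ ⟨T, -, rfl⟩ i j a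
    exact b.coord_fst_swap T i j a
  · rintro _ ⟨T, -, rfl⟩ i a d
    exact b.coord_snd_swap T i a d
  · rintro k l hkl _ ⟨T, hT, rfl⟩
    convert coord_derivative_mem b hN (b.rotW_mem hkl) hT using 2
    · funext i j a
      have h1 := map_rotFamily ((LinearMap.flip S.η (b.u a)).comp ((torsBilin T).flip (b.e j))) b.ε k l b.e i
      have h2 := map_rotFamily ((LinearMap.flip S.η (b.u a)).comp (torsBilin T (b.e i))) b.ε k l b.e j
      simp only [LinearMap.comp_apply, LinearMap.flip_apply] at h1 h2
      rw [rotW_e, rotW_e, rotW_u, h1, h2, map_zero, add_zero]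
      simp only [rotMatrix, rotFamily, smul_eq_mul]
      exact add_sub_assoc _ _ _
    · funext i a d
      have h1 := map_rotFamily ((LinearMap.flip S.η (b.u d)).comp ((torsBilin T).flip (b.u a))) b.ε k l b.e i
      have h2 := map_rotFamily ((LinearMap.flip S.η (b.u a)).comp ((torsBilin T).flip (b.u d))) b.ε k l b.e i
      simp only [LinearMap.comp_apply, LinearMap.flip_apply] at h1 h2
      rw [rotW_e, rotW_u, rotW_u, h1, h2]
      simp only [rotFamily, coord, LinearMap.coe_mk, AddHom.coe_mk, map_zero, add_zero,
        LinearMap.zero_apply]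
      split_ifs <;> simp <;> ring
  · rintro k l hkl _ ⟨T, hT, rfl⟩
    convert coord_derivative_mem b hN (b.rotU_mem hkl) hT using 2
    · funext i j a
      have h1 := map_rotFamily (S.η (torsBilin T (b.e i) (b.e j))) b.δ k l b.u a
      rw [rotU_e, rotU_e, rotU_u, h1]
      simp only [rotFamily, coord, LinearMap.coe_mk, AddHom.coe_mk, map_zero, add_zero, zero_add,
        LinearMap.zero_apply]
    · funext i a d
      have h1 : ∀ a d, S.η (torsBilin T (b.e i) (rotFamily b.δ k l b.u a)) (b.u d) = _ := fun a d ↦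
        map_rotFamily ((LinearMap.flip S.η (b.u d)).comp (torsBilin T (b.e i))) b.δ k l b.u a
      have h2 : ∀ a d, S.η (torsBilin T (b.e i) (b.u a)) (rotFamily b.δ k l b.u d) = _ := fun a d ↦
        map_rotFamily (S.η (torsBilin T (b.e i) (b.u a))) b.δ k l b.u d
      simp only [rotU_e, rotU_u, h1, h2, map_zero, LinearMap.zero_apply, zero_add]
      simp only [LinearMap.comp_apply, LinearMap.flip_apply, rotMatrix, rotFamily, coord,
        LinearMap.coe_mk, AddHom.coe_mk, smul_eq_mul]
      split_ifs <;> ring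
  · rintro k d _ ⟨T, hT, rfl⟩
    convert coord_derivative_mem b hN (b.boost_mem k d) hT using 2
    · funext i j a
      rw [boost_e, boost_e, S.η_right (b.boost_u_mem k d a)]
      simp
    · funext i a c
      rw [boost_e, S.η_right (b.boost_u_mem k d a), S.η_right (b.boost_u_mem k d c), boost_u,
        boost_u]
      simp only [coord, LinearMap.coe_mk, AddHom.coe_mk]
      split_ifs <;> simp

end AdaptedBasis

end GalileanModel

namespace GalileanModel

variable {p D : ℕ} {S : GalileanModel p D}

/-! ### The submodules of the cokernel -/

theorem mkQ_mem_map_iff {K : Submodule ℝ (Tors D)} (hK : LinearMap.range S.spencer ≤ K)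
    {T : Tors D} :
    (LinearMap.range S.spencer).mkQ T ∈ K.map (LinearMap.range S.spencer).mkQ ↔ T ∈ K := by
  rw [← Submodule.mem_comap, Submodule.comap_map_mkQ, sup_eq_right.2 hK]

section

variable {ι κ : Type*} [DecidableEq ι] [DecidableEq κ] [Fintype ι] [Fintype κ]
  (b : S.AdaptedBasis ι κ)

namespace AdaptedBasis

omit [Fintype ι] [Fintype κ] in
theorem mem_ker_coord {T : Tors D} : T ∈ LinearMap.ker b.coord ↔
    (b.coord T).1 = 0 ∧ (b.coord T).2 = 0 := by
  rw [LinearMap.mem_ker, Prod.ext_iff]; rfl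

theorem range_spencer_le_torsInv : LinearMap.range S.spencer ≤ S.torsInv := by
  obtain ⟨b⟩ := S.exists_adaptedBasis
  rw [b.range_spencer]
  intro T hT
  exact b.mem_torsInv_iff.2 (congrArg Prod.fst hT)

theorem range_spencer_le_torsTr : LinearMap.range S.spencer ≤ S.torsTr := by
  obtain ⟨b⟩ := S.exists_adaptedBasis
  rw [b.range_spencer]
  intro T hT
  refine b.mem_torsTr_iff.2 ⟨congrArg Prod.fst hT, fun i ↦ ⟨0, ?_⟩⟩
  rw [show (b.coord T).2 = 0 from congrArg Prod.snd hT]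
  funext a c
  simp

theorem range_spencer_le_torsZero : LinearMap.range S.spencer ≤ S.torsZero := by
  obtain ⟨b⟩ := S.exists_adaptedBasis
  rw [b.range_spencer]
  intro T hT
  refine b.mem_torsZero_iff.2 ⟨congrArg Prod.fst hT, fun i ↦ ⟨b.coord_snd_swap T i, ?_⟩⟩
  rw [show (b.coord T).2 = 0 from congrArg Prod.snd hT]
  simp

/-- The product of the diagonal entries has the sign of the Gram determinants. -/
theorem prod_ε_neg_of_det_neg {n : Type*} [Fintype n] [DecidableEq n] (c : Basis n ℝ S.W)
    (hc : (Matrix.of fun i j ↦ S.γ (c i) (c j)).det < 0) : ∏ i, b.ε i < 0 := by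
  have hli : LinearIndependent ℝ fun i ↦ (⟨b.e i, b.mem_W i⟩ : S.W) :=
    LinearIndependent.of_comp S.W.subtype (b.b.linearIndependent.comp _ Sum.inl_injective)
  let e : Basis ι ℝ S.W := Basis.mk hli (by
    rintro ⟨w, hw⟩ -
    have h : (⟨w, hw⟩ : S.W) = ∑ i, b.b.repr w (.inl i) • (⟨b.e i, b.mem_W i⟩ : S.W) := by
      ext1
      simpa using! b.eq_sum_of_mem hw
    rw [h]
    exact Submodule.sum_mem _ fun i _ ↦ Submodule.smul_mem _ _ (Submodule.subset_span ⟨i, rfl⟩))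
  let f : Basis n ℝ S.W := e.reindex (e.indexEquiv c)
  have hf : LinearMap.BilinForm.toMatrix f S.γForm = Matrix.diagonal fun i ↦ b.ε ((e.indexEquiv c).symm i) := by
    ext i j
    simp only [LinearMap.BilinForm.toMatrix_apply, f, e, Basis.reindex_apply, Basis.mk_apply, γForm_apply,
      b.γ_apply, Matrix.diagonal_apply, EmbeddingLike.apply_eq_iff_eq]
  have hc' : LinearMap.BilinForm.toMatrix c S.γForm = Matrix.of fun i j ↦ S.γ (c i) (c j) := by
    ext i j
    simp [LinearMap.BilinForm.toMatrix_apply, γForm_apply]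
  -- Gram determinants of two bases differ by the square of the transition determinant, so the sign
  -- does not depend on the basis.
  have h := LinearMap.BilinForm.toMatrix_mul_basis_toMatrix f c S.γForm
  rw [hf, hc'] at h
  rw [← h, Matrix.det_mul, Matrix.det_mul, Matrix.det_transpose, Matrix.det_diagonal,
    Equiv.prod_comp (e.indexEquiv c).symm b.ε] at hc
  by_contra! h0
  nlinarith [mul_nonneg h0 (mul_self_nonneg (f.toMatrix ⇑c).det)]

-- If s_i = c δ on the diagonal, its trace is c times the number of indices of V/W; tracelessness
-- forces c = 0.
include b in
theorem torsTr_inf_torsZero_le [Nonempty κ] : S.torsTr ⊓ S.torsZero ≤ LinearMap.range S.spencer := by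
  rw [b.range_spencer]
  rintro T ⟨h1, h2⟩
  obtain ⟨h, h1⟩ := b.mem_torsTr_iff.1 h1
  obtain ⟨-, h2⟩ := b.mem_torsZero_iff.1 h2
  refine Prod.ext h (funext fun i ↦ ?_)
  obtain ⟨c, hc⟩ := h1 i
  have h3 := (h2 i).2
  rw [hc] at h3
  have h4 : ∀ a, (b.δ a)⁻¹ * (if a = a then c * b.δ a else 0) = c := by
    intro a
    have := b.δ_ne a
    rw [if_pos rfl]
    field_simp
  rw [Finset.sum_congr rfl fun a _ ↦ h4 a] at h3
  simp only [Finset.sum_const, Finset.card_univ, nsmul_eq_mul, mul_eq_zero, Nat.cast_eq_zero,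
    Fintype.card_ne_zero, false_or] at h3
  rw [hc, h3]
  funext a d
  simp

include b in
theorem torsInv_le [Nonempty κ] : S.torsInv ≤ S.torsTr ⊔ S.torsZero := by
  intro T hT
  have h := b.mem_torsInv_iff.1 hT
  -- The average of the trace: the multiple of the quadratic form to be split off from s_i.
  let t : ι → ℝ := fun i ↦ (∑ a, (b.δ a)⁻¹ * (b.coord T).2 i a a) / Fintype.card κ
  obtain ⟨T', hT'⟩ := b.exists_coord_eq (c := 0)
    (s := fun i a d ↦ if a = d then t i * b.δ a else 0)
    (by simp) (by intro i a d; grind)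
  rw [← sub_add_cancel T T', add_comm]
  refine Submodule.add_mem_sup ?_ ?_
  · refine b.mem_torsTr_iff.2 ⟨by rw [hT'], fun i ↦ ⟨t i, by rw [hT']⟩⟩
  · refine b.mem_torsZero_iff.2 ⟨by rw [map_sub, hT', Prod.fst_sub, h]; simp,
      fun i ↦ ⟨b.coord_snd_swap _ i, ?_⟩⟩
    have h4 : ∀ a, (b.δ a)⁻¹ * (b.coord (T - T')).2 i a a =
        (b.δ a)⁻¹ * (b.coord T).2 i a a - t i := by
      intro a
      have := b.δ_ne a
      rw [map_sub, hT']
      simp only [Prod.snd_sub, Pi.sub_apply, if_pos]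
      field_simp
    have : (Fintype.card κ : ℝ) ≠ 0 := by simp
    simp only [h4, Finset.sum_sub_distrib, Finset.sum_const, Finset.card_univ, nsmul_eq_mul]
    simp only [t]
    field_simp
    simp

/-- The classification of the invariant submodules. -/
theorem submodule_cases (hι : 3 ≤ Fintype.card ι) (hκ : 3 ≤ Fintype.card κ)
    (hι4 : Fintype.card ι = 4 → ∏ i, b.ε i < 0) {N : Submodule ℝ S.Coker}
    (hN : S.IsGSubmodule N) :
    N ∈ [⊥, S.torsTr.map (LinearMap.range S.spencer).mkQ,
      S.torsZero.map (LinearMap.range S.spencer).mkQ,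
      S.torsInv.map (LinearMap.range S.spencer).mkQ, ⊤] := by
  set q := (LinearMap.range S.spencer).mkQ with hq
  have hN' : ∀ g ∈ S.G, ∀ T ∈ N.comap q, torsAct g T ∈ N.comap q := fun g hg T hT ↦
    hN ⟨g, hg⟩ _ hT
  -- The projection `q` and the coordinates have the same kernel, so membership in `N` can be read
  -- off from the coordinates.
  have hmem : ∀ T, q T ∈ N ↔ b.coord T ∈ (N.comap q).map b.coord := by
    intro T
    refine ⟨fun h ↦ ⟨T, h, rfl⟩, ?_⟩
    rintro ⟨T', hT', h⟩
    have : q T = q T' := by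
      rw [← sub_eq_zero, ← map_sub, ← LinearMap.mem_ker, Submodule.ker_mkQ, b.range_spencer,
        LinearMap.mem_ker, map_sub, h, sub_self]
    rw [this]
    exact hT'
  have hext : ∀ K : Submodule ℝ (Tors D), LinearMap.range S.spencer ≤ K →
      (∀ T, T ∈ K ↔ b.coord T ∈ (N.comap q).map b.coord) → N = K.map q := by
    intro K hK h
    ext t
    obtain ⟨T, rfl⟩ := Submodule.mkQ_surjective _ t
    rw [hmem, ← h, mkQ_mem_map_iff hK]
  simp only [List.mem_cons, List.not_mem_nil, or_false]
  rcases b.map_coord_cases hι hκ hι4 hN' with h | h | h | h | h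
  · left
    rw [hext _ le_rfl fun T ↦ ?_, hq, Submodule.mkQ_map_self]
    rw [h, b.range_spencer, mem_ker_coord]
  · right; left
    exact hext _ range_spencer_le_torsTr fun T ↦ by rw [h, b.mem_torsTr_iff]
  · right; right; left
    exact hext _ range_spencer_le_torsZero fun T ↦ by rw [h, b.mem_torsZero_iff]
  · right; right; right; left
    refine hext _ range_spencer_le_torsInv fun T ↦ ?_
    rw [h, b.mem_torsInv_iff]
    exact ⟨fun h ↦ ⟨h, fun i ↦ b.coord_snd_swap T i⟩, And.left⟩
  · right; right; right; right
    rw [hext ⊤ le_top fun T ↦ ?_, Submodule.map_top, hq, Submodule.range_mkQ]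
    rw [h]
    exact ⟨fun _ ↦ ⟨b.coord_fst_swap T, b.coord_snd_swap T⟩, fun _ ↦ trivial⟩

include b in
/-- The five submodules are distinct. -/
theorem nodup_submodules [Nontrivial ι] [Nontrivial κ] :
    [⊥, S.torsTr.map (LinearMap.range S.spencer).mkQ,
      S.torsZero.map (LinearMap.range S.spencer).mkQ,
      S.torsInv.map (LinearMap.range S.spencer).mkQ, ⊤].Nodup := by
  obtain ⟨i, j, hij⟩ := exists_pair_ne ι
  obtain ⟨a, d, had⟩ := exists_pair_ne κ
  -- Three witnesses separate the five submodules: `T₁` is pure trace, `T₂` is off-diagonal and so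
  -- traceless, and `T₃` has a non-zero first coordinate.
  obtain ⟨T₁, hT₁⟩ := b.exists_coord_eq (c := 0)
    (s := fun _ a d ↦ if a = d then b.δ a else 0)
    (by simp) (by intro i a d; grind)
  obtain ⟨T₂, hT₂⟩ := b.exists_coord_eq (c := 0) (s := fun _ ↦ symUnit a d)
    (by simp) (by intro i a d; simp only [symUnit]; grind)
  obtain ⟨T₃, hT₃⟩ := b.exists_coord_eq (c := fun i' j' _ ↦ antiUnit i j i' j') (s := 0)
    (by intro i j a; simp only [antiUnit]; grind) (by simp)
  have h1 : T₁ ∈ S.torsTr := b.mem_torsTr_iff.2 ⟨by rw [hT₁], fun i ↦ ⟨1, by rw [hT₁]; simp⟩⟩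
  have h1' : T₁ ∉ S.torsZero := by
    intro h
    have := ((b.mem_torsZero_iff.1 h).2 i).2
    rw [hT₁] at this
    simp [b.δ_ne] at this
  have h2 : T₂ ∈ S.torsZero := by
    refine b.mem_torsZero_iff.2 ⟨by rw [hT₂], fun i ↦ ⟨b.coord_snd_swap _ i, ?_⟩⟩
    rw [hT₂]
    refine Finset.sum_eq_zero fun c _ ↦ ?_
    have : symUnit a d c c = 0 := by simp only [symUnit]; grind
    simp only [this, mul_zero]
  have h2' : T₂ ∉ S.torsTr := by
    intro h
    obtain ⟨c, hc⟩ := (b.mem_torsTr_iff.1 h).2 i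
    rw [hT₂] at hc
    have := congrFun (congrFun hc a) d
    simp [symUnit, had] at this
  have h3 : T₃ ∉ S.torsInv := by
    intro h
    have := congrFun (congrFun (congrFun (b.mem_torsInv_iff.1 h) i) j) a
    rw [hT₃] at this
    simp [antiUnit] at this
    grind
  have h1i : T₁ ∈ S.torsInv := b.mem_torsInv_iff.2 (b.mem_torsTr_iff.1 h1).1
  have h2i : T₂ ∈ S.torsInv := h2.1
  have e1 : ∀ {T}, _ := fun {T} ↦ mkQ_mem_map_iff (S := S) (K := S.torsTr) (T := T)
    range_spencer_le_torsTr
  have e2 : ∀ {T}, _ := fun {T} ↦ mkQ_mem_map_iff (S := S) (K := S.torsZero) (T := T)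
    range_spencer_le_torsZero
  have e3 : ∀ {T}, _ := fun {T} ↦ mkQ_mem_map_iff (S := S) (K := S.torsInv) (T := T)
    range_spencer_le_torsInv
  have hb : ∀ T (K : Submodule ℝ (Tors D)), LinearMap.range S.spencer ≤ K → T ∉ K →
      (LinearMap.range S.spencer).mkQ T ∉ (⊥ : Submodule ℝ S.Coker) := by
    intro T K hK hT h
    rw [Submodule.mem_bot, ← LinearMap.mem_ker, Submodule.ker_mkQ] at h
    exact hT (hK h)
  have b1 := hb T₁ _ range_spencer_le_torsZero h1'
  have b2 := hb T₂ _ range_spencer_le_torsTr h2'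
  have b3 := hb T₃ _ range_spencer_le_torsInv h3
  have ne : ∀ {N N' : Submodule ℝ S.Coker} (t), t ∈ N' → t ∉ N → N ≠ N' := by
    rintro N N' t h h' rfl
    exact h' h
  have ht : ∀ t, t ∈ (⊤ : Submodule ℝ S.Coker) := fun _ ↦ trivial
  simp only [List.nodup_cons, List.mem_cons, List.not_mem_nil, or_false, not_or, not_false_eq_true,
    List.nodup_nil, and_true]
  have t3 : T₃ ∉ S.torsTr := fun h ↦ h3 (b.mem_torsInv_iff.2 (b.mem_torsTr_iff.1 h).1)
  have z3 : T₃ ∉ S.torsZero := fun h ↦ h3 h.1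
  exact ⟨⟨ne _ (e1.2 h1) b1, ne _ (e2.2 h2) b2, ne _ (e3.2 h1i) b1, ne _ (ht _) b3⟩,
    ⟨ne _ (e2.2 h2) (mt e1.1 h2'), ne _ (e3.2 h2i) (mt e1.1 h2'), ne _ (ht _) (mt e1.1 t3)⟩,
    ⟨ne _ (e3.2 h1i) (mt e2.1 h1'), ne _ (ht _) (mt e2.1 z3)⟩, ne _ (ht _) (mt e3.1 h3)⟩

end AdaptedBasis

end

open AdaptedBasis

theorem isGSubmodule_map {K : Submodule ℝ (Tors D)}
    (hK : ∀ g ∈ S.fullGroup, ∀ T ∈ K, torsAct g T ∈ K) :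
    S.IsGSubmodule (K.map (LinearMap.range S.spencer).mkQ) := by
  rintro ⟨g, hg⟩ _ ⟨T, hT, rfl⟩
  exact ⟨torsAct g T, hK g (S.G_le_fullGroup hg) T hT, rfl⟩

theorem isGSubmodule_of_mem {N : Submodule ℝ S.Coker}
    (hN : N ∈ [⊥, S.torsTr.map (LinearMap.range S.spencer).mkQ,
      S.torsZero.map (LinearMap.range S.spencer).mkQ,
      S.torsInv.map (LinearMap.range S.spencer).mkQ, ⊤]) : S.IsGSubmodule N := by
  simp only [List.mem_cons, List.not_mem_nil, or_false] at hN
  rcases hN with rfl | rfl | rfl | rfl | rfl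
  · intro g t ht
    rw [Submodule.mem_bot] at ht ⊢
    rw [ht, map_zero]
  · exact isGSubmodule_map fun g hg T hT ↦ torsAct_mem_torsTr hg hT
  · exact isGSubmodule_map fun g hg T hT ↦ torsAct_mem_torsZero hg hT
  · exact isGSubmodule_map fun g hg T hT ↦ torsAct_mem_torsInv hg hT
  · intro g t _
    trivial

theorem torsTr_inf_torsZero_map : S.torsTr.map (LinearMap.range S.spencer).mkQ ⊓
    S.torsZero.map (LinearMap.range S.spencer).mkQ = ⊥ := by
  obtain ⟨b⟩ := S.exists_adaptedBasis
  rw [eq_bot_iff]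
  rintro t ⟨h1, h2⟩
  obtain ⟨T, rfl⟩ := Submodule.mkQ_surjective _ t
  rw [Submodule.mem_bot, ← LinearMap.mem_ker, Submodule.ker_mkQ]
  exact b.torsTr_inf_torsZero_le ⟨(mkQ_mem_map_iff range_spencer_le_torsTr).1 h1,
    (mkQ_mem_map_iff range_spencer_le_torsZero).1 h2⟩

theorem torsTr_sup_torsZero_map : S.torsTr.map (LinearMap.range S.spencer).mkQ ⊔
    S.torsZero.map (LinearMap.range S.spencer).mkQ =
      S.torsInv.map (LinearMap.range S.spencer).mkQ := by
  obtain ⟨b⟩ := S.exists_adaptedBasis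
  rw [← Submodule.map_sup]
  congr 1
  refine le_antisymm (sup_le (fun T hT ↦ ?_) fun T hT ↦ hT.1) b.torsInv_le
  exact b.mem_torsInv_iff.2 (b.mem_torsTr_iff.1 hT).1

end GalileanModel

/-! ### The characteristic form in coordinates -/

/-- A multilinear map which vanishes as soon as one argument lies in `W` only depends on the
arguments modulo `W`. -/
theorem MultilinearMap.eq_of_forall_sub_mem {ι X Y : Type*} [Fintype ι] [DecidableEq ι]
    [AddCommGroup X] [Module ℝ X] [AddCommGroup Y] [Module ℝ Y] {W : Submodule ℝ X}
    (f : MultilinearMap ℝ (fun _ : ι ↦ X) Y) (hf : ∀ m, (∃ i, m i ∈ W) → f m = 0) {m m' : ι → X}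
    (h : ∀ i, m i - m' i ∈ W) : f m = f m' := by
  have e : m = m' + (m - m') := by abel
  rw [e, f.map_add_univ, Finset.sum_eq_single Finset.univ]
  · simp
  · intro s _ hs
    obtain ⟨i, hi⟩ : ∃ i, i ∉ s := by
      by_contra! h'
      exact hs (Finset.eq_univ_iff_forall.2 h')
    exact hf _ ⟨i, by simpa [Finset.piecewise_eq_of_notMem _ _ _ hi] using h i⟩
  · simp

namespace GalileanModel

variable {p D : ℕ} {S : GalileanModel p D} {ι κ : Type*} [DecidableEq ι] [DecidableEq κ]
  [Fintype ι] [Fintype κ] (b : S.AdaptedBasis ι κ)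

namespace AdaptedBasis

/-- The coordinates of vectors modulo `W`. -/
def coordU (v : RVec D) (a : κ) : ℝ := (b.δ a)⁻¹ * S.η v (b.u a)

theorem sub_sum_coordU_mem (v : RVec D) : v - ∑ a, b.coordU v a • b.u a ∈ S.W := by
  rw [b.mem_W_iff]
  intro c
  have := b.δ_ne c
  simp [b.η_apply, coordU]
  field_simp
  simp

/-- The form descends to V/W, where its degree equals the dimension; top forms are multiples of the
determinant. -/
theorem alternating_eq_det {Ω₀ : RVec D [⋀^κ]→ₗ[ℝ] ℝ}
    (hΩ₀W : ∀ m : κ → RVec D, (∃ i, m i ∈ S.W) → Ω₀ m = 0) (m : κ → RVec D) :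
    Ω₀ m = Ω₀ b.u * Matrix.det (Matrix.of fun i ↦ b.coordU (m i)) := by
  have h := MultilinearMap.eq_of_forall_sub_mem Ω₀.toMultilinearMap hΩ₀W
    (m := m) (m' := fun i ↦ ∑ a, b.coordU (m i) a • b.u a) fun i ↦ b.sub_sum_coordU_mem (m i)
  let L : (κ → ℝ) →ₗ[ℝ] RVec D := Fintype.linearCombination ℝ b.u
  have h2 := congrArg (fun f : (κ → ℝ) [⋀^κ]→ₗ[ℝ] ℝ ↦ f fun i ↦ b.coordU (m i))
    (AlternatingMap.eq_smul_basis_det (Pi.basisFun ℝ κ) (Ω₀.compLinearMap L))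
  have h3 : ∀ a, L (Pi.basisFun ℝ κ a) = b.u a := by
    intro a
    simp [L, Fintype.linearCombination_apply_single]
  have h4 : (Ω₀.compLinearMap L) (Pi.basisFun ℝ κ) = Ω₀ b.u := by
    change Ω₀ (fun a ↦ L (Pi.basisFun ℝ κ a)) = _
    simp only [h3]
  simp only [h4, AlternatingMap.smul_apply, Pi.basisFun_det] at h2
  exact h.trans h2

/-- The Gram matrix of the vectors under `η` is C diag(δ) Cᵀ, with C their coordinates modulo W. So
the square of det C is expressed through `η` and is invariant under all automorphisms of the model.
-/
theorem det_coordU_sq (m : κ → RVec D) :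
    Matrix.det (Matrix.of fun i ↦ b.coordU (m i)) ^ 2 * ∏ a, b.δ a =
      Matrix.det (Matrix.of fun i j ↦ S.η (m i) (m j)) := by
  have h : (Matrix.of fun i ↦ b.coordU (m i)) * Matrix.diagonal b.δ *
      (Matrix.of fun i ↦ b.coordU (m i)).transpose = Matrix.of fun i j ↦ S.η (m i) (m j) := by
    ext i j
    rw [Matrix.mul_apply]
    have h1 : S.η (m i) (m j) = S.η (m i) (∑ a, b.coordU (m j) a • b.u a) := by
      rw [← sub_eq_zero, ← map_sub]
      exact S.η_right (b.sub_sum_coordU_mem (m j)) _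
    simp only [Matrix.of_apply, h1, map_sum, map_smul, Matrix.mul_diagonal,
      Matrix.transpose_apply, smul_eq_mul]
    refine Finset.sum_congr rfl fun a _ ↦ ?_
    have := b.δ_ne a
    rw [coordU]
    field_simp
  rw [← h, Matrix.det_mul, Matrix.det_mul, Matrix.det_diagonal, Matrix.det_transpose]
  ring

end AdaptedBasis

/-- The elements of `G` preserve the characteristic form. -/
theorem alternating_map_of_mem_G {Ω₀ : RVec D [⋀^Fin (p + 1)]→ₗ[ℝ] ℝ}
    (hΩ₀W : ∀ m : Fin (p + 1) → RVec D, (∃ i, m i ∈ S.W) → Ω₀ m = 0) {g : GLVec D} (hg : g ∈ S.G)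
    (m : Fin (p + 1) → RVec D) : Ω₀ (fun i ↦ g.val (m i)) = Ω₀ m := by
  obtain ⟨b⟩ := S.exists_adaptedBasis
  rw [b.alternating_eq_det hΩ₀W, b.alternating_eq_det hΩ₀W m]
  congr 1
  -- The full group preserves the determinant up to sign. A non-zero continuous function whose
  -- square is constant is itself constant on the connected identity component.
  have hsq : ∀ g ∈ S.fullGroup, Matrix.det (Matrix.of fun i ↦ b.coordU (g.val (m i))) ^ 2 =
      Matrix.det (Matrix.of fun i ↦ b.coordU (m i)) ^ 2 := by
    intro g hg
    have h0 : ∏ a, b.δ a ≠ 0 := Finset.prod_ne_zero_iff.2 fun a _ ↦ b.δ_ne a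
    refine mul_right_cancel₀ h0 ?_
    rw [b.det_coordU_sq, b.det_coordU_sq]
    simp only [hg.1]
  by_cases h0 : Matrix.det (Matrix.of fun i ↦ b.coordU (m i)) = 0
  · have := hsq g (S.G_le_fullGroup hg)
    rw [h0] at this ⊢
    simpa using this
  obtain ⟨g, hg, rfl⟩ := hg
  have hcont : Continuous fun g : S.fullGroup ↦
      Matrix.det (Matrix.of fun i ↦ b.coordU (g.1.val (m i))) := by
    refine Continuous.matrix_det (continuous_matrix fun i a ↦ ?_)
    have h1 : Continuous fun g : S.fullGroup ↦ g.1.val (m i) :=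
      (ContinuousLinearMap.apply ℝ (RVec D) (m i)).continuous.comp
        (Units.continuous_val.comp continuous_subtype_val)
    exact continuous_const.mul
      ((LinearMap.continuous_of_finiteDimensional (LinearMap.flip S.η (b.u a))).comp h1)
  exact (isPreconnected_connectedComponent (x := (1 : S.fullGroup))).eq_of_sq_eq
    hcont.continuousOn (continuousOn_const (c := Matrix.det (Matrix.of fun i ↦ b.coordU (m i))))
    (fun g _ ↦ hsq g.1 g.2) (fun _ ↦ h0) mem_connectedComponent (by rfl) hg

end GalileanModel

/-! ### The characteristic tensor fields in frames -/

section Frames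

variable {p D : ℕ} {M : Type*} [TopologicalSpace M] [ChartedSpace (RVec D) M]
  [IsManifold (𝓡 D) 1 M] {S : GalileanModel p D} (P : GStructure S M)

namespace GStructure

variable {x : M} {u : RVec D ≃L[ℝ] TangentSpace (𝓡 D) x}

variable {P} in
theorem exists_symm_frame (hu : u ∈ P.frames x) :
    ∃ g ∈ S.G, ∀ X, (P.frame x).symm X = g.val (u.symm X) := by
  obtain ⟨g, hg, h⟩ := (P.mem_iff x _ u (P.frame_mem x)).1 hu
  refine ⟨g, hg, fun X ↦ ?_⟩
  rw [ContinuousLinearEquiv.symm_apply_eq, ← h, ContinuousLinearEquiv.apply_symm_apply]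

variable {P} in
theorem mem_E_iff (hu : u ∈ P.frames x) {X : TangentSpace (𝓡 D) x} :
    X ∈ P.E x ↔ u.symm X ∈ S.W := by
  obtain ⟨g, hg, h⟩ := exists_symm_frame hu
  rw [← GalileanModel.map_mem_W_iff (S.G_le_fullGroup hg), ← h]
  constructor
  · rintro ⟨w, hw, rfl⟩
    simpa using hw
  · intro hX
    exact ⟨_, hX, (P.frame x).apply_symm_apply X⟩

variable {P} in
theorem η_eq (hu : u ∈ P.frames x) (X Y : TangentSpace (𝓡 D) x) :
    P.η x X Y = S.η (u.symm X) (u.symm Y) := by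
  obtain ⟨g, hg, h⟩ := exists_symm_frame hu
  rw [η, h, h, (S.G_le_fullGroup hg).1]

variable {P} in
theorem γ_eq (hu : u ∈ P.frames x) {X Y : TangentSpace (𝓡 D) x} (hX : X ∈ P.E x)
    (hY : Y ∈ P.E x) : P.γ x X Y = S.γ (u.symm X) (u.symm Y) := by
  obtain ⟨g, hg, h⟩ := exists_symm_frame hu
  rw [γ, h, h, GalileanModel.γ_map (S.G_le_fullGroup hg) ((mem_E_iff hu).1 hX) ((mem_E_iff hu).1 hY)]

variable {P} in
theorem Ω_eq {Ω₀ : RVec D [⋀^Fin (p + 1)]→ₗ[ℝ] ℝ}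
    (hΩ₀W : ∀ m : Fin (p + 1) → RVec D, (∃ i, m i ∈ S.W) → Ω₀ m = 0) (hu : u ∈ P.frames x)
    (X : Fin (p + 1) → TangentSpace (𝓡 D) x) : P.Ω Ω₀ x X = Ω₀ fun i ↦ u.symm (X i) := by
  obtain ⟨g, hg, h⟩ := exists_symm_frame hu
  simp only [Ω, h]
  exact GalileanModel.alternating_map_of_mem_G hΩ₀W hg _

/-- The metric on the transverse bundle is induced by `h`. -/
theorem mem_E_iff_exists_dual (x : M) (Z : TangentSpace (𝓡 D) x) : Z ∈ P.E x ↔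
    ∃ α : Dual ℝ (TangentSpace (𝓡 D) x), (∀ β, P.h x β α = β Z) ∧ ∀ Y ∈ P.E x, P.γ x Z Y = α Y := by
  have hE : ∀ Y, Y ∈ P.E x ↔ (P.frame x).symm Y ∈ S.W := fun Y ↦ mem_E_iff (P.frame_mem x)
  have hh : ∀ α β : Dual ℝ (TangentSpace (𝓡 D) x), P.h x β α =
      β (P.frame x (S.sharp (α ∘ₗ (P.frame x).toLinearEquiv.toLinearMap))) := fun α β ↦
    (S.apply_sharp _ _).symm
  constructor
  · intro hZ
    obtain ⟨a, ha⟩ := S.exists_sharp ((hE Z).1 hZ)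
    have hc : (a ∘ₗ (P.frame x).symm.toLinearEquiv.toLinearMap) ∘ₗ
        (P.frame x).toLinearEquiv.toLinearMap = a := by
      ext1 v
      exact congrArg a ((P.frame x).symm_apply_apply v)
    refine ⟨a ∘ₗ (P.frame x).symm.toLinearEquiv.toLinearMap, fun β ↦ ?_, fun Y hY ↦ ?_⟩
    · rw [hh, hc, ha, ContinuousLinearEquiv.apply_symm_apply]
    · rw [γ, ← ha, S.γ_sharp _ ((hE Y).1 hY)]
      rfl
  · rintro ⟨α, h, -⟩
    have : Z = P.frame x (S.sharp (α ∘ₗ (P.frame x).toLinearEquiv.toLinearMap)) := by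
      rw [← sub_eq_zero, ← forall_dual_apply_eq_zero_iff ℝ]
      intro β
      rw [map_sub, ← h, hh, sub_self]
    rw [hE, this, ContinuousLinearEquiv.symm_apply_apply]
    exact S.sharp_mem _

end GStructure

end Frames

/-! ### Local sections of the bundle of frames -/

section LocalSections

variable {p D : ℕ} {M : Type*} [TopologicalSpace M] [ChartedSpace (RVec D) M]
  [IsManifold (𝓡 D) ∞ M]

namespace IsLocalSection

variable {F : ∀ x : M, Set (RVec D ≃L[ℝ] TangentSpace (𝓡 D) x)} {U : Set M}
  {s : ∀ x : M, RVec D ≃L[ℝ] TangentSpace (𝓡 D) x} (hs : IsLocalSection F U s) {x : M} (hx : x ∈ U)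

include hs hx

theorem contMDiffAt (v : RVec D) : ContMDiffAt (𝓡 D) (𝓡 D).tangent ∞
    (fun y ↦ (⟨y, s y v⟩ : TangentBundle (𝓡 D) M)) x :=
  (hs.smooth v).contMDiffAt (hs.isOpen.mem_nhds hx)

/-- The components of a smooth vector field in a smooth frame are smooth. -/
theorem contMDiffAt_symm {X : ∀ x : M, TangentSpace (𝓡 D) x}
    (hX : ContMDiffAt (𝓡 D) (𝓡 D).tangent ∞ (fun y ↦ (⟨y, X y⟩ : TangentBundle (𝓡 D) M)) x) :
    ContMDiffAt (𝓡 D) 𝓘(ℝ, RVec D) ∞ (fun y ↦ (s y).symm (X y)) x := by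
  let e := trivializationAt (RVec D) (TangentSpace (𝓡 D) : M → Type _) x
  have hxe : x ∈ e.baseSet := FiberBundle.mem_baseSet_trivializationAt' x
  let b := (EuclideanSpace.basisFun (Fin D) ℝ).toBasis
  -- `Φ y` is the matrix of the frame in the local trivialisation. Components in the frame are
  -- obtained with its inverse, and inversion of linear maps is smooth.
  let Φ : M → RVec D →L[ℝ] RVec D := fun y ↦
    ∑ i, (LinearMap.toContinuousLinearMap (b.coord i)).smulRight (e ⟨y, s y (b i)⟩).2
  have hΦ : ContMDiffAt (𝓡 D) 𝓘(ℝ, RVec D →L[ℝ] RVec D) ∞ Φ x := by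
    refine ContMDiffAt.sum fun i _ ↦ ?_
    have h1 := (e.contMDiffAt_section_iff hxe).1 (hs.contMDiffAt hx (b i))
    exact ((ContinuousLinearMap.smulRightL ℝ (RVec D) (RVec D)
      (LinearMap.toContinuousLinearMap (b.coord i))).contMDiff.contMDiffAt).comp x h1
  have hΦe : ∀ y (hy : y ∈ e.baseSet), Φ y =
      ((s y).trans (e.continuousLinearEquivAt ℝ y hy) : RVec D →L[ℝ] RVec D) := by
    intro y hy
    refine ContinuousLinearMap.coe_injective (b.ext fun j ↦ ?_)
    simp [Φ, Finsupp.single_apply]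
  have h2 := (e.contMDiffAt_section_iff hxe).1 hX
  have hinv : ContMDiffAt (𝓡 D) 𝓘(ℝ, RVec D →L[ℝ] RVec D) ∞
      (fun y ↦ ContinuousLinearMap.inverse (Φ y)) x := by
    have h3 : ContDiffAt ℝ ∞ (ContinuousLinearMap.inverse : (RVec D →L[ℝ] RVec D) → _) (Φ x) := by
      rw [hΦe x hxe]
      exact contDiffAt_map_inverse _
    exact h3.contMDiffAt.comp x hΦ
  refine (hinv.clm_apply h2).congr_of_eventuallyEq ?_
  filter_upwards [e.open_baseSet.mem_nhds hxe] with y hy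
  rw [hΦe y hy, ContinuousLinearMap.inverse_equiv]
  exact (congrArg (s y).symm ((e.continuousLinearEquivAt ℝ y hy).symm_apply_apply (X y))).symm

theorem contMDiffAt_apply {f : M → RVec D} (hf : ContMDiffAt (𝓡 D) 𝓘(ℝ, RVec D) ∞ f x) :
    ContMDiffAt (𝓡 D) (𝓡 D).tangent ∞ (fun y ↦ (⟨y, s y (f y)⟩ : TangentBundle (𝓡 D) M)) x := by
  let b := (EuclideanSpace.basisFun (Fin D) ℝ).toBasis
  have h : ContMDiffAt (𝓡 D) (𝓡 D).tangent ∞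
    (fun y ↦ (⟨y, ∑ i, b.coord i (f y) • s y (b i)⟩ : TangentBundle (𝓡 D) M)) x := by
    refine ContMDiffAt.sum_section fun i _ ↦ ContMDiffAt.smul_section ?_ (hs.contMDiffAt hx _)
    exact (LinearMap.toContinuousLinearMap (b.coord i)).contMDiff.contMDiffAt.comp x hf
  convert h using 3 with y
  refine (congrArg (s y) (b.sum_repr (f y)).symm).trans ((map_sum (s y) _ _).trans ?_)
  exact Finset.sum_congr rfl fun i _ ↦ map_smul (s y) _ _

/-- The vector fields of a local frame extend to global vector fields. -/
theorem exists_extension [T2Space M] (v : RVec D) : ∃ Y : ∀ x : M, TangentSpace (𝓡 D) x,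
    IsSmoothVF Y ∧ (∀ᶠ y in nhds x, Y y = s y v) ∧ (∀ y ∈ U, ∃ c : ℝ, Y y = s y (c • v)) ∧
      ∀ y, y ∉ U → Y y = 0 := by
  -- A bump function supported in U and equal to 1 near x multiplies the frame field; multiplication
  -- by a scalar does not leave E.
  obtain ⟨f, -, hf⟩ := (SmoothBumpFunction.nhds_basis_tsupport (I := 𝓡 D) x).mem_iff.1
    (hs.isOpen.mem_nhds hx)
  refine ⟨fun y ↦ f y • s y v, ?_, ?_, fun y _ ↦ ⟨f y, (map_smul (s y) _ _).symm⟩, fun y hy ↦ ?_⟩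
  · exact ContMDiffOn.smul_section_of_tsupport (f.contMDiff.contMDiffOn) hs.isOpen hf (hs.smooth v)
  · filter_upwards [f.eventuallyEq_one] with y hy
    rw [hy]
    exact one_smul ℝ _
  · have : f y = 0 := image_eq_zero_of_notMem_tsupport fun h ↦ hy (hf h)
    dsimp only
    rw [this]
    exact zero_smul ℝ _

end IsLocalSection

namespace GStructure

variable {S : GalileanModel p D} (P : GStructure S M)

/-- Every frame of the `G`-structure is the value of a smooth local section. -/
theorem exists_section_eq {x : M} {u : RVec D ≃L[ℝ] TangentSpace (𝓡 D) x} (hu : u ∈ P.frames x) :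
    ∃ U s, x ∈ U ∧ IsLocalSection P.frames U s ∧ s x = u := by
  obtain ⟨U, s, hx, hs⟩ := P.exists_section x
  obtain ⟨g, hg, h⟩ := (P.mem_iff x _ u (hs.mem x hx)).1 hu
  let e : RVec D ≃L[ℝ] RVec D := ContinuousLinearEquiv.unitsEquiv ℝ (RVec D) g
  refine ⟨U, fun y ↦ e.trans (s y), hx, ⟨hs.isOpen, fun y hy ↦ ?_, fun v ↦ hs.smooth (e v)⟩, ?_⟩
  · exact (P.mem_iff y _ _ (hs.mem y hy)).2 ⟨g, hg, fun v ↦ rfl⟩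
  · ext v
    rw [h]
    rfl

variable {P} {U : Set M} {s : ∀ x : M, RVec D ≃L[ℝ] TangentSpace (𝓡 D) x}
  (hs : IsLocalSection P.frames U s) {x : M} (hx : x ∈ U)

include hs hx in
theorem exists_extension_E [T2Space M] {w : RVec D} (hw : w ∈ S.W) :
    ∃ Y : ∀ x : M, TangentSpace (𝓡 D) x, P.IsSectionE Y ∧ ∀ᶠ y in nhds x, Y y = s y w := by
  obtain ⟨Y, hY, hYe, hYU, hY0⟩ := hs.exists_extension hx w
  refine ⟨Y, ⟨hY, fun y ↦ ?_⟩, hYe⟩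
  by_cases hy : y ∈ U
  · obtain ⟨c, hc⟩ := hYU y hy
    rw [hc, mem_E_iff (hs.mem y hy), ContinuousLinearEquiv.symm_apply_apply]
    exact S.W.smul_mem c hw
  · rw [hY0 y hy]
    exact (P.E y).zero_mem

end GStructure

end LocalSections

/-! ### Derivatives of vector-valued functions on manifolds -/

section Derivatives

variable {E H M F G : Type*} [NormedAddCommGroup E] [NormedSpace ℝ E] [TopologicalSpace H]
  {I : ModelWithCorners ℝ E H} [TopologicalSpace M] [ChartedSpace H M]
  [NormedAddCommGroup F] [NormedSpace ℝ F] [NormedAddCommGroup G] [NormedSpace ℝ G]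

theorem mvfderiv_comp_of_hasFDerivAt {f : M → F} {x : M} {φ : F → G} {φ' : F →L[ℝ] G}
    (hφ : HasFDerivAt φ φ' (f x)) (hf : MDifferentiableAt I 𝓘(ℝ, F) f x) (X : TangentSpace I x) :
    mvfderiv I (fun y ↦ φ (f y)) x X = φ' (mvfderiv I f x X) := by
  have h := (hφ.hasMFDerivAt.comp x hf.hasMFDerivAt).mfderiv
  change mfderiv I 𝓘(ℝ, G) (φ ∘ f) x X = _
  rw [h]
  rfl

theorem mvfderiv_clm_comp {f : M → F} {x : M} (L : F →L[ℝ] G)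
    (hf : MDifferentiableAt I 𝓘(ℝ, F) f x) (X : TangentSpace I x) :
    mvfderiv I (fun y ↦ L (f y)) x X = L (mvfderiv I f x X) :=
  mvfderiv_comp_of_hasFDerivAt L.hasFDerivAt hf X

theorem mvfderiv_bilin [FiniteDimensional ℝ F] {f g : M → F} {x : M} (B : F →ₗ[ℝ] F →ₗ[ℝ] G)
    (hf : MDifferentiableAt I 𝓘(ℝ, F) f x) (hg : MDifferentiableAt I 𝓘(ℝ, F) g x)
    (X : TangentSpace I x) : mvfderiv I (fun y ↦ B (f y) (g y)) x X =
      B (mvfderiv I f x X) (g x) + B (f x) (mvfderiv I g x X) := by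
  have h := mvfderiv_comp_of_hasFDerivAt (f := fun y ↦ (f y, g y))
    ((LinearMap.toContinuousBilinearMap B).hasFDerivAt_of_bilinear (hasFDerivAt_fst (p := (f x, g x)))
    (hasFDerivAt_snd (p := (f x, g x)))) (hf.prodMk_space hg) X
  have h1 : mvfderiv I f x X = (mvfderiv I (fun y ↦ (f y, g y)) x X).1 :=
    mvfderiv_clm_comp (ContinuousLinearMap.fst ℝ F F) (hf.prodMk_space hg) X
  have h2 : mvfderiv I g x X = (mvfderiv I (fun y ↦ (f y, g y)) x X).2 :=
    mvfderiv_clm_comp (ContinuousLinearMap.snd ℝ F F) (hf.prodMk_space hg) X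
  rw [h1, h2, add_comm]
  exact h

end Derivatives

/-! ### Adapted connections in local frames -/

section Connections

variable {p D : ℕ} {M : Type*} [TopologicalSpace M] [ChartedSpace (RVec D) M]
  [IsManifold (𝓡 D) ∞ M]

theorem CovariantDerivative.sum_smul
    (cov : CovariantDerivative (𝓡 D) (RVec D) (TangentSpace (𝓡 D) : M → Type _)) {x : M}
    {ι : Type*} (t : Finset ι) {g : ι → M → ℝ} {σ : ι → ∀ x : M, TangentSpace (𝓡 D) x}
    (hg : ∀ i, MDifferentiableAt (𝓡 D) 𝓘(ℝ, ℝ) (g i) x)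
    (hσ : ∀ i, MDifferentiableAt (𝓡 D) (𝓡 D).tangent
      (fun y ↦ (⟨y, σ i y⟩ : TangentBundle (𝓡 D) M)) x) (X : TangentSpace (𝓡 D) x) :
    cov (fun y ↦ ∑ i ∈ t, g i y • σ i y) x X =
      ∑ i ∈ t, (g i x • cov (σ i) x X + mvfderiv (𝓡 D) (g i) x X • σ i x) := by
  classical
  have hcov := cov.isCovariantDerivativeOn (s := Set.univ)
  induction t using Finset.induction_on with
  | empty =>
    simp only [Finset.sum_empty]
    have := hcov.zero (x := x)
    exact congrArg (fun L : TangentSpace (𝓡 D) x →L[ℝ] TangentSpace (𝓡 D) x ↦ L X) this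
  | insert i t hi ih =>
    have h1 : (fun y ↦ ∑ j ∈ insert i t, g j y • σ j y) =
        (g i • σ i) + fun y ↦ ∑ j ∈ t, g j y • σ j y := by
      funext y
      exact Finset.sum_insert hi
    have h2 : MDifferentiableAt (𝓡 D) (𝓡 D).tangent
        (fun y ↦ (⟨y, (g i • σ i) y⟩ : TangentBundle (𝓡 D) M)) x := (hg i).smul_section (hσ i)
    have h3 : MDifferentiableAt (𝓡 D) (𝓡 D).tangent
        (fun y ↦ (⟨y, ∑ j ∈ t, g j y • σ j y⟩ : TangentBundle (𝓡 D) M)) x :=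
      MDifferentiableAt.sum_section fun j _ ↦ (hg j).smul_section (hσ j)
    rw [h1, hcov.add h2 h3, hcov.leibniz (hσ i) (hg i), Finset.sum_insert hi, ← ih]
    rfl

namespace GStructure

variable {S : GalileanModel p D} {P : GStructure S M}
  {cov : CovariantDerivative (𝓡 D) (RVec D) (TangentSpace (𝓡 D) : M → Type _)}

/-- The connection form of an adapted connection. -/
theorem IsAdapted.exists_cov_eq (hcov : P.IsAdapted cov) {U : Set M}
    {s : ∀ x : M, RVec D ≃L[ℝ] TangentSpace (𝓡 D) x} (hs : IsLocalSection P.frames U s) {x : M}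
    (hx : x ∈ U) : ∃ A : TangentSpace (𝓡 D) x → End ℝ (RVec D), (∀ X, A X ∈ S.lieAlg) ∧
      ∀ X (f : M → RVec D), MDifferentiableAt (𝓡 D) 𝓘(ℝ, RVec D) f x →
        cov (fun y ↦ s y (f y)) x X = s x (mvfderiv (𝓡 D) f x X + A X (f x)) := by
  choose A hA hAs using hcov.connection_form U s hs x hx
  refine ⟨A, hA, fun X f hf ↦ ?_⟩
  let b := (EuclideanSpace.basisFun (Fin D) ℝ).toBasis
  -- The section is expanded in the fields `s (b i)` of a constant basis. The Leibniz rule gives the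
  -- derivatives of the coefficients, and the connection form gives the rest.
  have h1 : ∀ y (v : RVec D), s y v = ∑ i, b.coord i v • s y (b i) := by
    intro y v
    refine (congrArg (s y) (b.sum_repr v).symm).trans ((map_sum (s y) _ _).trans ?_)
    exact Finset.sum_congr rfl fun i _ ↦ map_smul (s y) _ _
  have hb : ∀ i, MDifferentiableAt (𝓡 D) 𝓘(ℝ, ℝ) (fun y ↦ b.coord i (f y)) x := fun i ↦
    (LinearMap.toContinuousLinearMap (b.coord i)).differentiableAt.comp_mdifferentiableAt hf
  have h2 := cov.sum_smul Finset.univ (x := x) hb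
    (fun i ↦ (hs.contMDiffAt hx (b i)).mdifferentiableAt (by simp)) X
  have h3 : (fun y ↦ s y (f y)) = fun y ↦ ∑ i, b.coord i (f y) • s y (b i) := funext fun y ↦ h1 y _
  rw [h3, h2, Finset.sum_add_distrib, add_comm, map_add]
  congr 1
  · rw [h1]
    refine Finset.sum_congr rfl fun i _ ↦ ?_
    have := mvfderiv_clm_comp (LinearMap.toContinuousLinearMap (b.coord i)) hf X
    exact congrArg (fun r : ℝ ↦ r • s x (b i)) this
  · simp only [hAs]
    conv_rhs => rw [← b.sum_repr (f x)]
    rw [map_sum]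
    refine Eq.trans ?_ (map_sum (s x) _ _).symm
    refine Finset.sum_congr rfl fun i _ ↦ ?_
    rw [map_smul]
    exact (map_smul (s x) _ _).symm

theorem torsBilin_torsionAt (x : M) (u : RVec D ≃L[ℝ] TangentSpace (𝓡 D) x) (v v' : RVec D) :
    torsBilin (torsionAt cov x u) v v' = u.symm (cov.torsion x (u v) (u v')) := rfl

/-- The components of the Lie bracket of vector fields in a local frame. -/
theorem IsAdapted.exists_symm_mlieBracket_eq (hcov : P.IsAdapted cov) {U : Set M}
    {s : ∀ x : M, RVec D ≃L[ℝ] TangentSpace (𝓡 D) x} (hs : IsLocalSection P.frames U s) {x : M}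
    (hx : x ∈ U) : ∃ A : TangentSpace (𝓡 D) x → End ℝ (RVec D), (∀ X, A X ∈ S.lieAlg) ∧
      ∀ X Y : ∀ x : M, TangentSpace (𝓡 D) x,
        ContMDiffAt (𝓡 D) (𝓡 D).tangent ∞ (fun y ↦ (⟨y, X y⟩ : TangentBundle (𝓡 D) M)) x →
        ContMDiffAt (𝓡 D) (𝓡 D).tangent ∞ (fun y ↦ (⟨y, Y y⟩ : TangentBundle (𝓡 D) M)) x →
        (s x).symm (VectorField.mlieBracket (𝓡 D) X Y x) =
          (mvfderiv (𝓡 D) (fun y ↦ (s y).symm (Y y)) x (X x) + A (X x) ((s x).symm (Y x)))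
          - (mvfderiv (𝓡 D) (fun y ↦ (s y).symm (X y)) x (Y x) + A (Y x) ((s x).symm (X x)))
          - torsBilin (torsionAt cov x (s x)) ((s x).symm (X x)) ((s x).symm (Y x)) := by
  obtain ⟨A, hA, h⟩ := hcov.exists_cov_eq hs hx
  refine ⟨A, hA, fun X Y hX hY ↦ ?_⟩
  have e : ∀ X : ∀ x : M, TangentSpace (𝓡 D) x, (fun y ↦ s y ((s y).symm (X y))) = X := fun X ↦
    funext fun y ↦ (s y).apply_symm_apply _
  have h1 := h (X x) _ ((hs.contMDiffAt_symm hx hY).mdifferentiableAt (by simp))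
  have h2 := h (Y x) _ ((hs.contMDiffAt_symm hx hX).mdifferentiableAt (by simp))
  rw [e] at h1 h2
  rw [torsBilin_torsionAt, ContinuousLinearEquiv.apply_symm_apply,
    ContinuousLinearEquiv.apply_symm_apply, cov.torsion_apply
    (hX.mdifferentiableAt (by simp)) (hY.mdifferentiableAt (by simp)),
    h1, h2, map_sub, map_sub, ContinuousLinearEquiv.symm_apply_apply,
    ContinuousLinearEquiv.symm_apply_apply]
  abel

end GStructure

end Connections

/-! ### Intrinsic torsion and Lie derivatives -/

section IntrinsicTorsion

variable {p D : ℕ}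

namespace GalileanModel

variable {S : GalileanModel p D}

/-- A basis-free form of the vanishing of the coordinates: v = e_j, v' = u_a gives c = 0, and the
pairs of vectors u give s = 0. -/
theorem mem_range_spencer_iff {T : Tors D} : T ∈ LinearMap.range S.spencer ↔
    ∀ w ∈ S.W, ∀ v v', S.η (torsBilin T w v) v' + S.η v (torsBilin T w v') = 0 := by
  obtain ⟨b⟩ := S.exists_adaptedBasis
  constructor
  · rintro ⟨k, rfl⟩ w hw v v'
    rw [torsBilin_spencer, torsBilin_spencer, map_sub, map_sub, LinearMap.sub_apply,
      S.η_left (lieAlg_mem_W (k v).2 hw), S.η_right (lieAlg_mem_W (k v').2 hw), sub_zero, sub_zero]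
    exact (k w).2.1 v v'
  · intro h
    refine b.mem_range_spencer_of_coord (Prod.ext ?_ ?_)
    · funext i j a
      have := h _ (b.mem_W i) (b.e j) (b.u a)
      rwa [b.η_e, add_zero] at this
    · funext i a c
      have := h _ (b.mem_W i) (b.u a) (b.u c)
      rwa [S.η_symm (b.u a)] at this

/-- The witnesses are related by z = -w₀/2. The sign comes from exchanging the arguments of T, and
the factor from the 2 in L_X η = 2γ(X, Z)η. -/
theorem mem_torsTr_iff' {T : Tors D} : T ∈ S.torsTr ↔ ∃ z ∈ S.W, ∀ w ∈ S.W, ∀ v v',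
    S.η (torsBilin T w v) v' + S.η v (torsBilin T w v') = 2 * S.γ w z * S.η v v' := by
  have e : ∀ w v v', S.η (torsBilin T w v) v' + S.η v (torsBilin T w v') =
      -(S.η (T ![v, w]) v' + S.η (T ![v', w]) v) := by
    intro w v v'
    rw [← torsBilin_apply, ← torsBilin_apply, torsBilin_swap T w v, torsBilin_swap T w v',
      S.η_symm v, map_neg, map_neg, LinearMap.neg_apply, LinearMap.neg_apply]
    ring
  constructor
  · rintro ⟨w₀, hw₀, h⟩
    refine ⟨(-(1 / 2) : ℝ) • w₀, S.W.smul_mem _ hw₀, fun w hw v v' ↦ ?_⟩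
    rw [e, h w hw, S.γ_symm hw (S.W.smul_mem _ hw₀), γ_smul_left _ hw₀ hw]
    ring
  · rintro ⟨z, hz, h⟩
    refine ⟨(-2 : ℝ) • z, S.W.smul_mem _ hz, fun w hw v v' ↦ ?_⟩
    have := h w hw v v'
    rw [e, S.γ_symm hw hz] at this
    rw [γ_smul_left _ hz hw]
    linarith

end GalileanModel

open GalileanModel GalileanModel.AdaptedBasis

variable {M : Type*} [TopologicalSpace M] [ChartedSpace (RVec D) M]

theorem mvfderiv_congr {F : Type*} [NormedAddCommGroup F] [NormedSpace ℝ F] {f g : M → F} {x : M}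
    (h : f =ᶠ[nhds x] g) (X : TangentSpace (𝓡 D) x) :
    mvfderiv (𝓡 D) f x X = mvfderiv (𝓡 D) g x X := by
  change mfderiv (𝓡 D) 𝓘(ℝ, F) f x X = mfderiv (𝓡 D) 𝓘(ℝ, F) g x X
  rw [h.mfderiv_eq]
  rfl

variable [IsManifold (𝓡 D) ∞ M]

namespace GStructure

variable {S : GalileanModel p D} {P : GStructure S M}
  {cov : CovariantDerivative (𝓡 D) (RVec D) (TangentSpace (𝓡 D) : M → Type _)}

theorem intrinsicTorsionIn_map_iff {K : Submodule ℝ (Tors D)}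
    (hK : LinearMap.range S.spencer ≤ K) :
    P.IntrinsicTorsionIn cov (K.map (LinearMap.range S.spencer).mkQ) ↔
      ∀ x, ∀ u ∈ P.frames x, torsionAt cov x u ∈ K := by
  simp only [IntrinsicTorsionIn, mkQ_mem_map_iff hK]

/-- In a frame of the structure a section of E is a function with values in the fixed subspace W, so
its derivatives lie in W too. This is tested with the functionals η(·, w), which cut out W. -/
theorem mvfderiv_symm_mem_W {U : Set M} {s : ∀ x : M, RVec D ≃L[ℝ] TangentSpace (𝓡 D) x}
    (hs : IsLocalSection P.frames U s) {x : M} (hx : x ∈ U) {X : ∀ x : M, TangentSpace (𝓡 D) x}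
    (hX : P.IsSectionE X) (v : TangentSpace (𝓡 D) x) :
    mvfderiv (𝓡 D) (fun y ↦ (s y).symm (X y)) x v ∈ S.W := by
  rw [S.mem_W_iff]
  intro w
  have h := mvfderiv_clm_comp (LinearMap.toContinuousLinearMap (LinearMap.flip S.η w))
    ((hs.contMDiffAt_symm hx hX.1.contMDiffAt).mdifferentiableAt (by simp)) v
  have h2 : (fun y ↦ LinearMap.toContinuousLinearMap (LinearMap.flip S.η w) ((s y).symm (X y)))
      =ᶠ[nhds x] fun _ ↦ 0 := by
    filter_upwards [hs.isOpen.mem_nhds hx] with y hy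
    exact S.η_left ((mem_E_iff (hs.mem y hy)).1 (hX.2 y)) w
  rw [mvfderiv_congr h2, mvfderiv_const] at h
  exact h.symm

theorem symm_torsion {x : M} (u : RVec D ≃L[ℝ] TangentSpace (𝓡 D) x) (X Y : TangentSpace (𝓡 D) x) :
    u.symm (cov.torsion x X Y) = torsBilin (torsionAt cov x u) (u.symm X) (u.symm Y) := by
  rw [torsBilin_torsionAt, ContinuousLinearEquiv.apply_symm_apply,
    ContinuousLinearEquiv.apply_symm_apply]

/-- The Lie derivative of `η` along a section of the transverse bundle, in terms of torsion. -/
theorem IsAdapted.lieDerivη_eq (hcov : P.IsAdapted cov) {X Y Y' : ∀ x : M, TangentSpace (𝓡 D) x}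
    (hX : P.IsSectionE X) (hY : IsSmoothVF Y) (hY' : IsSmoothVF Y') (x : M) :
    P.lieDerivη X Y Y' x = P.η x (cov.torsion x (X x) (Y x)) (Y' x)
      + P.η x (Y x) (cov.torsion x (X x) (Y' x)) := by
  obtain ⟨U, s, hx, hs⟩ := P.exists_section x
  obtain ⟨A, hA, hbr⟩ := hcov.exists_symm_mlieBracket_eq hs hx
  have hsx := hs.mem x hx
  have h1 : (fun y ↦ P.η y (Y y) (Y' y)) =ᶠ[nhds x]
      fun y ↦ S.η ((s y).symm (Y y)) ((s y).symm (Y' y)) := by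
    filter_upwards [hs.isOpen.mem_nhds hx] with y hy
    exact η_eq (hs.mem y hy) _ _
  have hXW := (mem_E_iff hsx).1 (hX.2 x)
  -- These are the components of ∇_v X. They lie in W, so the terms ∇_Y X and ∇_Y' X of the brackets
  -- disappear under `η`; the remaining connection terms cancel because the connection form is
  -- `η`-skew.
  have hd : ∀ v, mvfderiv (𝓡 D) (fun y ↦ (s y).symm (X y)) x v + A v ((s x).symm (X x)) ∈ S.W :=
    fun v ↦ S.W.add_mem (mvfderiv_symm_mem_W hs hx hX v) (lieAlg_mem_W (hA v) hXW)
  rw [lieDerivη, mvfderiv_congr h1, mvfderiv_bilin S.η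
    ((hs.contMDiffAt_symm hx hY.contMDiffAt).mdifferentiableAt (by simp))
    ((hs.contMDiffAt_symm hx hY'.contMDiffAt).mdifferentiableAt (by simp)),
    η_eq hsx, η_eq hsx, η_eq hsx, η_eq hsx, hbr X Y hX.1.contMDiffAt hY.contMDiffAt,
    hbr X Y' hX.1.contMDiffAt hY'.contMDiffAt, symm_torsion, symm_torsion]
  have h2 := (hA (X x)).1 ((s x).symm (Y x)) ((s x).symm (Y' x))
  have h3 := S.η_left (hd (Y x)) ((s x).symm (Y' x))
  have h4 := S.η_right (hd (Y' x)) ((s x).symm (Y x))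
  simp only [map_sub, map_add, LinearMap.sub_apply, LinearMap.add_apply] at h3 h4 ⊢
  linarith

theorem exists_sectionE_eq [T2Space M] {x : M} {X : TangentSpace (𝓡 D) x} (hX : X ∈ P.E x) :
    ∃ Y : ∀ x : M, TangentSpace (𝓡 D) x, P.IsSectionE Y ∧ Y x = X := by
  obtain ⟨U, s, hx, hs⟩ := P.exists_section x
  obtain ⟨Y, hY, h⟩ := exists_extension_E hs hx ((mem_E_iff (hs.mem x hx)).1 hX)
  exact ⟨Y, hY, by rw [h.self_of_nhds, ContinuousLinearEquiv.apply_symm_apply]⟩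

variable (P) in
include P in
theorem exists_smoothVF_eq [T2Space M] {x : M} (X : TangentSpace (𝓡 D) x) :
    ∃ Y : ∀ x : M, TangentSpace (𝓡 D) x, IsSmoothVF Y ∧ Y x = X := by
  obtain ⟨U, s, hx, hs⟩ := P.exists_section x
  obtain ⟨Y, hY, h, -⟩ := hs.exists_extension hx ((s x).symm X)
  exact ⟨Y, hY, by rw [h.self_of_nhds, ContinuousLinearEquiv.apply_symm_apply]⟩

/-- The intrinsic torsion vanishes if and only if `η` is invariant along the transverse bundle. -/
theorem IsAdapted.intrinsicTorsionIn_bot_iff [T2Space M] (hcov : P.IsAdapted cov) :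
    P.IntrinsicTorsionIn cov ⊥ ↔ ∀ X : ∀ x : M, TangentSpace (𝓡 D) x, P.IsSectionE X →
      ∀ Y Y' : ∀ x : M, TangentSpace (𝓡 D) x, IsSmoothVF Y → IsSmoothVF Y' →
        ∀ x, P.lieDerivη X Y Y' x = 0 := by
  have e : (⊥ : Submodule ℝ S.Coker) =
      (LinearMap.range S.spencer).map (LinearMap.range S.spencer).mkQ := by
    rw [Submodule.mkQ_map_self]
  rw [e, intrinsicTorsionIn_map_iff le_rfl]
  constructor
  · intro h X hX Y Y' hY hY' x
    have hu := P.frame_mem x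
    rw [hcov.lieDerivη_eq hX hY hY', η_eq hu, η_eq hu, symm_torsion, symm_torsion]
    exact mem_range_spencer_iff.1 (h x _ hu) _ ((mem_E_iff hu).1 (hX.2 x)) _ _
  · intro h x u hu
    refine mem_range_spencer_iff.2 fun w hw v v' ↦ ?_
    obtain ⟨X, hX, hXx⟩ := exists_sectionE_eq (P := P) (X := u w)
      (by rw [mem_E_iff hu, ContinuousLinearEquiv.symm_apply_apply]; exact hw)
    obtain ⟨Y, hY, hYx⟩ := P.exists_smoothVF_eq (u v)
    obtain ⟨Y', hY', hYx'⟩ := P.exists_smoothVF_eq (u v')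
    have h1 := h X hX Y Y' hY hY' x
    rw [hcov.lieDerivη_eq hX hY hY', η_eq hu, η_eq hu, symm_torsion, symm_torsion, hXx, hYx, hYx'] at h1
    simpa only [ContinuousLinearEquiv.symm_apply_apply] using h1

/-- The intrinsic torsion lies in the second summand if and only if the Lie derivatives of `η`
along the transverse bundle are proportional to `η`. -/
theorem IsAdapted.intrinsicTorsionIn_torsTr_iff [T2Space M] (hcov : P.IsAdapted cov) :
    P.IntrinsicTorsionIn cov (S.torsTr.map (LinearMap.range S.spencer).mkQ) ↔
      ∃ Z : ∀ x : M, TangentSpace (𝓡 D) x, P.IsSectionE Z ∧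
        ∀ X : ∀ x : M, TangentSpace (𝓡 D) x, P.IsSectionE X →
          ∀ Y Y' : ∀ x : M, TangentSpace (𝓡 D) x, IsSmoothVF Y → IsSmoothVF Y' →
            ∀ x, P.lieDerivη X Y Y' x = 2 * P.γ x (X x) (Z x) * P.η x (Y x) (Y' x) := by
  rw [intrinsicTorsionIn_map_iff range_spencer_le_torsTr]
  constructor
  · intro h
    choose z hz h using fun x ↦ mem_torsTr_iff'.1 (h x _ (P.frame_mem x))
    let Z : ∀ x : M, TangentSpace (𝓡 D) x := fun x ↦ P.frame x (z x)
    have hZE : ∀ x, Z x ∈ P.E x := fun x ↦ by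
      rw [mem_E_iff (P.frame_mem x), ContinuousLinearEquiv.symm_apply_apply]
      exact hz x
    have key : ∀ x (X : TangentSpace (𝓡 D) x), X ∈ P.E x → ∀ Y Y', P.η x (cov.torsion x X Y) Y'
        + P.η x Y (cov.torsion x X Y') = 2 * P.γ x X (Z x) * P.η x Y Y' := by
      intro x X hX Y Y'
      have hu := P.frame_mem x
      rw [η_eq hu, η_eq hu, η_eq hu, γ_eq hu hX (hZE x), symm_torsion, symm_torsion,
        ContinuousLinearEquiv.symm_apply_apply]
      exact h x _ ((mem_E_iff hu).1 hX) _ _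
    refine ⟨Z, ⟨fun x ↦ ?_, hZE⟩, fun X hX Y Y' hY hY' x ↦ ?_⟩
    -- `Z` was chosen point by point, so its smoothness needs an argument. With Y = Y' = u_0 the
    -- equation determines γ(Z, e_i) as -1/δ_0 times the `η`-product with u_0 of the bracket of the
    -- frame fields e_i and u_0, which is smooth.
    · obtain ⟨U, s, hx, hs⟩ := P.exists_section x
      obtain ⟨b⟩ := S.exists_adaptedBasis
      -- the components of `Z`
      have hcomp : ∀ y ∈ U, ∀ i, S.γ ((s y).symm (Z y)) (b.e i) = - ((b.δ 0)⁻¹ *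
          S.η ((s y).symm (VectorField.mlieBracket (𝓡 D) (fun y ↦ s y (b.e i))
            (fun y ↦ s y (b.u 0)) y)) (b.u 0)) := by
        intro y hy i
        have hsy := hs.mem y hy
        have hei : s y (b.e i) ∈ P.E y := by
          rw [mem_E_iff hsy, ContinuousLinearEquiv.symm_apply_apply]
          exact b.mem_W i
        have h1 := key y _ hei (s y (b.u 0)) (s y (b.u 0))
        rw [η_eq hsy, η_eq hsy, η_eq hsy, γ_eq hsy hei (hZE y), symm_torsion,
          ContinuousLinearEquiv.symm_apply_apply, ContinuousLinearEquiv.symm_apply_apply,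
          S.γ_symm (b.mem_W i) ((mem_E_iff hsy).1 (hZE y)), b.η_apply, if_pos rfl,
          S.η_symm (b.u 0)] at h1
        obtain ⟨A, hA, hbr⟩ := hcov.exists_symm_mlieBracket_eq hs hy
        have h2 := hbr _ _ (hs.contMDiffAt hy (b.e i)) (hs.contMDiffAt hy (b.u 0))
        simp only [ContinuousLinearEquiv.symm_apply_apply] at h2
        rw [mvfderiv_const, mvfderiv_const] at h2
        rw [h2]
        have h3 := (hA (s y (b.e i))).1 (b.u 0) (b.u 0)
        rw [S.η_symm (b.u 0)] at h3
        have h4 := S.η_left (lieAlg_mem_W (hA (s y (b.u 0))) (b.mem_W i)) (b.u 0)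
        have h5 := b.δ_ne 0
        simp only [zero_apply, zero_add, map_sub, LinearMap.sub_apply, h4, sub_zero]
        rw [show S.η (A (s y (b.e i)) (b.u 0)) (b.u 0) = 0 by linarith]
        field_simp
        linarith
      have hsm : ContMDiffAt (𝓡 D) 𝓘(ℝ, RVec D) ∞ (fun y ↦ (s y).symm (Z y)) x := by
        have h1 : ∀ i, ContMDiffAt (𝓡 D) 𝓘(ℝ, ℝ) ∞ (fun y ↦ S.η ((s y).symm
            (VectorField.mlieBracket (𝓡 D) (fun y ↦ s y (b.e i)) (fun y ↦ s y (b.u 0)) y))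
              (b.u 0)) x := by
          intro i
          have : IsManifold (𝓡 D) (minSmoothness ℝ 2) M := by
            rw [minSmoothness_of_isRCLikeNormedField]
            exact IsManifold.of_le (n := ∞) (WithTop.coe_le_coe.2 le_top)
          have : IsManifold (𝓡 D) (((⊤ : ℕ∞) : WithTop ℕ∞) + 1) M :=
            IsManifold.of_le (n := ∞) (by simp)
          have h2 := hs.contMDiffAt_symm hx (ContMDiffAt.mlieBracket_vectorField (m := ⊤) (n := ⊤)
            (hs.contMDiffAt hx (b.e i)) (hs.contMDiffAt hx (b.u 0)) (by simp))
          exact (LinearMap.toContinuousLinearMap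
            (LinearMap.flip S.η (b.u 0))).contMDiff.contMDiffAt.comp x h2
        have h2 : ContMDiffAt (𝓡 D) 𝓘(ℝ, RVec D) ∞ (fun y ↦ ∑ i, ((b.ε i)⁻¹ * - ((b.δ 0)⁻¹ *
          S.η ((s y).symm (VectorField.mlieBracket (𝓡 D) (fun y ↦ s y (b.e i))
            (fun y ↦ s y (b.u 0)) y)) (b.u 0))) • b.e i) x := by
          refine ContMDiffAt.sum fun i _ ↦ ?_
          exact ((ContinuousLinearMap.toSpanSingleton ℝ (b.e i)).contMDiff.contMDiffAt.comp x
            (contMDiffAt_const.mul (contMDiffAt_const.mul (h1 i)).neg))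
        refine h2.congr_of_eventuallyEq ?_
        filter_upwards [hs.isOpen.mem_nhds hx] with y hy
        simp only [← hcomp y hy]
        exact (b.sum_γ ((mem_E_iff (hs.mem y hy)).1 (hZE y))).symm
      have := hs.contMDiffAt_apply hx hsm
      simpa only [ContinuousLinearEquiv.apply_symm_apply] using this
    · rw [hcov.lieDerivη_eq hX hY hY', key x _ (hX.2 x)]
  · rintro ⟨Z, hZ, h⟩ x u hu
    refine mem_torsTr_iff'.2 ⟨u.symm (Z x), (mem_E_iff hu).1 (hZ.2 x), fun w hw v v' ↦ ?_⟩
    obtain ⟨X, hX, hXx⟩ := exists_sectionE_eq (P := P) (X := u w)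
      (by rw [mem_E_iff hu, ContinuousLinearEquiv.symm_apply_apply]; exact hw)
    obtain ⟨Y, hY, hYx⟩ := P.exists_smoothVF_eq (u v)
    obtain ⟨Y', hY', hYx'⟩ := P.exists_smoothVF_eq (u v')
    have h1 := h X hX Y Y' hY hY' x
    rw [hcov.lieDerivη_eq hX hY hY', η_eq hu, η_eq hu, η_eq hu, γ_eq hu (hX.2 x) (hZ.2 x),
      symm_torsion, symm_torsion, hXx, hYx, hYx'] at h1
    simpa only [ContinuousLinearEquiv.symm_apply_apply] using h1

/-- The intrinsic torsion lies in the third submodule if and only if the transverse bundle is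
involutive. -/
theorem IsAdapted.intrinsicTorsionIn_torsInv_iff [T2Space M] (hcov : P.IsAdapted cov) :
    P.IntrinsicTorsionIn cov (S.torsInv.map (LinearMap.range S.spencer).mkQ) ↔ P.Involutive := by
  rw [intrinsicTorsionIn_map_iff range_spencer_le_torsInv]
  -- Modulo E the bracket of two sections of E is minus their torsion, since the covariant
  -- derivatives of sections of E stay in E.
  have key : ∀ (X Y : ∀ x : M, TangentSpace (𝓡 D) x), P.IsSectionE X → P.IsSectionE Y → ∀ x,
      ∀ u ∈ P.frames x, (VectorField.mlieBracket (𝓡 D) X Y x ∈ P.E x ↔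
        torsBilin (torsionAt cov x u) (u.symm (X x)) (u.symm (Y x)) ∈ S.W) := by
    intro X Y hX hY x u hu
    obtain ⟨U, s, hx, hs, rfl⟩ := P.exists_section_eq hu
    obtain ⟨A, hA, hbr⟩ := hcov.exists_symm_mlieBracket_eq hs hx
    rw [mem_E_iff hu, hbr X Y hX.1.contMDiffAt hY.1.contMDiffAt]
    refine Submodule.sub_mem_iff_right _ (S.W.sub_mem ?_ ?_)
    · exact S.W.add_mem (mvfderiv_symm_mem_W hs hx hY _)
        (lieAlg_mem_W (hA _) ((mem_E_iff hu).1 (hY.2 x)))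
    · exact S.W.add_mem (mvfderiv_symm_mem_W hs hx hX _)
        (lieAlg_mem_W (hA _) ((mem_E_iff hu).1 (hX.2 x)))
  constructor
  · intro h X Y hX hY x
    have hu := P.frame_mem x
    rw [key X Y hX hY x _ hu]
    exact h x _ hu _ ((mem_E_iff hu).1 (hX.2 x)) _ ((mem_E_iff hu).1 (hY.2 x))
  · intro h x u hu w hw w' hw'
    obtain ⟨X, hX, hXx⟩ := exists_sectionE_eq (P := P) (X := u w)
      (by rw [mem_E_iff hu, ContinuousLinearEquiv.symm_apply_apply]; exact hw)
    obtain ⟨Y, hY, hYx⟩ := exists_sectionE_eq (P := P) (X := u w')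
      (by rw [mem_E_iff hu, ContinuousLinearEquiv.symm_apply_apply]; exact hw')
    have h1 := (key X Y hX hY x u hu).1 (h X Y hX hY x)
    rw [hXx, hYx] at h1
    simp only [ContinuousLinearEquiv.symm_apply_apply] at h1
    exact h1

end GStructure

end IntrinsicTorsion

/-! ### Torsion and the exterior derivative of the characteristic form -/

namespace AlternatingMap

variable {V : Type*} [AddCommGroup V] [Module ℝ V]

/-- The action of an endomorphism as a derivation on alternating forms. -/
def deriv {κ : Type*} [Fintype κ] [DecidableEq κ] (f : V [⋀^κ]→ₗ[ℝ] ℝ) (A : End ℝ V) :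
    V [⋀^κ]→ₗ[ℝ] ℝ :=
  { (∑ k, f.toMultilinearMap.compLinearMap (Function.update (fun _ ↦ LinearMap.id) k A) :
      MultilinearMap ℝ (fun _ : κ ↦ V) ℝ) with
    map_eq_zero_of_eq' := by
      intro m i j hij hne
      have e : ∀ k, (fun l ↦ Function.update (fun _ ↦ LinearMap.id) k A l (m l)) =
          Function.update m k (A (m k)) := by
        intro k
        funext l
        rcases eq_or_ne l k with rfl | h
        · simp
        · simp [h]
      change (∑ k, f.toMultilinearMap.compLinearMap _ : MultilinearMap ℝ (fun _ : κ ↦ V) ℝ) m = 0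
      rw [sum_apply]
      simp only [MultilinearMap.compLinearMap_apply, e]
      rw [← Finset.add_sum_erase _ _ (Finset.mem_univ i), ← Finset.add_sum_erase _ _
        (Finset.mem_erase.2 ⟨hne.symm, Finset.mem_univ j⟩), Finset.sum_eq_zero, add_zero]
      · have h1 : Function.update m j (A (m j)) =
            Function.update m i (A (m i)) ∘ Equiv.swap i j := by
          funext l
          rcases eq_or_ne l i with rfl | hi
          · simp [hne, hne.symm, hij]
          rcases eq_or_ne l j with rfl | hj
          · simp [hij]
          · simp [Equiv.swap_apply_of_ne_of_ne hi hj, hi, hj]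
        rw [h1]
        exact (congrArg _ (f.map_swap _ hne)).trans (add_neg_cancel _)
      · intro k hk
        simp only [Finset.mem_erase, Finset.mem_univ, and_true] at hk
        refine f.map_eq_zero_of_eq _ ?_ hne
        rw [Function.update_of_ne hk.2.symm, Function.update_of_ne hk.1.symm, hij] }

theorem deriv_apply {κ : Type*} [Fintype κ] [DecidableEq κ] (f : V [⋀^κ]→ₗ[ℝ] ℝ) (A : End ℝ V)
    (m : κ → V) : f.deriv A m = ∑ k, f (Function.update m k (A (m k))) := by
  have e : ∀ k, (fun l ↦ Function.update (fun _ ↦ LinearMap.id) k A l (m l)) =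
      Function.update m k (A (m k)) := by
    intro k
    funext l
    rcases eq_or_ne l k with rfl | h
    · simp
    · simp [h]
  change (∑ k, f.toMultilinearMap.compLinearMap _ : MultilinearMap ℝ (fun _ : κ ↦ V) ℝ) m = _
  rw [sum_apply]
  simp only [MultilinearMap.compLinearMap_apply, e]
  rfl

variable {n : ℕ}

/-- The antisymmetrisation of `Ω₀(B(m_i, m_j), …)`. -/
theorem sum_deriv_removeNth (f : V [⋀^Fin (n + 1)]→ₗ[ℝ] ℝ) (m : Fin (n + 2) → V)
    (B : Fin (n + 2) → Fin (n + 2) → V) :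
    ∑ i : Fin (n + 2), (-1) ^ (i : ℕ) *
        ∑ k, f (Function.update (i.removeNth m) k (B i (i.succAbove k))) =
      ∑ i : Fin (n + 1), ∑ j ∈ Finset.Ici i, (-1) ^ ((i : ℕ) + (j : ℕ)) *
        f (Matrix.vecCons (B i.castSucc j.succ - B j.succ i.castSucc)
          (j.removeNth (i.castSucc.removeNth m))) := by
  simp only [Finset.mul_sum]
  -- The pairs (i, k), with k counting the indices other than i, are grouped into unordered pairs
  -- {i, j + 1} with i ≤ j; each group has two terms, one for either index being removed first.
  rw [Fin.sum_sum_eq_sum_triangle_add]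
  refine Fintype.sum_congr _ _ fun i ↦ Finset.sum_congr rfl fun j hj ↦ ?_
  rw [Finset.mem_Ici] at hj
  have H₁ : i.castSucc.succAbove j = j.succ := by simp [Fin.succAbove_of_le_castSucc, hj]
  have H₂ : j.predAbove i.castSucc = i := by simp [Fin.predAbove_of_le_castSucc, hj]
  have H₃ : j.succ.succAbove i = i.castSucc := by
    rw [Fin.succAbove_of_castSucc_lt]
    exact Fin.castSucc_lt_succ_iff.2 hj
  -- Moving the updated entry to the front produces the second sign. The shift from `j` to `j.succ`
  -- makes the signs of the two terms of a pair opposite, hence the difference of values of `B`.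
  simp only [← Fin.insertNth_removeNth, map_insertNth]
  rw [Fin.removeNth_removeNth_eq_swap m j i.castSucc, H₁, H₂, H₃]
  have h := f.map_update_sub (Matrix.vecCons (0 : V) (i.removeNth (j.succ.removeNth m))) 0
    (B i.castSucc j.succ) (B j.succ i.castSucc)
  have e : ∀ v : V, Function.update (Matrix.vecCons (0 : V) (i.removeNth (j.succ.removeNth m))) 0 v
      = Matrix.vecCons v (i.removeNth (j.succ.removeNth m)) := fun v ↦ by
    exact Fin.update_cons_zero _ _ _
  rw [e, e, e] at h
  rw [h]
  simp only [Fin.val_castSucc, Fin.val_succ, pow_add, pow_one]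
  ring

/-- The form `∑ (-1)^(i + j) f(T(m_i, m_j), …)`. -/
def contractForm (f : V [⋀^Fin (n + 1)]→ₗ[ℝ] ℝ) (T : V →ₗ[ℝ] V →ₗ[ℝ] V) :
    V [⋀^Fin (n + 2)]→ₗ[ℝ] ℝ :=
  alternatizeUncurryFin
    { toFun := fun v ↦ f.deriv (T v)
      map_add' := fun v v' ↦ by
        ext m
        simp only [deriv_apply, add_apply, map_add, LinearMap.add_apply, map_update_add,
          Finset.sum_add_distrib]
      map_smul' := fun c v ↦ by
        ext m
        simp only [deriv_apply, smul_apply, map_smul, LinearMap.smul_apply, map_update_smul,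
          Finset.smul_sum, RingHom.id_apply] }

theorem contractForm_apply (f : V [⋀^Fin (n + 1)]→ₗ[ℝ] ℝ) (T : V →ₗ[ℝ] V →ₗ[ℝ] V)
    (m : Fin (n + 2) → V) : f.contractForm T m =
      ∑ i : Fin (n + 2), (-1) ^ (i : ℕ) * f.deriv (T (m i)) (i.removeNth m) := by
  rw [contractForm, alternatizeUncurryFin_apply]
  simp only [zsmul_eq_mul, Int.cast_pow, Int.cast_neg, Int.cast_one]
  rfl

/-- For antisymmetric T the difference T(m_i, m_j) - T(m_j, m_i) is 2 T(m_i, m_j), which accounts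
for the factor. -/
theorem contractForm_eq (f : V [⋀^Fin (n + 1)]→ₗ[ℝ] ℝ) {T : V →ₗ[ℝ] V →ₗ[ℝ] V}
    (hT : ∀ v v', T v v' = - T v' v) (m : Fin (n + 2) → V) : f.contractForm T m =
      2 * ∑ i : Fin (n + 1), ∑ j ∈ Finset.Ici i, (-1) ^ ((i : ℕ) + (j : ℕ)) *
        f (Matrix.vecCons (T (m i.castSucc) (m j.succ))
          (j.removeNth (i.castSucc.removeNth m))) := by
  rw [contractForm_apply]
  simp only [deriv_apply]
  refine (sum_deriv_removeNth f m fun i k ↦ T (m i) (m k)).trans ?_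
  simp only [Finset.mul_sum]
  refine Fintype.sum_congr _ _ fun i ↦ Finset.sum_congr rfl fun j hj ↦ ?_
  rw [hT (m j.succ), sub_neg_eq_add, ← two_smul ℝ]
  have h := f.map_update_smul (Matrix.vecCons (0 : V) (j.removeNth (i.castSucc.removeNth m))) 0
    (2 : ℝ) (T (m i.castSucc) (m j.succ))
  have e : ∀ v : V, Function.update (Matrix.vecCons (0 : V) (j.removeNth (i.castSucc.removeNth m)))
      0 v = Matrix.vecCons v (j.removeNth (i.castSucc.removeNth m)) := fun v ↦
    Fin.update_cons_zero _ _ _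
  rw [e, e] at h
  rw [h, smul_eq_mul]
  ring

/-- The term i = 0 is the derivation by T(w, ·). In the other terms w remains an argument of f
unless it is replaced by T(m_i, w) = -T(w, m_i); brought back to its place, this yields the same
derivation once more, whence the factor 2. -/
theorem contractForm_cons {W : Submodule ℝ V} {f : V [⋀^Fin (n + 1)]→ₗ[ℝ] ℝ}
    (hf : ∀ m, (∃ i, m i ∈ W) → f m = 0) {T : V →ₗ[ℝ] V →ₗ[ℝ] V} (hT : ∀ v v', T v v' = - T v' v)
    {w : V} (hw : w ∈ W) (m : Fin (n + 1) → V) :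
    f.contractForm T (Matrix.vecCons w m) = 2 * f.deriv (T w) m := by
  rw [contractForm_apply, Fin.sum_univ_succ, two_mul]
  congr 1
  · simp
  · rw [deriv_apply]
    refine Fintype.sum_congr _ _ fun i ↦ ?_
    have h1 : i.succ.removeNth (Matrix.vecCons w m) =
        (Fin.cons w (i.removeNth m) : Fin (n + 1) → V) := by
      funext k
      refine Fin.cases ?_ (fun k ↦ ?_) k
      · simp [Fin.removeNth]
      · simp [Fin.removeNth, Fin.succ_succAbove_succ]
    rw [h1, deriv_apply, Finset.sum_eq_single 0]
    · rw [Fin.update_cons_zero, ← Fin.insertNth_removeNth, map_insertNth, Matrix.cons_val_succ,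
        Fin.cons_zero, hT w]
      have h := f.map_update_neg (Matrix.vecCons (0 : V) (i.removeNth m)) 0 (T (m i) w)
      have e : ∀ v : V, Function.update (Matrix.vecCons (0 : V) (i.removeNth m)) 0 v =
          Matrix.vecCons v (i.removeNth m) := fun v ↦ Fin.update_cons_zero _ _ _
      rw [e, e] at h
      rw [h, smul_neg, Fin.val_succ, pow_succ]
      simp
      rfl
    · intro k _ hk
      exact hf _ ⟨0, by rw [Function.update_of_ne hk.symm]; exact hw⟩
    · simp

end AlternatingMap


/-! ### Horizontal top forms and torsions without trace -/

namespace GalileanModel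

variable {p D : ℕ} {S : GalileanModel p D}

namespace AdaptedBasis

section

variable {ι κ : Type*} [DecidableEq ι] [DecidableEq κ]
  [Fintype ι] [Fintype κ] (b : S.AdaptedBasis ι κ)

theorem map_update_u {Ω₀ : RVec D [⋀^κ]→ₗ[ℝ] ℝ}
    (hΩ₀W : ∀ m : κ → RVec D, (∃ i, m i ∈ S.W) → Ω₀ m = 0) (a : κ) (v : RVec D) :
    Ω₀ (Function.update b.u a v) = b.coordU v a * Ω₀ b.u := by
  have h1 := MultilinearMap.eq_of_forall_sub_mem Ω₀.toMultilinearMap hΩ₀W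
    (m := Function.update b.u a v)
    (m' := Function.update b.u a (∑ c, b.coordU v c • b.u c)) fun i ↦ by
      rcases eq_or_ne i a with rfl | h
      · simpa using b.sub_sum_coordU_mem v
      · simp [h]
  refine h1.trans ((Ω₀.map_update_sum _ _ _ _).trans ?_)
  simp only [AlternatingMap.map_update_smul]
  rw [Finset.sum_eq_single a]
  · simp
  · intro c _ hc
    rw [Ω₀.map_eq_zero_of_eq _ (i := a) (j := c) (by simp [hc]) hc.symm, smul_zero]
  · simp

/-- On a top form of V/W a derivation acts as multiplication by a trace: replacing one u_a by its
image retains only the diagonal component. -/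
theorem deriv_u {Ω₀ : RVec D [⋀^κ]→ₗ[ℝ] ℝ}
    (hΩ₀W : ∀ m : κ → RVec D, (∃ i, m i ∈ S.W) → Ω₀ m = 0) (A : End ℝ (RVec D)) :
    Ω₀.deriv A b.u = (∑ a, (b.δ a)⁻¹ * S.η (A (b.u a)) (b.u a)) * Ω₀ b.u := by
  rw [AlternatingMap.deriv_apply, Finset.sum_mul]
  exact Finset.sum_congr rfl fun a _ ↦ b.map_update_u hΩ₀W a _

end

end AdaptedBasis

theorem deriv_eq_zero_of_mem {κ : Type*} [DecidableEq κ] [Fintype κ] {Ω₀ : RVec D [⋀^κ]→ₗ[ℝ] ℝ}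
    (hΩ₀W : ∀ m : κ → RVec D, (∃ i, m i ∈ S.W) → Ω₀ m = 0) {A : End ℝ (RVec D)}
    (hA : ∀ w ∈ S.W, A w ∈ S.W) (m : κ → RVec D) (hm : ∃ i, m i ∈ S.W) : Ω₀.deriv A m = 0 := by
  obtain ⟨i, hi⟩ := hm
  rw [AlternatingMap.deriv_apply]
  refine Finset.sum_eq_zero fun k _ ↦ hΩ₀W _ ⟨i, ?_⟩
  rcases eq_or_ne i k with rfl | h
  · simpa using hA _ hi
  · simpa [h] using hi

theorem deriv_eq_zero {κ : Type*} [DecidableEq κ] [Fintype κ] {ι : Type*} [DecidableEq ι]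
    [Fintype ι] (b : S.AdaptedBasis ι κ) {Ω₀ : RVec D [⋀^κ]→ₗ[ℝ] ℝ}
    (hΩ₀W : ∀ m : κ → RVec D, (∃ i, m i ∈ S.W) → Ω₀ m = 0) {A : End ℝ (RVec D)}
    (hA : ∀ w ∈ S.W, A w ∈ S.W) (htr : ∑ a, (b.δ a)⁻¹ * S.η (A (b.u a)) (b.u a) = 0)
    (m : κ → RVec D) : Ω₀.deriv A m = 0 := by
  rw [b.alternating_eq_det (deriv_eq_zero_of_mem hΩ₀W hA) m, b.deriv_u hΩ₀W, htr, zero_mul,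
    zero_mul]

/-- Forms which are horizontal for `W` are infinitesimally invariant. -/
theorem deriv_eq_zero_of_mem_lieAlg {Ω₀ : RVec D [⋀^Fin (p + 1)]→ₗ[ℝ] ℝ}
    (hΩ₀W : ∀ m : Fin (p + 1) → RVec D, (∃ i, m i ∈ S.W) → Ω₀ m = 0) {A : End ℝ (RVec D)}
    (hA : A ∈ S.lieAlg) (m : Fin (p + 1) → RVec D) : Ω₀.deriv A m = 0 := by
  obtain ⟨b⟩ := S.exists_adaptedBasis
  refine deriv_eq_zero b hΩ₀W (fun w hw ↦ lieAlg_mem_W hA hw) (Finset.sum_eq_zero fun a _ ↦ ?_) m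
  have := hA.1 (b.u a) (b.u a)
  rw [S.η_symm (b.u a)] at this
  rw [show S.η (A (b.u a)) (b.u a) = 0 by linarith, mul_zero]

theorem continuous_of_horizontal {Ω₀ : RVec D [⋀^Fin (p + 1)]→ₗ[ℝ] ℝ}
    (hΩ₀W : ∀ m : Fin (p + 1) → RVec D, (∃ i, m i ∈ S.W) → Ω₀ m = 0) : Continuous Ω₀ := by
  obtain ⟨b⟩ := S.exists_adaptedBasis
  have h : (Ω₀ : (Fin (p + 1) → RVec D) → ℝ) = fun m ↦
      Ω₀ b.u * Matrix.det (Matrix.of fun i ↦ b.coordU (m i)) :=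
    funext fun m ↦ b.alternating_eq_det hΩ₀W m
  rw [h]
  refine continuous_const.mul (Continuous.matrix_det (continuous_pi fun i ↦ continuous_pi fun a ↦ ?_))
  refine continuous_const.mul ?_
  exact (LinearMap.toContinuousLinearMap (LinearMap.flip S.η (b.u a))).continuous.comp
    (continuous_apply i)

/-- The contraction with w ∈ W as an argument is twice the derivation of Ω₀ by T(w, ·). The
vanishing of these derivations says both that T(w, ·) preserves W and that its trace on V/W is zero.
Once they vanish, the contraction is a horizontal form whose degree exceeds dim V/W, hence zero. -/
theorem mem_torsZero_iff_contractForm {Ω₀ : RVec D [⋀^Fin (p + 1)]→ₗ[ℝ] ℝ} (hΩ₀ : Ω₀ ≠ 0)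
    (hΩ₀W : ∀ m : Fin (p + 1) → RVec D, (∃ i, m i ∈ S.W) → Ω₀ m = 0) {T : Tors D} :
    T ∈ S.torsZero ↔ Ω₀.contractForm (torsBilin T) = 0 := by
  obtain ⟨b⟩ := S.exists_adaptedBasis
  have hu : Ω₀ b.u ≠ 0 := by
    intro h
    refine hΩ₀ (AlternatingMap.ext fun m ↦ ?_)
    rw [b.alternating_eq_det hΩ₀W, h, zero_mul]
    rfl
  constructor
  · intro hT
    have hinv : ∀ w ∈ S.W, ∀ w' ∈ S.W, torsBilin T w w' ∈ S.W := hT.1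
    have h1 : ∀ w ∈ S.W, ∀ m, Ω₀.deriv (torsBilin T w) m = 0 := by
      intro w hw
      refine deriv_eq_zero b hΩ₀W (hinv w hw) ?_
      rw [← b.trace_contract T w (hinv w hw)]
      exact hT.2 w hw
    have h2 : ∀ m, (∃ i, m i ∈ S.W) → Ω₀.contractForm (torsBilin T) m = 0 := by
      have h0 : ∀ m : Fin (p + 2) → RVec D, m 0 ∈ S.W → Ω₀.contractForm (torsBilin T) m = 0 := by
        intro m hm
        rw [← Fin.cons_self_tail m]
        exact (AlternatingMap.contractForm_cons hΩ₀W (torsBilin_swap T) hm _).trans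
          (by rw [h1 _ hm, mul_zero])
      rintro m ⟨i, hi⟩
      rcases eq_or_ne i 0 with rfl | h
      · exact h0 m hi
      · have := AlternatingMap.map_swap (Ω₀.contractForm (torsBilin T)) m h
        rw [h0 _ (by simpa using hi)] at this
        linarith
    refine AlternatingMap.ext fun m ↦ ?_
    have h3 := MultilinearMap.eq_of_forall_sub_mem (Ω₀.contractForm (torsBilin T)).toMultilinearMap
      h2 (m := m) fun i ↦ b.sub_sum_coordU_mem (m i)
    -- There are p + 2 arguments, but their coordinates modulo W lie in a space of dimension p + 1.
    refine h3.trans (AlternatingMap.map_linearDependent _ _ fun hli ↦ ?_)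
    have h4 := (LinearIndependent.of_comp (Fintype.linearCombination ℝ b.u)
      (v := fun i ↦ b.coordU (m i)) hli).fintype_card_le_finrank
    simp at h4
  · intro h
    have h1 : ∀ w ∈ S.W, ∀ m, Ω₀.deriv (torsBilin T w) m = 0 := by
      intro w hw m
      have := AlternatingMap.contractForm_cons hΩ₀W (torsBilin_swap T) hw m
      rw [h] at this
      change (0 : ℝ) = _ at this
      linarith
    have hinv : T ∈ S.torsInv := by
      intro w hw w' hw'
      change torsBilin T w w' ∈ S.W
      rw [b.mem_W_iff]
      intro a
      -- With w' in slot `a`, every term of the derivation still contains w' except the one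
      -- replacing it by T(w, w'). The result is the `a`-th component of T(w, w') times Ω₀(u).
      have h2 := h1 w hw (Function.update b.u a w')
      rw [AlternatingMap.deriv_apply, Finset.sum_eq_single a, Function.update_idem,
        Function.update_self, b.map_update_u hΩ₀W] at h2
      · have := (mul_eq_zero.1 h2).resolve_right hu
        exact (mul_eq_zero.1 this).resolve_left (inv_ne_zero (b.δ_ne a))
      · intro k _ hk
        exact hΩ₀W _ ⟨a, by rw [Function.update_of_ne hk.symm]; simpa using hw'⟩
      · simp
    refine ⟨hinv, fun w hw ↦ (b.trace_contract T w _).trans ?_⟩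
    have h2 := h1 w hw b.u
    rw [b.deriv_u hΩ₀W] at h2
    exact (mul_eq_zero.1 h2).resolve_right hu

end GalileanModel

/-! ### The exterior derivative of the characteristic form -/

section ExteriorDerivative

open GalileanModel

variable {p D : ℕ} {M : Type*} [TopologicalSpace M] [ChartedSpace (RVec D) M]

theorem mvfderiv_alternating {n : ℕ} {Ω₀ : RVec D [⋀^Fin n]→ₗ[ℝ] ℝ} (hc : Continuous Ω₀)
    {f : Fin n → M → RVec D} {x : M} (hf : ∀ i, ContMDiffAt (𝓡 D) 𝓘(ℝ, RVec D) ∞ (f i) x)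
    (X : TangentSpace (𝓡 D) x) : mvfderiv (𝓡 D) (fun y ↦ Ω₀ fun i ↦ f i y) x X =
      ∑ k, Ω₀ (Function.update (fun i ↦ f i x) k (mvfderiv (𝓡 D) (f k) x X)) := by
  let Ω : ContinuousMultilinearMap ℝ (fun _ : Fin n ↦ RVec D) ℝ := ⟨Ω₀.toMultilinearMap, hc⟩
  have hF : MDifferentiableAt (𝓡 D) 𝓘(ℝ, Fin n → RVec D) (fun y i ↦ f i y) x :=
    (contMDiffAt_pi_space.2 hf).mdifferentiableAt (by simp)
  have h1 := mvfderiv_comp_of_hasFDerivAt (Ω.hasFDerivAt (x := fun i ↦ f i x)) hF X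
  refine h1.trans ?_
  rw [ContinuousMultilinearMap.linearDeriv_apply]
  refine Finset.sum_congr rfl fun k _ ↦ ?_
  have h2 := mvfderiv_clm_comp (ContinuousLinearMap.proj (R := ℝ) (φ := fun _ ↦ RVec D) k) hF X
  exact congrArg (fun v ↦ Ω₀ (Function.update (fun i ↦ f i x) k v)) h2.symm

variable [IsManifold (𝓡 D) ∞ M]

namespace GStructure

variable {S : GalileanModel p D} {P : GStructure S M}
  {cov : CovariantDerivative (𝓡 D) (RVec D) (TangentSpace (𝓡 D) : M → Type _)}

/-- The exterior derivative of the characteristic form in terms of torsion. -/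
theorem IsAdapted.two_mul_dΩ_eq (hcov : P.IsAdapted cov) {Ω₀ : RVec D [⋀^Fin (p + 1)]→ₗ[ℝ] ℝ}
    (hΩ₀W : ∀ m : Fin (p + 1) → RVec D, (∃ i, m i ∈ S.W) → Ω₀ m = 0)
    {X : Fin (p + 2) → ∀ x : M, TangentSpace (𝓡 D) x} (hX : ∀ i, IsSmoothVF (X i)) {x : M}
    {u : RVec D ≃L[ℝ] TangentSpace (𝓡 D) x} (hu : u ∈ P.frames x) : 2 * P.dΩ Ω₀ X x =
      Ω₀.contractForm (torsBilin (torsionAt cov x u)) fun i ↦ u.symm (X i x) := by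
  obtain ⟨U, s, hx, hs, rfl⟩ := P.exists_section_eq hu
  obtain ⟨A, hA, hbr⟩ := hcov.exists_symm_mlieBracket_eq hs hx
  rw [AlternatingMap.contractForm_eq _ (torsBilin_swap _)]
  congr 1
  set m : Fin (p + 2) → RVec D := fun i ↦ (s x).symm (X i x) with hm
  have hf : ∀ i, ContMDiffAt (𝓡 D) 𝓘(ℝ, RVec D) ∞ (fun y ↦ (s y).symm (X i y)) x := fun i ↦
    hs.contMDiffAt_symm hx (hX i).contMDiffAt
  -- The components of ∇_{X_i} X_k.
  let B : Fin (p + 2) → Fin (p + 2) → RVec D := fun i k ↦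
    mvfderiv (𝓡 D) (fun y ↦ (s y).symm (X k y)) x (X i x) + A (X i x) (m k)
  have h1 : ∀ i : Fin (p + 2), mvfderiv (𝓡 D) (fun y ↦ P.Ω Ω₀ y (i.removeNth fun k ↦ X k y)) x
      (X i x) = ∑ k, Ω₀ (Function.update (i.removeNth m) k (B i (i.succAbove k))) := by
    intro i
    have e : (fun y ↦ P.Ω Ω₀ y (i.removeNth fun k ↦ X k y)) =ᶠ[nhds x]
        fun y ↦ Ω₀ fun k ↦ (s y).symm (X (i.succAbove k) y) := by
      filter_upwards [hs.isOpen.mem_nhds hx] with y hy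
      exact Ω_eq hΩ₀W (hs.mem y hy) _
    rw [mvfderiv_congr e, mvfderiv_alternating (continuous_of_horizontal hΩ₀W)
      (f := fun k y ↦ (s y).symm (X (i.succAbove k) y)) fun k ↦ hf _]
    -- Ω₀ is annihilated by 𝔤, so the connection terms may be added to the derivatives for free. The
    -- covariant derivatives then cancel against those in the brackets, and only the torsion
    -- remains.
    have h2 := deriv_eq_zero_of_mem_lieAlg hΩ₀W (hA (X i x)) (i.removeNth m)
    rw [AlternatingMap.deriv_apply] at h2
    rw [← add_zero (∑ k, _), ← h2, ← Finset.sum_add_distrib]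
    refine Finset.sum_congr rfl fun k _ ↦ ?_
    exact (Ω₀.map_update_add (i.removeNth m) k _ _).symm
  have h2 : ∀ i j : Fin (p + 1), P.Ω Ω₀ x (Matrix.vecCons
      (VectorField.mlieBracket (𝓡 D) (X i.castSucc) (X j.succ) x)
      (j.removeNth (i.castSucc.removeNth fun k ↦ X k x))) =
      Ω₀ (Matrix.vecCons (B i.castSucc j.succ - B j.succ i.castSucc)
        (j.removeNth (i.castSucc.removeNth m))) -
      Ω₀ (Matrix.vecCons (torsBilin (torsionAt cov x (s x)) (m i.castSucc) (m j.succ))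
        (j.removeNth (i.castSucc.removeNth m))) := by
    intro i j
    rw [Ω_eq hΩ₀W hu]
    have e : ∀ v : RVec D, Function.update (Matrix.vecCons (0 : RVec D)
        (j.removeNth (i.castSucc.removeNth m))) 0 v =
        Matrix.vecCons v (j.removeNth (i.castSucc.removeNth m)) := fun v ↦ Fin.update_cons_zero _ _ _
    have h3 := Ω₀.map_update_sub (Matrix.vecCons (0 : RVec D)
      (j.removeNth (i.castSucc.removeNth m))) 0 (B i.castSucc j.succ - B j.succ i.castSucc)
      (torsBilin (torsionAt cov x (s x)) (m i.castSucc) (m j.succ))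
    rw [e, e, e] at h3
    rw [← h3]
    congr 1
    funext k
    refine Fin.cases ?_ (fun k ↦ ?_) k
    · exact hbr _ _ (hX _).contMDiffAt (hX _).contMDiffAt
    · rfl
  rw [dΩ]
  simp only [h1, h2]
  rw [AlternatingMap.sum_deriv_removeNth, ← Finset.sum_sub_distrib]
  refine Finset.sum_congr rfl fun i _ ↦ ?_
  rw [← Finset.sum_sub_distrib]
  refine Finset.sum_congr rfl fun j _ ↦ ?_
  ring

/-- The intrinsic torsion lies in the fourth submodule if and only if the characteristic form is
closed. -/
theorem IsAdapted.intrinsicTorsionIn_torsZero_iff [T2Space M] (hcov : P.IsAdapted cov)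
    {Ω₀ : RVec D [⋀^Fin (p + 1)]→ₗ[ℝ] ℝ} (hΩ₀ : Ω₀ ≠ 0)
    (hΩ₀W : ∀ m : Fin (p + 1) → RVec D, (∃ i, m i ∈ S.W) → Ω₀ m = 0) :
    P.IntrinsicTorsionIn cov (S.torsZero.map (LinearMap.range S.spencer).mkQ) ↔
      ∀ X : Fin (p + 2) → ∀ x : M, TangentSpace (𝓡 D) x, (∀ i, IsSmoothVF (X i)) →
        ∀ x, P.dΩ Ω₀ X x = 0 := by
  rw [intrinsicTorsionIn_map_iff AdaptedBasis.range_spencer_le_torsZero]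
  constructor
  · intro h X hX x
    have h1 := hcov.two_mul_dΩ_eq hΩ₀W hX (P.frame_mem x)
    rw [(mem_torsZero_iff_contractForm hΩ₀ hΩ₀W).1 (h x _ (P.frame_mem x))] at h1
    exact (mul_eq_zero.1 h1).resolve_left two_ne_zero
  · intro h x u hu
    refine (mem_torsZero_iff_contractForm hΩ₀ hΩ₀W).2 (AlternatingMap.ext fun m ↦ ?_)
    choose X hX hXx using fun i ↦ P.exists_smoothVF_eq (u (m i))
    have h1 := hcov.two_mul_dΩ_eq hΩ₀W hX hu
    rw [h X hX x, mul_zero] at h1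
    simp only [hXx, ContinuousLinearEquiv.symm_apply_apply] at h1
    exact h1.symm

end GStructure

end ExteriorDerivative

/-! ### The smooth inverse function theorem and superposition operators -/

/-- The inverse function theorem for smooth maps, on a neighbourhood. -/
theorem ContDiffOn.exists_openPartialHomeomorph {E F : Type*} [NormedAddCommGroup E]
    [NormedSpace ℝ E] [NormedAddCommGroup F] [NormedSpace ℝ F] [CompleteSpace E]
    {f : E → F} {O : Set E} (hO : IsOpen O) (hf : ContDiffOn ℝ ∞ f O) {a : E} (ha : a ∈ O)
    {f' : E ≃L[ℝ] F} (hf' : HasFDerivAt f (f' : E →L[ℝ] F) a) :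
    ∃ e : OpenPartialHomeomorph E F, a ∈ e.source ∧ e.source ⊆ O ∧ (e : E → F) = f ∧
      ContDiffOn ℝ ∞ e.symm e.target ∧
      ∀ z ∈ e.source, ∃ g : E ≃L[ℝ] F, HasFDerivAt f (g : E →L[ℝ] F) z := by
  have hfa : ∀ z ∈ O, ContDiffAt ℝ ∞ f z := fun z hz ↦ (hf z hz).contDiffAt (hO.mem_nhds hz)
  let e₀ := (hfa a ha).toOpenPartialHomeomorph f hf' (by simp)
  let R : Set (E →L[ℝ] F) := Set.range ((↑) : (E ≃L[ℝ] F) → E →L[ℝ] F)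
  have hR : IsOpen R := ContinuousLinearEquiv.isOpen
  have hcont : ContinuousOn (fderiv ℝ f) O := hf.continuousOn_fderiv_of_isOpen hO (by simp)
  -- Restricting to the points where the derivative is invertible makes the inverse smooth on the
  -- whole target, not only at the image of `a`.
  have hO' : IsOpen (O ∩ fderiv ℝ f ⁻¹' R) := hcont.isOpen_inter_preimage hO hR
  let e := e₀.restrOpen _ hO'
  have hes : e.source = e₀.source ∩ (O ∩ fderiv ℝ f ⁻¹' R) := e₀.restrOpen_source _ hO'
  have hinv : ∀ z ∈ e.source, ∃ g : E ≃L[ℝ] F, HasFDerivAt f (g : E →L[ℝ] F) z := by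
    intro z hz
    rw [hes] at hz
    obtain ⟨g, hg⟩ := hz.2.2
    refine ⟨g, ?_⟩
    rw [hg]
    exact ((hfa z hz.2.1).differentiableAt (by simp)).hasFDerivAt
  have hef : (e : E → F) = f := rfl
  refine ⟨e, ?_, ?_, hef, ?_, hinv⟩
  · rw [hes]
    exact ⟨(hfa a ha).mem_toOpenPartialHomeomorph_source hf' _, ha, f', hf'.fderiv.symm⟩
  · rw [hes]
    exact fun z hz ↦ hz.2.1
  · intro y hy
    have hy' := e.map_target hy
    obtain ⟨g, hg⟩ := hinv _ hy'
    rw [hes] at hy'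
    exact (e.contDiffAt_symm hy (by rw [hef]; exact hg)
      (by rw [hef]; exact hfa _ hy'.2.1)).contDiffWithinAt

namespace ContinuousMap

section Superposition

universe u

variable {K : Type*} [TopologicalSpace K] [CompactSpace K]

/-- The pointwise application of a continuous family of linear maps. -/
def applyL (E F : Type*) [NormedAddCommGroup E] [NormedSpace ℝ E] [NormedAddCommGroup F]
    [NormedSpace ℝ F] : C(K, E →L[ℝ] F) →L[ℝ] C(K, E) →L[ℝ] C(K, F) :=
  LinearMap.mkContinuous₂
    (LinearMap.mk₂ ℝ (fun (L : C(K, E →L[ℝ] F)) (u : C(K, E)) ↦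
      (⟨fun t ↦ L t (u t), by fun_prop⟩ : C(K, F)))
      (fun _ _ _ ↦ by ext; simp) (fun _ _ _ ↦ by ext; simp) (fun _ _ _ ↦ by ext; simp)
      (fun _ _ _ ↦ by ext; simp)) 1 fun L u ↦ by
    rw [one_mul]
    refine (ContinuousMap.norm_le _ (by positivity)).2 fun t ↦ ?_
    exact ((L t).le_opNorm _).trans (mul_le_mul (L.norm_coe_le_norm t) (u.norm_coe_le_norm t)
      (norm_nonneg _) (by positivity))

variable {E F : Type*} [NormedAddCommGroup E] [NormedSpace ℝ E] [NormedAddCommGroup F]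
    [NormedSpace ℝ F]

theorem applyL_apply (L : C(K, E →L[ℝ] F)) (u : C(K, E)) (t : K) :
    applyL E F L u t = L t (u t) := rfl

/-- The superposition operator `u ↦ f ∘ u`. -/
def superpose (f : E → F) (hf : ContDiff ℝ ∞ f) (u : C(K, E)) : C(K, F) :=
  (⟨f, hf.continuous⟩ : C(E, F)).comp u

theorem contDiff_fderiv {f : E → F} (hf : ContDiff ℝ ∞ f) : ContDiff ℝ ∞ (fderiv ℝ f) :=
  hf.fderiv_right (by simp)

/-- The range of u is compact, so the derivative of f is uniformly continuous near it; the mean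
value inequality then bounds the remainder uniformly in t. -/
theorem hasFDerivAt_superpose {f : E → F} (hf : ContDiff ℝ ∞ f) (u : C(K, E)) :
    HasFDerivAt (superpose (K := K) f hf)
      (applyL E F (superpose (fderiv ℝ f) (contDiff_fderiv hf) u)) u := by
  rw [hasFDerivAt_iff_isLittleO_nhds_zero, Asymptotics.isLittleO_iff]
  intro ε hε
  have hK : IsCompact (Set.range u) := isCompact_range u.continuous
  have h1 := hK.uniformContinuousAt_of_continuousAt (fderiv ℝ f)
    (fun x _ ↦ (contDiff_fderiv hf).continuous.continuousAt) (Metric.dist_mem_uniformity hε)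
  obtain ⟨δ, hδ, h2⟩ := Metric.mem_uniformity_dist.1 h1
  filter_upwards [Metric.ball_mem_nhds (0 : C(K, E)) hδ] with h hh
  rw [mem_ball_zero_iff] at hh
  refine (ContinuousMap.norm_le _ (by positivity)).2 fun t ↦ ?_
  have hht : ‖h t‖ ≤ ‖h‖ := h.norm_coe_le_norm t
  have h3 := (convex_ball (u t) δ).norm_image_sub_le_of_norm_fderiv_le' (𝕜 := ℝ) (f := f)
    (φ := fderiv ℝ f (u t)) (C := ε) (x := u t) (y := u t + h t)
    (fun x _ ↦ (hf.differentiable (by simp)).differentiableAt) (fun x hx ↦ by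
      have := h2 (a := u t) (b := x) (by rw [dist_comm]; exact hx) ⟨t, rfl⟩
      rw [← dist_eq_norm, dist_comm]
      exact this.le) (Metric.mem_ball_self hδ)
      (by rw [Metric.mem_ball, dist_eq_norm, add_sub_cancel_left]; exact hht.trans_lt hh)
  rw [add_sub_cancel_left] at h3
  exact h3.trans (mul_le_mul_of_nonneg_left hht hε.le)

/-- The derivative is the superposition with `fderiv ℝ f` followed by the continuous linear map
`applyL`, so smoothness follows by induction. The target space changes in each step to a space of
linear maps, hence the quantification over spaces in one universe. -/
theorem contDiff_superpose_nat (n : ℕ) : ∀ {F : Type u} [NormedAddCommGroup F]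
    [NormedSpace ℝ F] {E : Type u} [NormedAddCommGroup E] [NormedSpace ℝ E] {f : E → F}
    (hf : ContDiff ℝ ∞ f), ContDiff ℝ n (superpose (K := K) f hf) := by
  induction n with
  | zero =>
    intro F _ _ E _ _ f hf
    exact contDiff_zero.2 (continuous_iff_continuousAt.2 fun u ↦
      (hasFDerivAt_superpose hf u).continuousAt)
  | succ n ih =>
    intro F _ _ E _ _ f hf
    refine contDiff_succ_iff_hasFDerivAt.2 ⟨_, ?_, hasFDerivAt_superpose hf⟩
    exact (applyL E F).contDiff.comp (ih (contDiff_fderiv hf))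

theorem contDiff_superpose {F : Type u} [NormedAddCommGroup F] [NormedSpace ℝ F] {E : Type u}
    [NormedAddCommGroup E] [NormedSpace ℝ E] {f : E → F} (hf : ContDiff ℝ ∞ f) :
    ContDiff ℝ ∞ (superpose (K := K) f hf) :=
  contDiff_infty.2 fun n ↦ contDiff_superpose_nat n hf

end Superposition

end ContinuousMap

/-! ### Smooth solutions of a radial differential equation -/

section Primitive

variable {Y : Type*} [NormedAddCommGroup Y] [NormedSpace ℝ Y]

omit [NormedSpace ℝ Y] in
theorem continuous_IccExtend (u : C(unitInterval, Y)) :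
    Continuous (Set.IccExtend (zero_le_one (α := ℝ)) u) := u.continuous.Icc_extend'

/-- The primitive vanishing at `0`. -/
def primitive (Y : Type*) [NormedAddCommGroup Y] [NormedSpace ℝ Y] :
    C(unitInterval, Y) →L[ℝ] C(unitInterval, Y) :=
  LinearMap.mkContinuous
    { toFun := fun u ↦ ⟨fun t ↦ ∫ s in (0 : ℝ)..t, Set.IccExtend (zero_le_one (α := ℝ)) u s,
        (intervalIntegral.continuous_primitive
          (fun a b ↦ (continuous_IccExtend u).intervalIntegrable a b) 0).comp
          continuous_subtype_val⟩
      map_add' := fun u v ↦ by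
        ext t
        exact intervalIntegral.integral_add ((continuous_IccExtend u).intervalIntegrable _ _)
          ((continuous_IccExtend v).intervalIntegrable _ _)
      map_smul' := fun c u ↦ by
        ext t
        exact intervalIntegral.integral_smul c _ } 1 fun u ↦ by
    rw [one_mul]
    refine (ContinuousMap.norm_le _ (norm_nonneg _)).2 fun t ↦ ?_
    have h := intervalIntegral.norm_integral_le_of_norm_le_const (a := 0) (b := (t : ℝ))
      (f := Set.IccExtend (zero_le_one (α := ℝ)) u) (C := ‖u‖) fun s _ ↦ u.norm_coe_le_norm _
    refine h.trans ?_
    rw [sub_zero, abs_of_nonneg t.2.1]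
    exact mul_le_of_le_one_right (norm_nonneg _) t.2.2

theorem primitive_apply (u : C(unitInterval, Y)) (t : unitInterval) :
    primitive Y u t = ∫ s in (0 : ℝ)..t, Set.IccExtend (zero_le_one (α := ℝ)) u s := rfl

end Primitive

section RadialODE

universe u

variable {X Y : Type u} [NormedAddCommGroup X] [NormedSpace ℝ X] [NormedAddCommGroup Y]
  [NormedSpace ℝ Y]

/-- The linear part of `(ξ, y, u) ↦ (t ↦ (x₀ + t ξ, u(t), ξ))`. -/
def radialPathL (X Y : Type*) [NormedAddCommGroup X] [NormedSpace ℝ X] [NormedAddCommGroup Y]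
    [NormedSpace ℝ Y] : ((X × Y) × C(unitInterval, Y)) →L[ℝ] C(unitInterval, (X × Y) × X) :=
  LinearMap.mkContinuous
    { toFun := fun w ↦ ⟨fun t ↦ (((t : ℝ) • w.1.1, w.2 t), w.1.1), by fun_prop⟩
      map_add' := fun w w' ↦ by ext t <;> simp
      map_smul' := fun c w ↦ by ext t <;> simp [smul_comm c] } 1 fun w ↦ by
    rw [one_mul]
    refine (ContinuousMap.norm_le _ (norm_nonneg _)).2 fun t ↦ ?_
    have h1 : ‖w.1.1‖ ≤ ‖w‖ := (norm_fst_le w.1).trans (norm_fst_le w)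
    have h2 : ‖w.2 t‖ ≤ ‖w‖ := (w.2.norm_coe_le_norm t).trans (norm_snd_le w)
    refine max_le (max_le ?_ h2) h1
    change ‖(t : ℝ) • w.1.1‖ ≤ ‖w‖
    rw [norm_smul, Real.norm_of_nonneg t.2.1]
    exact (mul_le_of_le_one_left (norm_nonneg _) t.2.2).trans h1

/-- The path `t ↦ (x₀ + t ξ, u(t), ξ)`. -/
def radialPath (x₀ : X) (w : (X × Y) × C(unitInterval, Y)) : C(unitInterval, (X × Y) × X) :=
  ContinuousMap.const _ ((x₀, 0), 0) + radialPathL X Y w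

theorem radialPath_apply (x₀ : X) (w : (X × Y) × C(unitInterval, Y)) (t : unitInterval) :
    radialPath x₀ w t = ((x₀ + (t : ℝ) • w.1.1, w.2 t), w.1.1) := by
  ext <;> simp [radialPath, radialPathL]

theorem hasFDerivAt_radialPath (x₀ : X) (w : (X × Y) × C(unitInterval, Y)) :
    HasFDerivAt (radialPath x₀) (radialPathL X Y) w :=
  (radialPathL X Y).hasFDerivAt.const_add _

variable {A : X × Y → X →L[ℝ] Y}

theorem contDiff_eval_fst (hA : ContDiff ℝ ∞ A) :
    ContDiff ℝ ∞ fun q : (X × Y) × X ↦ A q.1 q.2 :=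
  (hA.comp contDiff_fst).clm_apply contDiff_snd

theorem fderiv_eval_fst (hA : ContDiff ℝ ∞ A) (q r : (X × Y) × X) :
    fderiv ℝ (fun q : (X × Y) × X ↦ A q.1 q.2) q r = fderiv ℝ A q.1 r.1 q.2 + A q.1 r.2 := by
  have h1 : HasFDerivAt A (fderiv ℝ A q.1) q.1 :=
    ((hA.differentiable (by simp)).differentiableAt).hasFDerivAt
  have h2 := (h1.comp q (hasFDerivAt_fst (p := q))).clm_apply (hasFDerivAt_snd (p := q))
  have h3 : fderiv ℝ (fun q : (X × Y) × X ↦ A q.1 q.2) q = _ := h2.fderiv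
  rw [h3]
  simp [add_comm]

/-- The right hand side of the integral equation. -/
def radialRHS (hA : ContDiff ℝ ∞ A) (x₀ : X) (w : (X × Y) × C(unitInterval, Y)) :
    C(unitInterval, Y) :=
  ContinuousMap.const _ w.1.2 +
    primitive Y (ContinuousMap.superpose _ (contDiff_eval_fst hA) (radialPath x₀ w))

/-- Constant functions. -/
def constL (Y : Type*) [NormedAddCommGroup Y] [NormedSpace ℝ Y] : Y →L[ℝ] C(unitInterval, Y) :=
  LinearMap.mkContinuous
    { toFun := ContinuousMap.const _
      map_add' := fun _ _ ↦ rfl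
      map_smul' := fun _ _ ↦ rfl } 1 fun y ↦ by
    rw [one_mul]
    exact (ContinuousMap.norm_le _ (norm_nonneg _)).2 fun t ↦ le_rfl

theorem contDiff_radialRHS (hA : ContDiff ℝ ∞ A) (x₀ : X) : ContDiff ℝ ∞ (radialRHS hA x₀) := by
  have h1 : ContDiff ℝ ∞ (radialPath (Y := Y) x₀) :=
    contDiff_const.add (radialPathL X Y).contDiff
  exact ((constL Y).contDiff.comp (contDiff_snd.comp contDiff_fst)).add
    ((primitive Y).contDiff.comp ((ContinuousMap.contDiff_superpose _).comp h1))

/-- The derivative of the right hand side of the integral equation. -/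
def radialDeriv (hA : ContDiff ℝ ∞ A) (x₀ : X) (w : (X × Y) × C(unitInterval, Y)) :
    ((X × Y) × C(unitInterval, Y)) →L[ℝ] C(unitInterval, Y) :=
  (constL Y).comp ((ContinuousLinearMap.snd ℝ X Y).comp (ContinuousLinearMap.fst ℝ _ _)) +
    (primitive Y).comp ((ContinuousMap.applyL _ _ (ContinuousMap.superpose _
      (ContinuousMap.contDiff_fderiv (contDiff_eval_fst hA)) (radialPath x₀ w))).comp
        (radialPathL X Y))

theorem hasFDerivAt_radialRHS (hA : ContDiff ℝ ∞ A) (x₀ : X)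
    (w : (X × Y) × C(unitInterval, Y)) :
    HasFDerivAt (radialRHS hA x₀) (radialDeriv hA x₀ w) w := by
  have h1 := (ContinuousMap.hasFDerivAt_superpose (contDiff_eval_fst hA) (radialPath x₀ w)).comp w
    (hasFDerivAt_radialPath x₀ w)
  exact ((constL Y).hasFDerivAt.comp w (hasFDerivAt_snd.comp w hasFDerivAt_fst)).add
    ((primitive Y).hasFDerivAt.comp w h1)

theorem radialDeriv_apply (hA : ContDiff ℝ ∞ A) (x₀ : X) (w v : (X × Y) × C(unitInterval, Y))
    (t : unitInterval) : radialDeriv hA x₀ w v t = v.1.2 + ∫ s in (0 : ℝ)..t,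
      Set.IccExtend (zero_le_one (α := ℝ)) (fun s : unitInterval ↦
        fderiv ℝ A (x₀ + (s : ℝ) • w.1.1, w.2 s) ((s : ℝ) • v.1.1, v.2 s) w.1.1 +
          A (x₀ + (s : ℝ) • w.1.1, w.2 s) v.1.1) s := by
  have h : (ContinuousMap.applyL _ _ (ContinuousMap.superpose _
      (ContinuousMap.contDiff_fderiv (contDiff_eval_fst hA)) (radialPath x₀ w))
        (radialPathL X Y v) : unitInterval → Y) = fun s : unitInterval ↦
        fderiv ℝ A (x₀ + (s : ℝ) • w.1.1, w.2 s) ((s : ℝ) • v.1.1, v.2 s) w.1.1 +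
          A (x₀ + (s : ℝ) • w.1.1, w.2 s) v.1.1 := by
    funext s
    have h1 := fderiv_eval_fst hA (radialPath x₀ w s) (radialPathL X Y v s)
    rw [radialPath_apply] at h1
    rw [ContinuousMap.applyL_apply]
    change fderiv ℝ (fun q : (X × Y) × X ↦ A q.1 q.2) (radialPath x₀ w s) (radialPathL X Y v s) = _
    rw [radialPath_apply]
    exact h1
  rw [← h]
  rfl

/-- Smooth solutions of the integral equation `u(t) = y + ∫₀ᵗ A(x₀ + s ξ, u(s)) ξ ds`. -/
theorem exists_radial_solution [CompleteSpace X] [CompleteSpace Y] (hA : ContDiff ℝ ∞ A)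
    (z₀ : X × Y) : ∃ (u : X × Y → C(unitInterval, Y)) (O : Set (X × Y)), IsOpen O ∧ (0, z₀.2) ∈ O ∧
      ContDiffOn ℝ ∞ u O ∧ u (0, z₀.2) = ContinuousMap.const _ z₀.2 ∧
      ∀ z ∈ O, u z = radialRHS hA z₀.1 (z, u z) := by
  let w₀ : (X × Y) × C(unitInterval, Y) := ((0, z₀.2), ContinuousMap.const _ z₀.2)
  -- The zeros of the second component are the solutions. At ξ = 0 the right hand side does not
  -- depend on the unknown path to first order, so the derivative of `Ψ` is triangular with
  -- identities on the diagonal, and the local inverse at (z, 0) yields the solution.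
  let Ψ : (X × Y) × C(unitInterval, Y) → (X × Y) × C(unitInterval, Y) := fun w ↦
    (w.1, w.2 - radialRHS hA z₀.1 w)
  have hΨ : ContDiff ℝ ∞ Ψ :=
    contDiff_fst.prodMk (contDiff_snd.sub (contDiff_radialRHS hA z₀.1))
  let ℓ : (X × Y) →L[ℝ] C(unitInterval, Y) :=
    - (radialDeriv hA z₀.1 w₀).comp (ContinuousLinearMap.inl ℝ _ _)
  let Ψ' : ((X × Y) × C(unitInterval, Y)) ≃L[ℝ] (X × Y) × C(unitInterval, Y) :=
    (ContinuousLinearEquiv.refl ℝ _).skewProd (ContinuousLinearEquiv.refl ℝ _) ℓ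
  have hΨ' : HasFDerivAt Ψ (Ψ' : _ →L[ℝ] _) w₀ := by
    have h1 := (hasFDerivAt_fst (𝕜 := ℝ) (p := w₀)).prodMk
      ((hasFDerivAt_snd (𝕜 := ℝ) (p := w₀)).sub (hasFDerivAt_radialRHS hA z₀.1 w₀))
    have h2 : (Ψ' : _ →L[ℝ] _) = (ContinuousLinearMap.fst ℝ (X × Y) C(unitInterval, Y)).prod
        (ContinuousLinearMap.snd ℝ _ _ - radialDeriv hA z₀.1 w₀) := by
      refine ContinuousLinearMap.ext fun v ↦ Prod.ext rfl ?_
      ext t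
      change v.2 t + -radialDeriv hA z₀.1 w₀ (v.1, 0) t = v.2 t - radialDeriv hA z₀.1 w₀ v t
      rw [radialDeriv_apply, radialDeriv_apply]
      simp [w₀, sub_eq_add_neg]
    rw [h2]
    exact h1
  obtain ⟨e, hw₀, -, he, hsymm, -⟩ := hΨ.contDiffOn.exists_openPartialHomeomorph isOpen_univ
    (Set.mem_univ _) hΨ'
  have hΨ₀ : Ψ w₀ = ((0, z₀.2), 0) := by
    refine Prod.ext rfl ?_
    ext t
    change z₀.2 - (z₀.2 + primitive Y _ t) = 0
    rw [sub_add_cancel_left, neg_eq_zero, primitive_apply]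
    have : ∀ s : unitInterval, ContinuousMap.superpose _ (contDiff_eval_fst hA)
        (radialPath z₀.1 w₀) s = 0 := by
      intro s
      change A _ (radialPath z₀.1 w₀ s).2 = 0
      rw [radialPath_apply]
      exact map_zero _
    simp [Set.IccExtend, this]
  let O : Set (X × Y) := (fun z ↦ (z, (0 : C(unitInterval, Y)))) ⁻¹' e.target
  have hO : IsOpen O := e.open_target.preimage (by fun_prop)
  refine ⟨fun z ↦ (e.symm (z, 0)).2, O, hO, ?_, ?_, ?_, ?_⟩
  · change ((0, z₀.2), 0) ∈ e.target
    rw [← hΨ₀, ← he]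
    exact e.map_source hw₀
  · exact contDiff_snd.comp_contDiffOn (hsymm.comp (contDiff_id.prodMk contDiff_const).contDiffOn
      fun z hz ↦ hz)
  · have := e.left_inv hw₀
    rw [he, hΨ₀] at this
    simp only [this]
    rfl
  · intro z hz
    have h1 := e.right_inv (x := (z, 0)) hz
    rw [he] at h1
    have h2 : (e.symm (z, 0)).1 = z := congrArg Prod.fst h1
    have h3 : (e.symm (z, 0)).2 - radialRHS hA z₀.1 (e.symm (z, 0)) = 0 := congrArg Prod.snd h1
    have h4 : ((z, (e.symm (z, 0)).2) : (X × Y) × C(unitInterval, Y)) = e.symm (z, 0) :=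
      Prod.ext h2.symm rfl
    simp only [h4]
    exact sub_eq_zero.1 h3

end RadialODE

/-! ### The Frobenius theorem for graphs -/

section Frobenius

universe u

variable {X Y : Type u} [NormedAddCommGroup X] [NormedSpace ℝ X] [NormedAddCommGroup Y]
  [NormedSpace ℝ Y] {A : X × Y → X →L[ℝ] Y}

theorem hasDerivAt_primitive [CompleteSpace Y] (N : C(unitInterval, Y)) (t : ℝ) :
    HasDerivAt (fun t ↦ ∫ s in (0 : ℝ)..t, Set.IccExtend (zero_le_one (α := ℝ)) N s)
      (Set.IccExtend (zero_le_one (α := ℝ)) N t) t :=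
  ((continuous_IccExtend N).integral_hasStrictDerivAt 0 t).hasDerivAt

/-- The radial solutions have the prescribed derivatives in all directions, provided that the
integrability condition holds along them. -/
theorem radial_deriv_eq [CompleteSpace Y] (hA : ContDiff ℝ ∞ A) {x₀ η : X}
    {w : (X × Y) × C(unitInterval, Y)} {U : C(unitInterval, Y)} (hw : w.2 = radialRHS hA x₀ w)
    (hU : U = radialDeriv hA x₀ w ((η, 0), U))
    (hsymm : ∀ t : unitInterval, ∀ z, z = (x₀ + (t : ℝ) • w.1.1, w.2 t) →
      fderiv ℝ A z (w.1.1, A z w.1.1) η = fderiv ℝ A z (η, A z η) w.1.1) :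
    U 1 = A (x₀ + w.1.1, w.2 1) η := by
  set ξ := w.1.1 with hξ
  have hAc := hA.continuous
  have hA'c := (hA.continuous_fderiv (by simp))
  let N : C(unitInterval, Y) := ContinuousMap.superpose _ (contDiff_eval_fst hA) (radialPath x₀ w)
  have hN : ∀ s : unitInterval, N s = A (x₀ + (s : ℝ) • ξ, w.2 s) ξ := by
    intro s
    change A (radialPath x₀ w s).1 (radialPath x₀ w s).2 = _
    rw [radialPath_apply]
  let M : C(unitInterval, Y) := ⟨fun s ↦
    fderiv ℝ A (x₀ + (s : ℝ) • ξ, w.2 s) ((s : ℝ) • η, U s) ξ + A (x₀ + (s : ℝ) • ξ, w.2 s) η,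
    by fun_prop⟩
  let a : ℝ → Y := fun t ↦ w.1.2 + ∫ s in (0 : ℝ)..t, Set.IccExtend (zero_le_one (α := ℝ)) N s
  let b : ℝ → Y := fun t ↦ ∫ s in (0 : ℝ)..t, Set.IccExtend (zero_le_one (α := ℝ)) M s
  have ha : ∀ t : unitInterval, a t = w.2 t := by
    intro t
    conv_rhs => rw [hw]
    rfl
  have hb : ∀ t : unitInterval, b t = U t := by
    intro t
    conv_rhs => rw [hU, radialDeriv_apply, zero_add]
    rfl
  have hda : ∀ t, HasDerivAt a (Set.IccExtend (zero_le_one (α := ℝ)) N t) t := fun t ↦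
    (hasDerivAt_primitive N t).const_add _
  have hdb : ∀ t, HasDerivAt b (Set.IccExtend (zero_le_one (α := ℝ)) M t) t := fun t ↦
    hasDerivAt_primitive M t
  let c : ℝ → X × Y := fun t ↦ (x₀ + t • ξ, a t)
  have hdc : ∀ t, HasDerivAt c (ξ, Set.IccExtend (zero_le_one (α := ℝ)) N t) t := fun t ↦ by
    have h := ((hasDerivAt_id t).smul_const ξ).const_add x₀
    rw [one_smul] at h
    exact h.prodMk (hda t)
  have hcc : Continuous c := continuous_iff_continuousAt.2 fun t ↦ (hdc t).continuousAt
  -- `b` is the variation of the path in the direction η, and t A(c(t))η is what it should be. The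
  -- integrability condition turns the equation for the difference into v' = DA(0, v)ξ, which is
  -- linear and homogeneous with v(0) = 0; a Gronwall estimate gives v = 0.
  let v : ℝ → Y := fun t ↦ b t - t • A (c t) η
  have hdv : ∀ t, HasDerivAt v (Set.IccExtend (zero_le_one (α := ℝ)) M t -
      (t • fderiv ℝ A (c t) (ξ, Set.IccExtend (zero_le_one (α := ℝ)) N t) η + A (c t) η)) t := by
    intro t
    have h1 := (((hA.differentiable (by simp)).differentiableAt
      (x := c t)).hasFDerivAt.comp_hasDerivAt t (hdc t)).clm_apply (hasDerivAt_const t η)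
    rw [map_zero, add_zero] at h1
    have h2 := (hasDerivAt_id t).smul h1
    rw [one_smul] at h2
    exact (hdb t).sub h2
  obtain ⟨K, hK⟩ := (isCompact_Icc (a := (0 : ℝ)) (b := 1)).exists_bound_of_continuousOn
    (f := fun t ↦ ‖fderiv ℝ A (c t)‖) (hA'c.comp hcc).norm.continuousOn
  replace hK := fun t ht ↦ (le_abs_self _).trans (hK t ht)
  have hv0 : v 0 = 0 := by
    simp [v, b]
  have key := eq_zero_of_abs_deriv_le_mul_abs_self_of_eq_zero_right (f := v) (K := K * ‖ξ‖)
    (a := 0) (b := 1) (fun t _ ↦ (hdv t).continuousAt.continuousWithinAt)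
    (fun t _ ↦ (hdv t).hasDerivWithinAt) hv0 (fun t ht ↦ ?_) 1 ⟨zero_le_one, le_rfl⟩
  · have h1 : b 1 = A (c 1) η := by
      have := sub_eq_zero.1 key
      rwa [one_smul] at this
    rw [← hb 1, ← ha 1]
    change b 1 = _
    rw [h1]
    simp only [c, one_smul]
    rfl
  · have htI : t ∈ unitInterval := ⟨ht.1, ht.2.le⟩
    have hct : c t = (x₀ + t • ξ, w.2 ⟨t, htI⟩) := by
      rw [← ha ⟨t, htI⟩]
    have hNt : Set.IccExtend (zero_le_one (α := ℝ)) N t = A (c t) ξ := by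
      rw [Set.IccExtend_of_mem _ _ htI, hN, hct]
    have hMt : Set.IccExtend (zero_le_one (α := ℝ)) M t =
        fderiv ℝ A (c t) (t • η, b t) ξ + A (c t) η := by
      rw [Set.IccExtend_of_mem _ _ htI, hct]
      have := hb ⟨t, htI⟩
      change b t = _ at this
      rw [this]
      rfl
    have hs := hsymm ⟨t, htI⟩ (c t) hct
    rw [hNt, hMt, hs]
    have e : fderiv ℝ A (c t) (t • η, b t) ξ + A (c t) η -
        (t • fderiv ℝ A (c t) (η, A (c t) η) ξ + A (c t) η) =
        fderiv ℝ A (c t) (0, v t) ξ := by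
      have h3 : ((t • η, b t) : X × Y) = t • (η, A (c t) η) + (0, v t) := by
        simp [v]
      rw [h3, map_add, map_smul]
      simp
    rw [e]
    calc ‖fderiv ℝ A (c t) (0, v t) ξ‖ ≤ ‖fderiv ℝ A (c t) (0, v t)‖ * ‖ξ‖ :=
          ContinuousLinearMap.le_opNorm _ _
      _ ≤ (‖fderiv ℝ A (c t)‖ * ‖((0, v t) : X × Y)‖) * ‖ξ‖ := by
          gcongr
          exact ContinuousLinearMap.le_opNorm _ _
      _ ≤ (K * ‖v t‖) * ‖ξ‖ := by
          have h4 : ‖((0, v t) : X × Y)‖ = ‖v t‖ := by simp [Prod.norm_def]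
          rw [h4]
          gcongr
          exact hK t ⟨ht.1, ht.2.le⟩
      _ = K * ‖ξ‖ * ‖v t‖ := by ring

/-- Solutions of the integrable total differential equation `D_ξ F = A(x₀ + ξ, F)`. -/
theorem exists_total_differential_solution [CompleteSpace X] [CompleteSpace Y]
    (hA : ContDiff ℝ ∞ A) {z₀ : X × Y} {O : Set (X × Y)} (hO : IsOpen O) (hz₀ : z₀ ∈ O)
    (hsymm : ∀ z ∈ O, ∀ ξ η, fderiv ℝ A z (ξ, A z ξ) η = fderiv ℝ A z (η, A z η) ξ) :
    ∃ (F : X × Y → Y) (O' : Set (X × Y)), IsOpen O' ∧ (0, z₀.2) ∈ O' ∧ ContDiffOn ℝ ∞ F O' ∧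
      F (0, z₀.2) = z₀.2 ∧
      (∀ z ∈ O', ∀ η, fderiv ℝ F z (η, 0) = A (z₀.1 + z.1, F z) η) ∧
      ∀ δ, fderiv ℝ F (0, z₀.2) (0, δ) = δ := by
  obtain ⟨u, O₁, hO₁, hz₁, hu, hu₀, heq⟩ := exists_radial_solution hA z₀
  let ev : C(unitInterval, Y) →L[ℝ] Y := ContinuousMap.evalCLM ℝ 1
  have hud : ∀ z ∈ O₁, HasFDerivAt u (fderiv ℝ u z) z := fun z hz ↦
    (((hu z hz).contDiffAt (hO₁.mem_nhds hz)).differentiableAt (by simp)).hasFDerivAt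
  have hder : ∀ z ∈ O₁, ∀ v, fderiv ℝ u z v = radialDeriv hA z₀.1 (z, u z) (v, fderiv ℝ u z v) := by
    intro z hz v
    have h1 := (hasFDerivAt_radialRHS hA z₀.1 (z, u z)).comp z ((hasFDerivAt_id z).prodMk (hud z hz))
    have h2 := h1.congr_of_eventuallyEq (Filter.eventuallyEq_of_mem (hO₁.mem_nhds hz) heq)
    exact congrArg (fun L ↦ L v) ((hud z hz).unique h2)
  let g : X × Y → unitInterval → X × Y := fun z t ↦ (z₀.1 + (t : ℝ) • z.1, u z t)
  have hev : ∀ z ∈ O₁, HasFDerivAt (fun z ↦ u z 1) (ev.comp (fderiv ℝ u z)) z := fun z hz ↦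
    ev.hasFDerivAt.comp z (hud z hz)
  -- Integrability is only known on O. For parameters near the constant solution the whole ray curve
  -- stays in O.
  have hgnhds : ∀ᶠ z in nhds ((0 : X), z₀.2), ∀ t, g z t ∈ O := by
    obtain ⟨ε, hε, hball⟩ := Metric.isOpen_iff.1 hO z₀ hz₀
    have h1 : ∀ᶠ z in nhds ((0 : X), z₀.2), ‖z.1‖ < ε := by
      have : Continuous fun z : X × Y ↦ ‖z.1‖ := by fun_prop
      exact this.continuousAt.eventually_lt_const (by simpa using hε)
    have h2 := (hud _ hz₁).continuousAt.eventually (Metric.ball_mem_nhds _ hε)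
    filter_upwards [h1, h2] with z hz1 hz2 t
    refine hball ?_
    rw [Metric.mem_ball, dist_eq_norm, Prod.norm_def, max_lt_iff]
    constructor
    · simp only [g, Prod.fst_sub, add_sub_cancel_left]
      rw [norm_smul, Real.norm_of_nonneg t.2.1]
      exact (mul_le_of_le_one_left (norm_nonneg _) t.2.2).trans_lt hz1
    · rw [dist_eq_norm, hu₀] at hz2
      exact ((u z - ContinuousMap.const _ z₀.2).norm_coe_le_norm t).trans_lt hz2
  obtain ⟨O₂, hO₂, hO₂o, hz₂⟩ := eventually_nhds_iff.1 hgnhds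
  refine ⟨fun z ↦ u z 1, O₁ ∩ O₂, hO₁.inter hO₂o, ⟨hz₁, hz₂⟩,
    (ev.contDiff.comp_contDiffOn hu).mono Set.inter_subset_left, ?_, fun z hz η ↦ ?_, fun δ ↦ ?_⟩
  · simp only [hu₀]
    rfl
  · rw [(hev z hz.1).fderiv]
    refine radial_deriv_eq hA (w := (z, u z)) (heq z hz.1) (hder z hz.1 _) ?_
    rintro t _ rfl
    exact hsymm _ (hO₂ z hz.2 t) _ _
  · rw [(hev _ hz₁).fderiv]
    have h1 := hder _ hz₁ (0, δ)
    change fderiv ℝ u (0, z₀.2) (0, δ) 1 = δ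
    rw [h1, radialDeriv_apply]
    simp [Set.IccExtend]

end Frobenius

/-! ### The Frobenius theorem in a vector space -/

section Frobenius

universe u

variable {X Y : Type u} [NormedAddCommGroup X] [NormedSpace ℝ X] [NormedAddCommGroup Y]
  [NormedSpace ℝ Y]

/-- A smooth function extends from a neighbourhood of a point to a globally smooth one. -/
theorem ContDiffOn.exists_contDiff_eqOn_ball {E F : Type*} [NormedAddCommGroup E] [NormedSpace ℝ E]
    [FiniteDimensional ℝ E] [NormedAddCommGroup F] [NormedSpace ℝ F] {f : E → F} {O : Set E}
    (hO : IsOpen O) (hf : ContDiffOn ℝ ∞ f O) {a : E} (ha : a ∈ O) :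
    ∃ (g : E → F) (r : ℝ), 0 < r ∧ Metric.ball a r ⊆ O ∧ ContDiff ℝ ∞ g ∧
      Set.EqOn g f (Metric.ball a r) := by
  obtain ⟨R, hR, hball⟩ := Metric.isOpen_iff.1 hO a ha
  let χ : ContDiffBump a := ⟨R / 4, R / 2, by positivity, by linarith⟩
  refine ⟨fun z ↦ χ z • f z, R / 4, by positivity,
    (Metric.ball_subset_ball (by linarith)).trans hball, contDiff_iff_contDiffAt.2 fun z ↦ ?_,
    fun z hz ↦ ?_⟩
  · by_cases hz : z ∈ Metric.closedBall a (R / 2)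
    · have hzO : z ∈ O := hball (Metric.closedBall_subset_ball (by linarith) hz)
      exact χ.contDiff.contDiffAt.smul ((hf z hzO).contDiffAt (hO.mem_nhds hzO))
    · refine (contDiffAt_const (c := (0 : F))).congr_of_eventuallyEq ?_
      filter_upwards [Metric.isClosed_closedBall.isOpen_compl.mem_nhds hz] with y hy
      rw [Set.mem_compl_iff, Metric.mem_closedBall, not_le] at hy
      rw [χ.zero_of_le_dist hy.le, zero_smul]
  · simp only
    rw [χ.one_of_mem_closedBall (Metric.ball_subset_closedBall hz), one_smul]

/-- The Frobenius theorem for the graphs of `A z : X → Y`. -/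
theorem exists_frobenius_chart_graph [CompleteSpace X] [CompleteSpace Y] {A : X × Y → X →L[ℝ] Y}
    (hA : ContDiff ℝ ∞ A) {z₀ : X × Y} {O : Set (X × Y)} (hO : IsOpen O) (hz₀ : z₀ ∈ O)
    (hsymm : ∀ z ∈ O, ∀ ξ η, fderiv ℝ A z (ξ, A z ξ) η = fderiv ℝ A z (η, A z η) ξ) :
    ∃ e : OpenPartialHomeomorph (X × Y) (X × Y), z₀ ∈ e.source ∧ e.source ⊆ O ∧
      ContDiffOn ℝ ∞ e e.source ∧ ContDiffOn ℝ ∞ e.symm e.target ∧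
      ∀ z ∈ e.source, ∀ v, v.2 = A z v.1 ↔ (fderiv ℝ e z v).2 = 0 := by
  obtain ⟨F, O₁, hO₁, hz₁, hF, hF₀, hFx, hFy⟩ :=
    exists_total_differential_solution hA hO hz₀ hsymm
  -- `G` maps the slices with constant second coordinate to integral manifolds. Its derivative at
  -- the base point is triangular, so it is a local diffeomorphism, and the inverse is the
  -- straightening chart.
  let G : X × Y → X × Y := fun z ↦ (z₀.1 + z.1, F z)
  have hG : ContDiffOn ℝ ∞ G O₁ := (contDiff_const.add contDiff_fst).contDiffOn.prodMk hF
  have hO₂ : IsOpen (O₁ ∩ G ⁻¹' O) := hG.continuousOn.isOpen_inter_preimage hO₁ hO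
  have hG₀ : G (0, z₀.2) = z₀ := Prod.ext (add_zero _) hF₀
  have hd : ∀ z ∈ O₁, HasFDerivAt G
      ((ContinuousLinearMap.fst ℝ X Y).prod (fderiv ℝ F z)) z := fun z hz ↦
    (hasFDerivAt_fst.const_add _).prodMk
      (((hF z hz).contDiffAt (hO₁.mem_nhds hz)).differentiableAt (by simp)).hasFDerivAt
  let G' : (X × Y) ≃L[ℝ] X × Y :=
    (ContinuousLinearEquiv.refl ℝ X).skewProd (ContinuousLinearEquiv.refl ℝ Y) (A z₀)
  have hG' : HasFDerivAt G (G' : (X × Y) →L[ℝ] X × Y) (0, z₀.2) := by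
    have h2 : (G' : (X × Y) →L[ℝ] X × Y) =
        (ContinuousLinearMap.fst ℝ X Y).prod (fderiv ℝ F (0, z₀.2)) := by
      refine ContinuousLinearMap.ext fun v ↦ Prod.ext rfl ?_
      change v.2 + A z₀ v.1 = fderiv ℝ F (0, z₀.2) v
      have h3 : v = (v.1, 0) + (0, v.2) := by simp
      conv_rhs => rw [h3, map_add, hFy, hFx _ hz₁]
      rw [add_comm]
      congr 2
      exact congrArg A hG₀.symm
    rw [h2]
    exact hd _ hz₁
  obtain ⟨e, he₀, hesub, heG, hesymm, hinv⟩ := (hG.mono Set.inter_subset_left).exists_openPartialHomeomorph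
    hO₂ ⟨hz₁, by rw [Set.mem_preimage, hG₀]; exact hz₀⟩ hG'
  refine ⟨e.symm, ?_, ?_, hesymm, ?_, ?_⟩
  · have := e.map_source he₀
    rwa [heG, hG₀] at this
  · intro z hz
    have h1 := (hesub (e.map_target hz)).2
    rw [Set.mem_preimage, ← heG, e.right_inv hz] at h1
    exact h1
  · change ContDiffOn ℝ ∞ e e.source
    rw [heG]
    exact hG.mono fun z hz ↦ (hesub hz).1
  · intro z hz v
    have hζ := e.map_target hz
    obtain ⟨g, hg⟩ := hinv _ hζ
    have hgd : ∀ q, g q = (q.1, fderiv ℝ F (e.symm z) q) := fun q ↦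
      congrArg (fun L ↦ L q) (hg.unique (hd _ (hesub hζ).1))
    have hGz : G (e.symm z) = z := by rw [← heG, e.right_inv hz]
    have hg0 : ∀ η, g (η, 0) = (η, A z η) := by
      intro η
      rw [hgd, hFx _ (hesub hζ).1]
      refine Prod.ext rfl ?_
      exact congrArg (fun y ↦ A y η) hGz
    have he' : HasFDerivAt e.symm (g.symm : (X × Y) →L[ℝ] X × Y) z :=
      e.hasFDerivAt_symm hz (by rw [heG]; exact hg)
    rw [he'.fderiv]
    constructor
    · intro h
      have : v = g (v.1, 0) := by rw [hg0, ← h]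
      rw [this]
      change (g.symm (g (v.1, 0))).2 = 0
      rw [ContinuousLinearEquiv.symm_apply_apply]
    · intro h
      obtain ⟨q, rfl⟩ := g.surjective v
      change (g.symm (g q)).2 = 0 at h
      rw [ContinuousLinearEquiv.symm_apply_apply] at h
      have : q = (q.1, 0) := Prod.ext rfl h
      rw [this, hg0]

/-- The Frobenius theorem for the ranges of `σ z : X → X × Y`. -/
theorem exists_frobenius_chart [FiniteDimensional ℝ X] [FiniteDimensional ℝ Y]
    {σ : X × Y → X →L[ℝ] X × Y} {z₀ : X × Y} {O : Set (X × Y)} (hO : IsOpen O) (hz₀ : z₀ ∈ O)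
    (hσ : ContDiffOn ℝ ∞ σ O) (hσ₀ : σ z₀ = ContinuousLinearMap.inl ℝ X Y)
    (hinv : ∀ z ∈ O, ∀ w w', fderiv ℝ σ z (σ z w) w' - fderiv ℝ σ z (σ z w') w ∈
      Set.range (σ z)) :
    ∃ e : OpenPartialHomeomorph (X × Y) (X × Y), z₀ ∈ e.source ∧ e.source ⊆ O ∧
      ContDiffOn ℝ ∞ e e.source ∧ ContDiffOn ℝ ∞ e.symm e.target ∧
      ∀ z ∈ e.source, ∀ v, v ∈ Set.range (σ z) ↔ (fderiv ℝ e z v).2 = 0 := by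
  have : CompleteSpace X := FiniteDimensional.complete ℝ X
  have : CompleteSpace Y := FiniteDimensional.complete ℝ Y
  let a : X × Y → X →L[ℝ] X := fun z ↦ (ContinuousLinearMap.fst ℝ X Y).comp (σ z)
  have ha : ContDiffOn ℝ ∞ a O := contDiffOn_const.clm_comp hσ
  let R : Set (X →L[ℝ] X) := Set.range ((↑) : (X ≃L[ℝ] X) → X →L[ℝ] X)
  have hR : IsOpen R := ContinuousLinearEquiv.isOpen
  have hO₁ : IsOpen (O ∩ a ⁻¹' R) := ha.continuousOn.isOpen_inter_preimage hO hR
  let B : X × Y → X →L[ℝ] Y := fun z ↦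
    ((ContinuousLinearMap.snd ℝ X Y).comp (σ z)).comp (a z).inverse
  have hB : ContDiffOn ℝ ∞ B (O ∩ a ⁻¹' R) := by
    refine ((contDiffOn_const.clm_comp hσ).mono Set.inter_subset_left).clm_comp fun z hz ↦ ?_
    obtain ⟨g, hg⟩ := hz.2
    have h1 : ContDiffAt ℝ ∞ ContinuousLinearMap.inverse (a z) := by
      rw [← hg]
      exact contDiffAt_map_inverse g
    exact h1.comp_contDiffWithinAt z ((ha z hz.1).mono Set.inter_subset_left)
  have hBa : ∀ z ∈ O ∩ a ⁻¹' R, ∀ w, B z (a z w) = (σ z w).2 := by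
    rintro z ⟨-, g, hg⟩ w
    change (σ z ((a z).inverse (a z w))).2 = _
    rw [← hg, ContinuousLinearMap.inverse_equiv]
    simp
  -- The superposition operators need a map that is smooth everywhere, so the graph map is cut off
  -- away from a ball.
  obtain ⟨A, r, hr, hrO, hA, hAB⟩ := hB.exists_contDiff_eqOn_ball hO₁ (a := z₀)
    ⟨hz₀, ContinuousLinearEquiv.refl ℝ X, by ext w; simp [a, hσ₀]⟩
  have hrange : ∀ z ∈ Metric.ball z₀ r, ∀ v, v ∈ Set.range (σ z) ↔ v.2 = A z v.1 := by
    intro z hz v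
    rw [hAB hz]
    constructor
    · rintro ⟨w, rfl⟩
      exact (hBa z (hrO hz) w).symm
    · intro h
      obtain ⟨g, hg⟩ := (hrO hz).2
      have h1 : a z (g.symm v.1) = v.1 := by
        rw [← hg]
        exact g.apply_symm_apply _
      refine ⟨g.symm v.1, Prod.ext h1 ?_⟩
      rw [h]
      exact (hBa z (hrO hz) _).symm.trans (congrArg (B z) h1)
  have hσd : ∀ z ∈ Metric.ball z₀ r, HasFDerivAt σ (fderiv ℝ σ z) z := fun z hz ↦
    (((hσ z (hrO hz).1).contDiffAt (hO.mem_nhds (hrO hz).1)).differentiableAt (by simp)).hasFDerivAt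
  -- Differentiating A z (σ z w).1 = (σ z w).2 translates the bracket condition on the frame fields
  -- into the symmetry of DA along the graph.
  have hder : ∀ z ∈ Metric.ball z₀ r, ∀ d w, fderiv ℝ A z d (σ z w).1 =
      (fderiv ℝ σ z d w).2 - A z (fderiv ℝ σ z d w).1 := by
    intro z hz d w
    have hw := (hσd z hz).clm_apply (hasFDerivAt_const w z)
    have h1 := ((hA.differentiable (by simp)).differentiableAt (x := z)).hasFDerivAt.clm_apply
      hw.fst
    have h2 : (fun y ↦ A y (σ y w).1) =ᶠ[nhds z] fun y ↦ (σ y w).2 := by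
      filter_upwards [Metric.isOpen_ball.mem_nhds hz] with y hy
      rw [hAB hy]
      exact hBa y (hrO hy) w
    have h3 := congrArg (fun L ↦ L d) (h1.unique (hw.snd.congr_of_eventuallyEq h2))
    simp at h3
    rw [← h3]
    abel
  obtain ⟨e, he₀, heO, he, hesymm, hker⟩ := exists_frobenius_chart_graph hA Metric.isOpen_ball
    (Metric.mem_ball_self hr) (z₀ := z₀) fun z hz ξ η ↦ by
      obtain ⟨w, hw⟩ := (hrange z hz (ξ, A z ξ)).2 rfl
      obtain ⟨w', hw'⟩ := (hrange z hz (η, A z η)).2 rfl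
      have h1 := hder z hz (ξ, A z ξ) w'
      have h2 := hder z hz (η, A z η) w
      have h3 := (hrange z hz _).1 (hinv z (hrO hz).1 w w')
      change σ z w = _ at hw
      change σ z w' = _ at hw'
      rw [hw, hw'] at h3
      rw [hw'] at h1
      rw [hw] at h2
      simp only [Prod.snd_sub, Prod.fst_sub, map_sub] at h1 h2 h3
      rw [h1, h2, sub_eq_sub_iff_sub_eq_sub]
      exact h3
  exact ⟨e, he₀, fun z hz ↦ (hrO (heO hz)).1, he, hesymm, fun z hz v ↦
    (hrange z (heO hz) v).trans (hker z hz v)⟩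

end Frobenius

/-! ### Foliations -/

section Foliation

variable {p D : ℕ} {M : Type*} [TopologicalSpace M] [ChartedSpace (RVec D) M]

/-- Composing a chart with a local diffeomorphism of the model space gives a chart. -/
theorem trans_mem_maximalAtlas [IsManifold (𝓡 D) ∞ M] {c : OpenPartialHomeomorph M (RVec D)}
    (hc : c ∈ IsManifold.maximalAtlas (𝓡 D) ∞ M) {ψ : OpenPartialHomeomorph (RVec D) (RVec D)}
    (h : ContDiffOn ℝ ∞ ψ ψ.source) (h' : ContDiffOn ℝ ∞ ψ.symm ψ.target) :
    c.trans ψ ∈ IsManifold.maximalAtlas (𝓡 D) ∞ M := by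
  have hψ : ψ ∈ contDiffGroupoid ∞ (𝓡 D) := by
    rw [contDiffGroupoid, mem_groupoid_of_pregroupoid]
    constructor
    · refine (contDiffOn_id.comp (h.comp contDiffOn_id fun z hz ↦ hz.1) fun _ _ ↦ Set.mem_univ _)
    · refine (contDiffOn_id.comp (h'.comp contDiffOn_id fun z hz ↦ hz.1) fun _ _ ↦ Set.mem_univ _)
  intro c' hc'
  obtain ⟨h1, h2⟩ := hc c' hc'
  constructor
  · rw [OpenPartialHomeomorph.trans_symm_eq_symm_trans_symm, OpenPartialHomeomorph.trans_assoc]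
    exact (contDiffGroupoid ∞ (𝓡 D)).trans ((contDiffGroupoid ∞ (𝓡 D)).symm hψ) h1
  · rw [← OpenPartialHomeomorph.trans_assoc]
    exact (contDiffGroupoid ∞ (𝓡 D)).trans h2 hψ

/-- The transverse factor goes to the coordinates with indices below m, in keeping with the
convention of `Foliated`. -/
theorem exists_equiv_coordinates {n m : ℕ} (h : n + m = D) :
    ∃ e : ((Fin n → ℝ) × (Fin m → ℝ)) ≃L[ℝ] RVec D,
      ∀ q, q.2 = 0 ↔ ∀ i : Fin D, (i : ℕ) < m → e q i = 0 := by
  let ε : Fin D ≃ Fin n ⊕ Fin m :=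
    (finCongr (by omega : D = m + n)).trans (finSumFinEquiv.symm.trans (Equiv.sumComm _ _))
  have hε : ∀ a : Fin m, ((ε.symm (.inr a) : Fin D) : ℕ) = a := fun a ↦ by simp [ε]
  let e : ((Fin n → ℝ) × (Fin m → ℝ)) ≃ₗ[ℝ] RVec D :=
    ((LinearEquiv.sumArrowLequivProdArrow (Fin n) (Fin m) ℝ ℝ).symm.trans
      (LinearEquiv.funCongrLeft ℝ ℝ ε)).trans (WithLp.linearEquiv 2 ℝ (Fin D → ℝ)).symm
  have he : ∀ q i, e q i = Sum.elim q.1 q.2 (ε i) := by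
    intro q i
    rfl
  refine ⟨e.toContinuousLinearEquiv, fun q ↦ ?_⟩
  change _ ↔ ∀ i : Fin D, (i : ℕ) < m → e q i = 0
  constructor
  · intro hq i hi
    have h1 : i = ε.symm (.inr ⟨i, hi⟩) := Fin.ext (hε ⟨i, hi⟩).symm
    rw [he, h1, Equiv.apply_symm_apply, Sum.elim_inr, hq]
    rfl
  · intro hq
    funext a
    have h1 := hq (ε.symm (.inr a)) (by rw [hε]; exact a.2)
    rwa [he, Equiv.apply_symm_apply] at h1

theorem GalileanModel.exists_equiv_prod (S : GalileanModel p D) :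
    ∃ e : RVec D ≃L[ℝ] (Fin (finrank ℝ S.W) → ℝ) × (Fin (p + 1) → ℝ),
      ∀ v, v ∈ S.W ↔ (e v).2 = 0 := by
  obtain ⟨b⟩ := S.exists_adaptedBasis
  refine ⟨(b.b.equivFun.trans
    (LinearEquiv.sumArrowLequivProdArrow _ _ ℝ ℝ)).toContinuousLinearEquiv, fun v ↦ ?_⟩
  rw [b.mem_W_iff, funext_iff]
  refine forall_congr' fun a ↦ ?_
  change _ ↔ b.b.repr v (.inr a) = 0
  rw [b.repr_inr, mul_eq_zero, or_iff_right (inv_ne_zero (b.δ_ne a))]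

theorem mlieBracket_eq_lieBracket {E : Type*} [NormedAddCommGroup E] [NormedSpace ℝ E]
    (V W : ∀ x : E, TangentSpace 𝓘(ℝ, E) x) (z : E) : VectorField.mlieBracket 𝓘(ℝ, E) V W z = VectorField.lieBracket ℝ V W z := by
  rw [← VectorField.mlieBracketWithin_univ, VectorField.mlieBracketWithin_eq_lieBracketWithin]
  exact congrFun VectorField.lieBracketWithin_univ z

namespace GStructure

/-- The vector fields of a local frame in a chart. -/
def chartField (c : OpenPartialHomeomorph M (RVec D))
    (s : ∀ x : M, RVec D ≃L[ℝ] TangentSpace (𝓡 D) x) (w : RVec D) (z : RVec D) : RVec D :=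
  VectorField.mpullback 𝓘(ℝ, RVec D) (𝓡 D) c.symm (fun x ↦ s x w) z

variable {c : OpenPartialHomeomorph M (RVec D)} (hcd : c.MDifferentiable (𝓡 D) (𝓡 D))
  (hc : ContMDiffOn 𝓘(ℝ, RVec D) (𝓡 D) ∞ c.symm c.target)

include hcd in
theorem isInvertible_mfderiv_symm {z : RVec D} (hz : z ∈ c.target) :
    (mfderiv 𝓘(ℝ, RVec D) (𝓡 D) c.symm z).IsInvertible :=
  ⟨hcd.symm.mfderiv hz, rfl⟩

include hcd in
theorem inverse_mfderiv_symm_apply {z : RVec D} (hz : z ∈ c.target)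
    (v : TangentSpace (𝓡 D) (c.symm z)) :
    (mfderiv 𝓘(ℝ, RVec D) (𝓡 D) c.symm z).inverse v = mvfderiv (𝓡 D) c (c.symm z) v := by
  let T := hcd.symm.mfderiv hz
  have hT : T.toContinuousLinearMap =
      mfderiv 𝓘(ℝ, RVec D) (𝓡 D) c.symm z := rfl
  obtain ⟨q, rfl⟩ := T.surjective v
  rw [← hT, ContinuousLinearMap.inverse_equiv]
  refine (T.symm_apply_apply q).trans ?_
  exact (congrArg (fun L ↦ L q) (hcd.symm.symm_comp_deriv hz)).symm

variable [IsManifold (𝓡 D) ∞ M] {S : GalileanModel p D} {P : GStructure S M} {U : Set M}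
  {s : ∀ x : M, RVec D ≃L[ℝ] TangentSpace (𝓡 D) x}

include hcd hc in
theorem contDiffAt_chartField (hs : IsLocalSection P.frames U s) {z : RVec D} (hz : z ∈ c.target)
    (hzU : c.symm z ∈ U) (w : RVec D) : ContDiffAt ℝ ∞ (chartField c s w) z := by
  have h := ContMDiffAt.mpullback_vectorField_preimage (m := ∞) (n := ∞) (hs.contMDiffAt hzU w)
    ((hc z hz).contMDiffAt (c.open_target.mem_nhds hz)) (isInvertible_mfderiv_symm hcd hz) (by simp)
  rw [← contMDiffWithinAt_univ] at h
  exact contDiffWithinAt_univ.1 (contMDiffWithinAt_vectorSpace_iff_contDiffWithinAt.1 h)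

include hc in
theorem Involutive.exists_lieBracket_chartField_eq [T2Space M] (hP : P.Involutive)
    (hs : IsLocalSection P.frames U s) {z : RVec D} (hz : z ∈ c.target) (hzU : c.symm z ∈ U)
    {w w' : RVec D} (hw : w ∈ S.W) (hw' : w' ∈ S.W) : ∃ w'' ∈ S.W,
      VectorField.lieBracket ℝ (chartField c s w) (chartField c s w') z =
        chartField c s w'' z := by
  -- Involutivity speaks of global sections, so the frame fields are extended; the bracket only
  -- depends on germs.
  obtain ⟨Y, hY, hYe⟩ := exists_extension_E hs hzU hw
  obtain ⟨Y', hY', hYe'⟩ := exists_extension_E hs hzU hw'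
  have h1 := hP Y Y' hY hY' (c.symm z)
  have h2 : VectorField.mlieBracket (𝓡 D) Y Y' (c.symm z) =
      VectorField.mlieBracket (𝓡 D) (fun x ↦ s x w) (fun x ↦ s x w') (c.symm z) :=
    Filter.EventuallyEq.mlieBracket_vectorField_eq hYe hYe'
  rw [h2, mem_E_iff (hs.mem _ hzU)] at h1
  refine ⟨_, h1, ?_⟩
  have : IsManifold (𝓡 D) (minSmoothness ℝ 2) M := by
    rw [minSmoothness_of_isRCLikeNormedField]
    exact IsManifold.of_le (n := ∞) (WithTop.coe_le_coe.2 le_top)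
  have h3 := VectorField.mpullback_mlieBracket (n := ∞)
    ((hs.contMDiffAt hzU w).mdifferentiableAt (by simp))
    ((hs.contMDiffAt hzU w').mdifferentiableAt (by simp))
    ((hc z hz).contMDiffAt (c.open_target.mem_nhds hz))
    (by rw [minSmoothness_of_isRCLikeNormedField]; exact WithTop.coe_le_coe.2 le_top)
  refine (mlieBracket_eq_lieBracket _ _ _).symm.trans (h3.symm.trans ?_)
  rw [VectorField.mpullback_apply, chartField, VectorField.mpullback_apply,
    ContinuousLinearEquiv.apply_symm_apply]

/-- An involutive transverse bundle defines a foliation. -/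
theorem Involutive.foliated [T2Space M] (hP : P.Involutive) : P.Foliated := by
  intro x₀
  obtain ⟨U, s, hxU, hs⟩ := P.exists_section x₀
  let c := chartAt (RVec D) x₀
  have hcd : c.MDifferentiable (𝓡 D) (𝓡 D) := mdifferentiable_chart x₀
  have hc : ContMDiffOn 𝓘(ℝ, RVec D) (𝓡 D) ∞ c.symm c.target := contMDiffOn_chart_symm
  have hx₀ : x₀ ∈ c.source := mem_chart_source _ x₀
  obtain ⟨I₁, hI₁⟩ := S.exists_equiv_prod
  obtain ⟨I₂, hI₂⟩ := exists_equiv_coordinates S.finrank_W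
  -- The chart is followed by this linear map so that the frame of E at the base point becomes the
  -- inclusion of the first factor.
  let L : RVec D ≃L[ℝ] (Fin (finrank ℝ S.W) → ℝ) × (Fin (p + 1) → ℝ) :=
    (hcd.mfderiv hx₀).symm.trans ((s x₀).symm.trans I₁)
  let O : Set ((Fin (finrank ℝ S.W) → ℝ) × (Fin (p + 1) → ℝ)) :=
    L.symm ⁻¹' (c.target ∩ c.symm ⁻¹' U)
  have hO : IsOpen O := (c.isOpen_inter_preimage_symm hs.isOpen).preimage L.symm.continuous
  let J : (Fin (finrank ℝ S.W) → ℝ) →L[ℝ] RVec D :=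
    (I₁.symm : (Fin (finrank ℝ S.W) → ℝ) × (Fin (p + 1) → ℝ) →L[ℝ] RVec D).comp
      (ContinuousLinearMap.inl ℝ _ _)
  have hJ : ∀ v, v ∈ S.W ↔ ∃ ξ, J ξ = v := by
    intro v
    rw [hI₁]
    constructor
    · intro h
      refine ⟨(I₁ v).1, I₁.injective ?_⟩
      exact (I₁.apply_symm_apply _).trans (Prod.ext rfl h.symm)
    · rintro ⟨ξ, rfl⟩
      exact congrArg Prod.snd (I₁.apply_symm_apply (ξ, 0))
  -- The frame fields of E, transported to the product space; the vector ξ parametrises W through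
  -- `J`.
  let σ : (Fin (finrank ℝ S.W) → ℝ) × (Fin (p + 1) → ℝ) → (Fin (finrank ℝ S.W) → ℝ) →L[ℝ]
      (Fin (finrank ℝ S.W) → ℝ) × (Fin (p + 1) → ℝ) := fun ζ ↦
    (L : RVec D →L[ℝ] (Fin (finrank ℝ S.W) → ℝ) × (Fin (p + 1) → ℝ)).comp
      (((mfderiv 𝓘(ℝ, RVec D) (𝓡 D) c.symm (L.symm ζ)).inverse.comp
        (s (c.symm (L.symm ζ)) : RVec D →L[ℝ] TangentSpace (𝓡 D) (c.symm (L.symm ζ)))).comp J)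
  have hσ : ∀ ζ ξ, σ ζ ξ = L (chartField c s (J ξ) (L.symm ζ)) := fun ζ ξ ↦ rfl
  have hV : ∀ ζ ∈ O, ∀ w, ContDiffAt ℝ ∞ (chartField c s w) (L.symm ζ) := fun ζ hζ w ↦
    contDiffAt_chartField hcd hc hs hζ.1 hζ.2 w
  have hσd : ContDiffOn ℝ ∞ σ O := by
    refine contDiffOn_clm_apply.2 fun ξ ζ hζ ↦ ContDiffAt.contDiffWithinAt ?_
    exact L.contDiff.contDiffAt.comp ζ ((hV ζ hζ (J ξ)).comp ζ L.symm.contDiff.contDiffAt)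
  have hσ' : ∀ ζ ∈ O, ∀ d ξ, fderiv ℝ σ ζ d ξ =
      L (fderiv ℝ (chartField c s (J ξ)) (L.symm ζ) (L.symm d)) := by
    intro ζ hζ d ξ
    have h1 := (((hσd ζ hζ).contDiffAt (hO.mem_nhds hζ)).differentiableAt
      (by simp)).hasFDerivAt.clm_apply (hasFDerivAt_const ξ ζ)
    have h2 := (L.hasFDerivAt (x := chartField c s (J ξ) (L.symm ζ))).comp ζ
      ((((hV ζ hζ (J ξ)).differentiableAt (by simp)).hasFDerivAt).comp ζ L.symm.hasFDerivAt)
    have h3 := congrArg (fun T ↦ T d) (h1.unique h2)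
    simpa using h3
  have hx₀' : c.symm (c x₀) = x₀ := c.left_inv hx₀
  have hζ₀ : L (c x₀) ∈ O := by
    change L.symm (L (c x₀)) ∈ c.target ∩ c.symm ⁻¹' U
    rw [ContinuousLinearEquiv.symm_apply_apply]
    exact ⟨c.map_source hx₀, by rw [Set.mem_preimage, hx₀']; exact hxU⟩
  have hσ₀ : σ (L (c x₀)) = ContinuousLinearMap.inl ℝ _ _ := by
    refine ContinuousLinearMap.ext fun ξ ↦ ?_
    have h1 : ∀ x, x = x₀ → L (mvfderiv (𝓡 D) c x (s x (J ξ))) = (ξ, 0) := by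
      rintro x rfl
      change I₁ ((s x).symm ((hcd.mfderiv hx₀).symm (hcd.mfderiv hx₀ (s x (J ξ))))) = _
      rw [ContinuousLinearEquiv.symm_apply_apply, ContinuousLinearEquiv.symm_apply_apply]
      exact I₁.apply_symm_apply (ξ, 0)
    refine Eq.trans ?_ (h1 _ hx₀')
    rw [hσ, ContinuousLinearEquiv.symm_apply_apply]
    exact congrArg L (inverse_mfderiv_symm_apply hcd (c.map_source hx₀) _)
  obtain ⟨e, he₀, heO, he, hesymm, hker⟩ := exists_frobenius_chart hO hζ₀ hσd hσ₀ (by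
    intro ζ hζ ξ ξ'
    obtain ⟨w, hw, h1⟩ := hP.exists_lieBracket_chartField_eq hc hs hζ.1 hζ.2
      ((hJ _).2 ⟨ξ, rfl⟩) ((hJ _).2 ⟨ξ', rfl⟩)
    obtain ⟨η, rfl⟩ := (hJ w).1 hw
    refine ⟨η, ?_⟩
    rw [hσ' ζ hζ, hσ' ζ hζ, hσ, hσ, hσ, ContinuousLinearEquiv.symm_apply_apply,
      ContinuousLinearEquiv.symm_apply_apply, ← map_sub, ← h1]
    rfl)
  let ψ : OpenPartialHomeomorph (RVec D) (RVec D) :=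
    (L.toHomeomorph.toOpenPartialHomeomorph.trans e).trans I₂.toHomeomorph.toOpenPartialHomeomorph
  have hψs : ∀ z, z ∈ ψ.source ↔ L z ∈ e.source := fun z ↦ by simp [ψ]
  have hψt : ∀ z, z ∈ ψ.target ↔ I₂.symm z ∈ e.target := fun z ↦ by simp [ψ]
  have hψ : ∀ z, ψ z = I₂ (e (L z)) := fun z ↦ rfl
  refine ⟨c.trans ψ, trans_mem_maximalAtlas (IsManifold.chart_mem_maximalAtlas x₀) ?_ ?_, ?_, ?_⟩
  · exact I₂.contDiff.comp_contDiffOn (he.comp L.contDiff.contDiffOn fun z hz ↦ (hψs z).1 hz)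
  · exact L.symm.contDiff.comp_contDiffOn (hesymm.comp I₂.symm.contDiff.contDiffOn
      fun z hz ↦ (hψt z).1 hz)
  · rw [OpenPartialHomeomorph.trans_source]
    exact ⟨hx₀, (hψs _).2 he₀⟩
  · intro x hx v
    rw [OpenPartialHomeomorph.trans_source] at hx
    obtain ⟨z, hz, rfl⟩ : ∃ z ∈ c.target, c.symm z = x := ⟨c x, c.map_source hx.1, c.left_inv hx.1⟩
    have hcz : c (c.symm z) = z := c.right_inv hz
    have hζ : L z ∈ e.source := by
      have := (hψs _).1 hx.2
      rwa [hcz] at this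
    have hζO := heO hζ
    have hzU : c.symm z ∈ U := by
      have := hζO.2
      rwa [Set.mem_preimage, ContinuousLinearEquiv.symm_apply_apply] at this
    have hφ : HasFDerivAt ψ ((I₂ : (Fin (finrank ℝ S.W) → ℝ) × (Fin (p + 1) → ℝ) →L[ℝ] RVec D).comp
        ((fderiv ℝ e (L z)).comp (L : RVec D →L[ℝ] _))) (c (c.symm z)) := by
      rw [hcz]
      have h1 := ((he _ hζ).contDiffAt (e.open_source.mem_nhds hζ)).differentiableAt (by simp)
      exact I₂.hasFDerivAt.comp z (h1.hasFDerivAt.comp z L.hasFDerivAt)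
    have hv := mvfderiv_comp_of_hasFDerivAt (I := 𝓡 D) hφ
      (hcd.mdifferentiableAt (c.map_target hz)) v
    have hv' : mvfderiv (𝓡 D) (c.trans ψ) (c.symm z) v =
        I₂ (fderiv ℝ e (L z) (L (mvfderiv (𝓡 D) c (c.symm z) v))) := hv
    rw [hv', ← hI₂, ← hker _ hζ, mem_E_iff (hs.mem _ hzU), ← inverse_mfderiv_symm_apply hcd hz]
    constructor
    · intro h
      obtain ⟨ξ, hξ⟩ := (hJ _).1 h
      refine ⟨ξ, ?_⟩
      rw [hσ, ContinuousLinearEquiv.symm_apply_apply, hξ, chartField, VectorField.mpullback_apply,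
        ContinuousLinearEquiv.apply_symm_apply]
    · rintro ⟨ξ, hξ⟩
      rw [hσ, ContinuousLinearEquiv.symm_apply_apply] at hξ
      have h1 := L.injective hξ
      obtain ⟨T, hT⟩ := isInvertible_mfderiv_symm hcd hz
      rw [chartField, VectorField.mpullback_apply, ← hT, ContinuousLinearMap.inverse_equiv] at h1
      have h2 := T.symm.injective h1
      rw [← h2, ContinuousLinearEquiv.symm_apply_apply]
      exact (hJ _).2 ⟨ξ, rfl⟩

end GStructure

end Foliation

end

/-! ### The classification and the geometric characterisations together -/

theorem mainTheorem1 (p D : ℕ) (hp : 1 < p) (hD : p + 3 < D) (S : GalileanModel p D)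
    (Ω₀ : RVec D [⋀^Fin (p + 1)]→ₗ[ℝ] ℝ) (hΩ₀ : Ω₀ ≠ 0)
    (hΩ₀W : ∀ m : Fin (p + 1) → RVec D, (∃ i, m i ∈ S.W) → Ω₀ m = 0)
    -- the submodules of the cokernel of the Spencer differential
    (Ttr T0 Tinv : Submodule ℝ S.Coker)
    (hTtr : Ttr = S.torsTr.map (LinearMap.range S.spencer).mkQ)
    (hT0 : T0 = S.torsZero.map (LinearMap.range S.spencer).mkQ)
    (hTinv : Tinv = S.torsInv.map (LinearMap.range S.spencer).mkQ) :
    -- there are five distinct `G`-submodules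
    ((∀ N ∈ [⊥, Ttr, T0, Tinv, ⊤], S.IsGSubmodule N) ∧
      [⊥, Ttr, T0, Tinv, ⊤].Nodup ∧
      Ttr ⊓ T0 = ⊥ ∧ Ttr ⊔ T0 = Tinv) ∧
    -- there are no further `G`-submodules; when `D = p + 5`, i.e. `dim W = 4`, this presupposes
    -- that the inner product `γ` on `W` is Lorentzian, i.e. has negative Gram determinants
    ((D = p + 5 → ∃ b : Basis (Fin 4) ℝ S.W,
        (Matrix.of fun i j ↦ S.γ (b i) (b j)).det < 0) →
      ∀ N : Submodule ℝ S.Coker, S.IsGSubmodule N → N ∈ [⊥, Ttr, T0, Tinv, ⊤]) ∧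
    -- geometric characterisations
    ∀ (M : Type*) [TopologicalSpace M] [ChartedSpace (RVec D) M] [IsManifold (𝓡 D) ∞ M]
      [T2Space M] [SigmaCompactSpace M] (P : GStructure S M)
      (cov : CovariantDerivative (𝓡 D) (RVec D) (TangentSpace (𝓡 D) : M → Type _)),
      P.IsAdapted cov →
      -- (0) generic intrinsic torsion
      P.IntrinsicTorsionIn cov ⊤ ∧
      -- (1) `E` is involutive, so that `M` is foliated by integral submanifolds of `E`, on which
      -- `h` induces the metric `γ`
      (P.IntrinsicTorsionIn cov Tinv ↔ P.Involutive) ∧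
      (P.Involutive → P.Foliated) ∧
      (∀ x : M, ∀ Z : TangentSpace (𝓡 D) x, Z ∈ P.E x ↔
        ∃ α : Dual ℝ (TangentSpace (𝓡 D) x), (∀ β, P.h x β α = β Z) ∧
          ∀ Y ∈ P.E x, P.γ x Z Y = α Y) ∧
      -- (2) `L_X η = 2 γ(X, Z) η`
      (P.IntrinsicTorsionIn cov Ttr ↔
        ∃ Z : ∀ x : M, TangentSpace (𝓡 D) x, P.IsSectionE Z ∧
          ∀ X : ∀ x : M, TangentSpace (𝓡 D) x, P.IsSectionE X →
            ∀ Y Y' : ∀ x : M, TangentSpace (𝓡 D) x, IsSmoothVF Y → IsSmoothVF Y' →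
              ∀ x, P.lieDerivη X Y Y' x = 2 * P.γ x (X x) (Z x) * P.η x (Y x) (Y' x)) ∧
      -- (3) `dΩ = 0`
      (P.IntrinsicTorsionIn cov T0 ↔
        ∀ X : Fin (p + 2) → ∀ x : M, TangentSpace (𝓡 D) x, (∀ i, IsSmoothVF (X i)) →
          ∀ x, P.dΩ Ω₀ X x = 0) ∧
      -- (4) `L_X η = 0`: vanishing intrinsic torsion
      (P.IntrinsicTorsionIn cov ⊥ ↔
        ∀ X : ∀ x : M, TangentSpace (𝓡 D) x, P.IsSectionE X →
          ∀ Y Y' : ∀ x : M, TangentSpace (𝓡 D) x, IsSmoothVF Y → IsSmoothVF Y' →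
            ∀ x, P.lieDerivη X Y Y' x = 0) := by
  subst hTtr hT0 hTinv
  obtain ⟨b⟩ := S.exists_adaptedBasis
  have hW : finrank ℝ S.W = D - (p + 1) := by
    have := S.finrank_W
    omega
  have : Nontrivial (Fin (finrank ℝ S.W)) := Fin.nontrivial_iff_two_le.2 (by omega)
  have : Nontrivial (Fin (p + 1)) := Fin.nontrivial_iff_two_le.2 (by omega)
  refine ⟨⟨fun N hN ↦ S.isGSubmodule_of_mem hN, b.nodup_submodules, GalileanModel.torsTr_inf_torsZero_map,
    GalileanModel.torsTr_sup_torsZero_map⟩, fun hγ N hN ↦ ?_, ?_⟩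
  -- From p + 3 < D and 1 < p both dim W = D - p - 1 and dim V/W = p + 1 are at least three. The
  -- condition in dimension four is the case D = p + 5.
  · refine b.submodule_cases (by simp; omega) (by simp; omega) (fun h ↦ ?_) hN
    obtain ⟨c, hc⟩ := hγ (by simp at h; omega)
    exact b.prod_ε_neg_of_det_neg c hc
  · intro M _ _ _ _ _ P cov hcov
    exact ⟨fun _ _ _ ↦ trivial, hcov.intrinsicTorsionIn_torsInv_iff,
      GStructure.Involutive.foliated, P.mem_E_iff_exists_dual, hcov.intrinsicTorsionIn_torsTr_iff,
      hcov.intrinsicTorsionIn_torsZero_iff hΩ₀ hΩ₀W, hcov.intrinsicTorsionIn_bot_iff⟩
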